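/- **Setting.** Let $\mathcal J$ be a countable set (of sorts), let $\mathcal J^{<\mathbb N}$ be the set of non-empty finite tuples from $\mathcal J$, and fix a function $J^*_\subset:\mathbb N_{>0}\times\mathcal J^{<\mathbb N}\to\mathcal J^{<\mathbb N}$. For a tuple $J$ let $\Vert J\Vert$ be its set of entries and $\sqrt J=\{J':\Vert J\Vert\subset\Vert J'\Vert\}$. *Sorting data* on a profinite group $G$ assign to each open normal subgroup $N$ a non-empty set $F(N)\subset\mathcal J^{<\mathbb N}$ such that $F(G)=\mathcal J^{<\mathbb N}$; $J\in F(N)\Leftrightarrow\sqrt J\subset F(N)$; $F(N)$ is closed under permuting the entries of tuples; if $N_1\subset N_2$, $[G:N_1]\le k$ and $J\in F(N_1)$, then $J^*_\subset(k,J)\in F(N_2)$; if $J_i\in F(N_i)$ for $i=1,2$, then $J_1{}^\frown J_2\in F(N_1\cap N_2)$; and $F(N_1)=F(N_2)$ if $N_1,N_2$ are conjugate in $G$. Let $\mathcal L$ be the many-sorted first-order language with a sort $m(k,J)$ for each $(k,J)\in\mathbb N_{>0}\times\mathcal J^{<\mathbb N}$ (distinct sorts being disjoint), binary relations $\le$ and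 $C$ between any two sorts, and a ternary relation $P$ on each sort. The $\mathcal L$-structure $S(G,F)$ has as elements of sort $m(k,J)$ the cosets $gN$ with $N$ open normal, $[G:N]\le k$, $J\in F(N)$; $gN\le g'N'$ means $N\subset N'$; $C(gN,g'N')$ means $gN\subset g'N'$; and $P(g_1N,g_2N,g_3N)$ means $g_1g_2N=g_3N$. A *sorted complete system* is an $\mathcal L$-structure isomorphic to some $S(G,F)$. Write $a\sim b$ if $a\le b\le a$. A *subsystem* of a sorted complete system $S$ is a substructure that is itself a sorted complete system; $S_X$ is the smallest subsystem containing $X\subset S$, and a subsystem is *finitely generated* if it is $S_X$ with $X$ finite. A set $X\subset S$ is a *presystem* if (locally full) whenever $x\in X$ has sort $m(k,J)$, $y$ has sort $m(k,J)$ and $x\sim y$, then $y\in X$, and (relatively dense) for every $s\in S_X$ there is $x\in X$ with $x\le s$. Let $\operatorname{coFSIm}(S)$ be the set of isomorphism classes of finitely generated subsystems of $S$. $S$ has *co-SEP* if for all finitely generated subsystems $S_1,S_2$ of $S$ and all embeddings $\Pi:S_2\to S_1$ and $\Phi:S_2\to S$ there is an embedding $\Psi:S_1\to S$ with $\Psi\circ\Pi=\Phi$.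 Let $SCS_{SEP}$ be the set of all $\mathcal L$-sentences true in every sorted complete system having co-SEP. **Theorem.** Let $S$ be a sorted complete system having co-SEP. 1. The models of $SCS_{SEP}$ are exactly the sorted complete systems having co-SEP. 2. For every finitely generated sorted complete system $A$, each of the two properties of a sorted complete system $M$, * there is a finite presystem $X$ of $M$ with $S_X\cong A$; * for every finite presystem $Y$ of $M$, $S_Y\not\cong A$ (where $S_X$, $S_Y$ are formed in $M$), is expressed, over all sorted complete systems $M$, by an $\mathcal L$-sentence. 3. $\operatorname{Th}(S)$ is axiomatized by $SCS_{SEP}$ together with the following axioms: for every $S_1\in\operatorname{coFSIm}(S)$, "there is a finite presystem $X$ with $S_X\cong S_1$", and for every finitely generated sorted complete system $S_2$ whose isomorphism class is not in $\operatorname{coFSIm}(S)$, "for every finite presystem $Y$, $S_Y\not\cong S_2$". That is, an $\mathcal L$-structure is a model of $\operatorname{Th}(S)$ if and only if it is a model of all these axioms. -/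

import Mathlib

universe u v w w'

namespace SortedSystem

/-! ### Sorts and sorted profinite groups -/

/-- Non-empty finite tuples of elements of `J`. -/
def Tup (J : Type u) : Type u := {l : List J // l ≠ []}

/-- The set of entries of a tuple. -/
def Tup.support {J : Type u} (T : Tup J) : Set J := {j | j ∈ T.1}

/-- Concatenation of tuples. -/
def Tup.append {J : Type u} (T T' : Tup J) : Tup J :=
  ⟨T.1 ++ T'.1, fun h => T.2 (List.append_eq_nil_iff.1 h).1⟩

/-- The tuples in which every entry of `T` occurs. -/
def Tup.root {J : Type u} (T : Tup J) : Set (Tup J) := {T' | T.support ⊆ T'.support}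

/-- The sorts `(k, T)` of the language: a positive integer and a non-empty tuple. -/
abbrev Srt (J : Type u) : Type u := ℕ+ × Tup J

/-- Sorting data on a profinite group `G`, with respect to the set of sorts `J` and the fixed
function `Jsub` (the second fixed function is concatenation of tuples). -/
structure SortingData {J : Type u} (Jsub : ℕ+ → Tup J → Tup J) (G : ProfiniteGrp.{w}) where
  F : OpenNormalSubgroup G → Set (Tup J)
  nonempty : ∀ N, (F N).Nonempty
  whole : ∀ N : OpenNormalSubgroup G, N.toSubgroup = ⊤ → F N = Set.univ
  root : ∀ N T, T ∈ F N ↔ T.root ⊆ F N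
  perm : ∀ N (T T' : Tup J), T.1.Perm T'.1 → (T ∈ F N ↔ T' ∈ F N)
  up : ∀ (N₁ N₂ : OpenNormalSubgroup G) (k : ℕ+) (T : Tup J), N₁ ≤ N₂ →
    N₁.toSubgroup.index ≤ k → T ∈ F N₁ → Jsub k T ∈ F N₂
  inter : ∀ (N₁ N₂ : OpenNormalSubgroup G) (T₁ T₂ : Tup J),
    T₁ ∈ F N₁ → T₂ ∈ F N₂ → T₁.append T₂ ∈ F (N₁ ⊓ N₂)
  conj : ∀ (N₁ N₂ : OpenNormalSubgroup G) (g : G),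
    (∀ x : G, x ∈ N₂ ↔ g * x * g⁻¹ ∈ N₁) → F N₁ = F N₂

/-! ### Structures for the many-sorted language -/

/-- Structures for the many-sorted relational language with sorts `(k, T)`, binary relations
`≤` and `C` between any two sorts, and a ternary relation `P` on each sort. -/
structure Str (J : Type u) where
  carrier : Srt J → Type w
  le : ∀ {s t : Srt J}, carrier s → carrier t → Prop
  C : ∀ {s t : Srt J}, carrier s → carrier t → Prop
  P : ∀ {s : Srt J}, carrier s → carrier s → carrier s → Prop

/-- The elements of a structure, of all sorts (the sorts are disjoint). -/
abbrev Str.Elt {J : Type u} (M : Str.{u, w} J) : Type (max u w) := Σ s : Srt J, M.carrier s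

/-- The substructure on a set of elements (the language is relational). -/
def Str.restrict {J : Type u} (M : Str.{u, w} J) (X : Set M.Elt) : Str.{u, w} J where
  carrier s := {a : M.carrier s // (⟨s, a⟩ : M.Elt) ∈ X}
  le a b := M.le a.1 b.1
  C a b := M.C a.1 b.1
  P a b c := M.P a.1 b.1 c.1

/-- Embeddings of structures. -/
structure Emb {J : Type u} (M : Str.{u, w} J) (N : Str.{u, w'} J) where
  toFun : ∀ s : Srt J, M.carrier s → N.carrier s
  inj : ∀ s, Function.Injective (toFun s)
  map_le : ∀ {s t : Srt J} (a : M.carrier s) (b : M.carrier t),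
    N.le (toFun s a) (toFun t b) ↔ M.le a b
  map_C : ∀ {s t : Srt J} (a : M.carrier s) (b : M.carrier t),
    N.C (toFun s a) (toFun t b) ↔ M.C a b
  map_P : ∀ {s : Srt J} (a b c : M.carrier s),
    N.P (toFun s a) (toFun s b) (toFun s c) ↔ M.P a b c

/-- Two structures are isomorphic: there is a surjective embedding. -/
def Iso {J : Type u} (M : Str.{u, w} J) (N : Str.{u, w'} J) : Prop :=
  ∃ f : Emb M N, ∀ s, Function.Surjective (f.toFun s)

/-! ### Sorted complete systems -/

/-- The sorted complete system of a sorted profinite group: the elements of sort `(k, T)` are the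
cosets of the open normal subgroups `N` with `[G : N] ≤ k` and `T ∈ F N`; the relation `a ≤ b` is
inclusion of the subgroups, `C a b` is inclusion of the cosets, and `P` is the graph of the
multiplication of `G ⧸ N`. -/
def systemOf {J : Type u} {Jsub : ℕ+ → Tup J → Tup J} (G : ProfiniteGrp.{w})
    (D : SortingData Jsub G) : Str.{u, w} J where
  carrier s := Σ N : {N : OpenNormalSubgroup G // N.toSubgroup.index ≤ s.1 ∧ s.2 ∈ D.F N},
    G ⧸ N.1.toSubgroup
  le a b := a.1.1 ≤ b.1.1
  C a b := ∀ g : G, (QuotientGroup.mk g : G ⧸ a.1.1.toSubgroup) = a.2 →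
    (QuotientGroup.mk g : G ⧸ b.1.1.toSubgroup) = b.2
  P a b c := ∃ (N : _) (x y : G ⧸ N.1.toSubgroup), a = ⟨N, x⟩ ∧ b = ⟨N, y⟩ ∧ c = ⟨N, x * y⟩

/-- `M` is a sorted complete system: it is isomorphic to the system of some sorted profinite
group. -/
def IsSCS {J : Type u} (Jsub : ℕ+ → Tup J → Tup J) (M : Str.{u, w} J) : Prop :=
  ∃ (G : ProfiniteGrp.{w}) (D : SortingData Jsub G), Iso (systemOf G D) M

/-- The set `A` carries a subsystem of `M`: a substructure that is a sorted complete system. -/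
def IsSubsystem {J : Type u} (Jsub : ℕ+ → Tup J → Tup J) (M : Str.{u, w} J)
    (A : Set M.Elt) : Prop :=
  IsSCS Jsub (M.restrict A)

/-- The smallest subsystem that contains `X`. -/
def generated {J : Type u} (Jsub : ℕ+ → Tup J → Tup J) (M : Str.{u, w} J)
    (X : Set M.Elt) : Set M.Elt :=
  ⋂₀ {A | IsSubsystem Jsub M A ∧ X ⊆ A}

/-- Finitely generated subsystems of `M`. -/
def IsFGSubsystem {J : Type u} (Jsub : ℕ+ → Tup J → Tup J) (M : Str.{u, w} J)
    (A : Set M.Elt) : Prop :=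
  IsSubsystem Jsub M A ∧ ∃ X : Set M.Elt, X.Finite ∧ generated Jsub M X = A

/-- `M` is a finitely generated sorted complete system. -/
def IsFGSystem {J : Type u} (Jsub : ℕ+ → Tup J → Tup J) (M : Str.{u, w} J) : Prop :=
  IsSCS Jsub M ∧ ∃ X : Set M.Elt, X.Finite ∧ generated Jsub M X = Set.univ

/-- The isomorphism class of `A` belongs to `coFSIm(M)`: `A` is isomorphic to a finitely generated
subsystem of `M`. -/
def InCoFSIm {J : Type u} (Jsub : ℕ+ → Tup J → Tup J) (M A : Str.{u, w} J) : Prop :=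
  ∃ B : Set M.Elt, IsFGSubsystem Jsub M B ∧ Iso (M.restrict B) A

/-- `X` is locally full: together with an element of `M(k, T)` it contains all the elements of
`M(k, T)` which are `∼`-equivalent to it. -/
def LocallyFull {J : Type u} (M : Str.{u, w} J) (X : Set M.Elt) : Prop :=
  ∀ (s : Srt J) (a b : M.carrier s), (⟨s, a⟩ : M.Elt) ∈ X → M.le a b → M.le b a →
    (⟨s, b⟩ : M.Elt) ∈ X

/-- `X` is relatively dense: every element of the subsystem generated by `X` lies above an element
of `X`. -/
def RelativelyDense {J : Type u} (Jsub : ℕ+ → Tup J → Tup J) (M : Str.{u, w} J)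
    (X : Set M.Elt) : Prop :=
  ∀ p ∈ generated Jsub M X, ∃ q ∈ X, M.le q.2 p.2

/-- Presystems. -/
def IsPresystem {J : Type u} (Jsub : ℕ+ → Tup J → Tup J) (M : Str.{u, w} J)
    (X : Set M.Elt) : Prop :=
  LocallyFull M X ∧ RelativelyDense Jsub M X

/-- The co-sorted embedding property. -/
def CoSEP {J : Type u} (Jsub : ℕ+ → Tup J → Tup J) (M : Str.{u, w} J) : Prop :=
  ∀ A B : Set M.Elt, IsFGSubsystem Jsub M A → IsFGSubsystem Jsub M B →
    ∀ (p : Emb (M.restrict B) (M.restrict A)) (f : Emb (M.restrict B) M),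
      ∃ g : Emb (M.restrict A) M, ∀ (s : Srt J) (b : (M.restrict B).carrier s),
        g.toFun s (p.toFun s b) = f.toFun s b

/-! ### Many-sorted first-order logic -/

/-- Variables of sort `s` in the context `Γ` (a finite list of sorts). -/
inductive Var {J : Type u} : List (Srt J) → Srt J → Type u
  | zero {Γ : List (Srt J)} {s : Srt J} : Var (s :: Γ) s
  | succ {Γ : List (Srt J)} {s t : Srt J} : Var Γ s → Var (t :: Γ) s

/-- First-order formulas with free variables in the context `Γ`. -/
inductive Fml (J : Type u) : List (Srt J) → Type u
  | falsum {Γ : List (Srt J)} : Fml J Γ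
  | eq {Γ : List (Srt J)} {s : Srt J} : Var Γ s → Var Γ s → Fml J Γ
  | le {Γ : List (Srt J)} {s t : Srt J} : Var Γ s → Var Γ t → Fml J Γ
  | C {Γ : List (Srt J)} {s t : Srt J} : Var Γ s → Var Γ t → Fml J Γ
  | P {Γ : List (Srt J)} {s : Srt J} : Var Γ s → Var Γ s → Var Γ s → Fml J Γ
  | imp {Γ : List (Srt J)} : Fml J Γ → Fml J Γ → Fml J Γ
  | all {Γ : List (Srt J)} (s : Srt J) : Fml J (s :: Γ) → Fml J Γ

/-- Assignments of values to the variables of a context. -/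
def Env {J : Type u} (M : Str.{u, w} J) (Γ : List (Srt J)) : Type (max u w) :=
  ∀ s : Srt J, Var Γ s → M.carrier s

/-- The assignment for the empty context. -/
def Env.nil {J : Type u} {M : Str.{u, w} J} : Env M [] := fun _ x => nomatch x

/-- Extension of an assignment by a value for one new variable. -/
def Env.cons {J : Type u} {M : Str.{u, w} J} {Γ : List (Srt J)} {t : Srt J} (a : M.carrier t)
    (e : Env M Γ) : Env M (t :: Γ)
  | _, Var.zero => a
  | _, Var.succ x => e _ x

/-- Satisfaction of a formula under an assignment. -/
def Sat {J : Type u} (M : Str.{u, w} J) : {Γ : List (Srt J)} → Fml J Γ → Env M Γ → Prop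
  | _, .falsum, _ => False
  | _, .eq x y, e => e _ x = e _ y
  | _, .le x y, e => M.le (e _ x) (e _ y)
  | _, .C x y, e => M.C (e _ x) (e _ y)
  | _, .P x y z, e => M.P (e _ x) (e _ y) (e _ z)
  | _, .imp φ ψ, e => Sat M φ e → Sat M ψ e
  | _, .all s φ, e => ∀ a : M.carrier s, Sat M φ (Env.cons a e)

/-- Sentences are formulas without free variables. -/
abbrev Sentence (J : Type u) : Type u := Fml J []

/-- `M` satisfies the sentence `φ`. -/
def Models {J : Type u} (M : Str.{u, w} J) (φ : Sentence J) : Prop := Sat M φ Env.nil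

/-- `M` is a model of the set of sentences `T`. -/
def IsModel {J : Type u} (M : Str.{u, w} J) (T : Set (Sentence J)) : Prop := ∀ φ ∈ T, Models M φ

/-- The complete theory of `M`. -/
def Th {J : Type u} (M : Str.{u, w} J) : Set (Sentence J) := {φ | Models M φ}

/-- The theory `T'` is axiomatized by `T`: the two have the same models. -/
def IsAxiomatizedBy {J : Type u} (T' T : Set (Sentence J)) : Prop :=
  ∀ M : Str.{u, w} J, IsModel M T' ↔ IsModel M T

/-- The sentence `φ` expresses the property `Q` of sorted complete systems. -/
def Expresses {J : Type u} (Jsub : ℕ+ → Tup J → Tup J) (φ : Sentence J)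
    (Q : Str.{u, w} J → Prop) : Prop :=
  ∀ M : Str.{u, w} J, IsSCS Jsub M → (Models M φ ↔ Q M)

/-- The theory of sorted complete systems having the co-sorted embedding property. -/
def SCSSEP {J : Type u} (Jsub : ℕ+ → Tup J → Tup J) : Set (Sentence J) :=
  {φ | ∀ M : Str.{u, w} J, IsSCS Jsub M → CoSEP Jsub M → Models M φ}

/-- There is a finite presystem `X` of `M` such that the subsystem generated by `X` is isomorphic
to `A`. -/
def Occurs {J : Type u} (Jsub : ℕ+ → Tup J → Tup J) (A M : Str.{u, w} J) : Prop :=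
  ∃ X : Set M.Elt, X.Finite ∧ IsPresystem Jsub M X ∧ Iso (M.restrict (generated Jsub M X)) A

/-- For every finite presystem `Y` of `M`, the subsystem generated by `Y` is not isomorphic
to `A`. -/
def Omitted {J : Type u} (Jsub : ℕ+ → Tup J → Tup J) (A M : Str.{u, w} J) : Prop :=
  ∀ Y : Set M.Elt, Y.Finite → IsPresystem Jsub M Y → ¬ Iso (M.restrict (generated Jsub M Y)) A

/-- The axioms saying of the members of `coFSIm(S)` that they occur. -/
def OccurrenceAxioms {J : Type u} (Jsub : ℕ+ → Tup J → Tup J) (S : Str.{u, w} J) :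
    Set (Sentence J) :=
  {φ | ∃ A : Str.{u, w} J, IsFGSystem Jsub A ∧ InCoFSIm Jsub S A ∧
    Expresses Jsub φ (Occurs Jsub A)}

/-- The axioms saying of the finitely generated systems outside `coFSIm(S)` that they do not
occur. -/
def OmissionAxioms {J : Type u} (Jsub : ℕ+ → Tup J → Tup J) (S : Str.{u, w} J) :
    Set (Sentence J) :=
  {φ | ∃ A : Str.{u, w} J, IsFGSystem Jsub A ∧ ¬ InCoFSIm Jsub S A ∧
    Expresses Jsub φ (Omitted Jsub A)}

end SortedSystem

/-!
The sorted complete systems form an elementary class. A model of the axioms `SCSAxioms` has a finite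
group on each `∼`-class and, by `C`, surjective homomorphisms between the groups of comparable
elements; the model is the system of the limit of these groups. Subsystems are then the subsets
that satisfy the conditions `Closed`, which mention no group, and the isomorphism type of a finitely
generated system is determined by a finite locally full set with a least element, described by
finitely many elements of known sorts. This makes two kinds of statements first-order: that a given
finitely generated system `A` embeds, and the instances of co-SEP, in the form of extension
properties of finite tuples. A structure that has every first-order property shared by all co-SEP
systems is therefore a co-SEP system.

For the completeness of the axioms, let `M` and `S` be co-SEP systems in which the same finitely
generated systems embed. Finite tuples of `M` and of `S` that are images of one tuple under
embeddings of one finitely generated system satisfy the same formulas: given a further element `a`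
of `M`, the subsystem generated by `a` and the given one embeds into `S`, and by co-SEP the
embedding can be chosen to extend the given one, which provides the matching element of `S`.
-/

universe w''

namespace SortedSystem

/-! ### Definability -/

/-- A finite list of variables together with the values that each parameter in `E M` assigns to
them, so that formulas can be built for properties of the parameters rather than of assignments. -/
structure Ctx {J : Type u} (E : Str.{u, w} J → Type (max u w)) where
  sorts : List (Srt J)
  val : ∀ M : Str.{u, w} J, E M → Env M sorts

section

variable {J : Type u} {E : Str.{u, w} J → Type (max u w)}

/-- The term `t` is a variable of the context. -/
def Reads (c : Ctx E) {s : Srt J} (t : ∀ M : Str.{u, w} J, E M → M.carrier s) : Prop :=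
  ∃ x : Var c.sorts s, ∀ M p, c.val M p s x = t M p

/-- The property `Q` is first-order definable, uniformly in all structures. -/
def Definable (c : Ctx E) (Q : ∀ M : Str.{u, w} J, E M → Prop) : Prop :=
  ∃ φ : Fml J c.sorts, ∀ M p, Sat M φ (c.val M p) ↔ Q M p

/-- Extension of a context by one variable. -/
def Ctx.ext (c : Ctx E) (s : Srt J) : Ctx (fun M => E M × M.carrier s) where
  sorts := s :: c.sorts
  val M p := Env.cons p.2 (c.val M p.1)

theorem Reads.zero {c : Ctx E} {s : Srt J} : Reads (c.ext s) (fun _ p => p.2) :=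
  ⟨.zero, fun _ _ => rfl⟩

theorem Reads.succ {c : Ctx E} {s r : Srt J} {t : ∀ M : Str.{u, w} J, E M → M.carrier s}
    (h : Reads c t) : Reads (c.ext r) (fun M p => t M p.1) := by
  obtain ⟨x, hx⟩ := h
  exact ⟨.succ x, fun M p => hx M p.1⟩

theorem Reads.one {c : Ctx E} {s₁ s₂ : Srt J} : Reads ((c.ext s₂).ext s₁) (fun _ p => p.1.2) :=
  Reads.zero.succ

theorem Reads.two {c : Ctx E} {s₁ s₂ s₃ : Srt J} :
    Reads (((c.ext s₃).ext s₂).ext s₁) (fun _ p => p.1.1.2) :=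
  Reads.one.succ

theorem Reads.three {c : Ctx E} {s₁ s₂ s₃ s₄ : Srt J} :
    Reads ((((c.ext s₄).ext s₃).ext s₂).ext s₁) (fun _ p => p.1.1.1.2) :=
  Reads.two.succ

theorem Reads.four {c : Ctx E} {s₁ s₂ s₃ s₄ s₅ : Srt J} :
    Reads (((((c.ext s₅).ext s₄).ext s₃).ext s₂).ext s₁) (fun _ p => p.1.1.1.1.2) :=
  Reads.three.succ

theorem Reads.five {c : Ctx E} {s₁ s₂ s₃ s₄ s₅ s₆ : Srt J} :
    Reads ((((((c.ext s₆).ext s₅).ext s₄).ext s₃).ext s₂).ext s₁) (fun _ p => p.1.1.1.1.1.2) :=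
  Reads.four.succ

namespace Definable

variable {c : Ctx E} {Q R : ∀ M : Str.{u, w} J, E M → Prop}

theorem congr (h : Definable c Q) (hQ : ∀ M p, R M p ↔ Q M p) : Definable c R := by
  obtain ⟨φ, hφ⟩ := h
  exact ⟨φ, fun M p => (hφ M p).trans (hQ M p).symm⟩

theorem imp (hQ : Definable c Q) (hR : Definable c R) :
    Definable c (fun M p => Q M p → R M p) := by
  obtain ⟨φ, hφ⟩ := hQ
  obtain ⟨ψ, hψ⟩ := hR
  exact ⟨.imp φ ψ, fun M p => imp_congr (hφ M p) (hψ M p)⟩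

theorem const (q : Prop) : Definable c (fun _ _ => q) := by
  by_cases hq : q
  · exact ⟨.imp .falsum .falsum, fun M p => by simp [Sat, hq]⟩
  · exact ⟨.falsum, fun M p => by simp [Sat, hq]⟩

theorem not (hQ : Definable c Q) : Definable c (fun M p => ¬ Q M p) :=
  hQ.imp (const False)

theorem and (hQ : Definable c Q) (hR : Definable c R) :
    Definable c (fun M p => Q M p ∧ R M p) :=
  (hQ.imp hR.not).not.congr fun _ _ => by tauto

theorem iff (hQ : Definable c Q) (hR : Definable c R) :
    Definable c (fun M p => Q M p ↔ R M p) :=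
  ((hQ.imp hR).and (hR.imp hQ)).congr fun _ _ => by tauto

theorem forall_finite {ι : Type*} [Finite ι] {Q : ι → ∀ M : Str.{u, w} J, E M → Prop}
    (h : ∀ i, Definable c (Q i)) : Definable c (fun M p => ∀ i, Q i M p) := by
  classical
  have := Fintype.ofFinite ι
  have forall_mem : ∀ S : Finset ι, Definable c (fun M p => ∀ i ∈ S, Q i M p) := by
    intro S
    induction S using Finset.induction_on with
    | empty => exact (const True).congr fun _ _ => by simp
    | insert a S _ ih => exact ((h a).and ih).congr fun _ _ => by simp
  exact (forall_mem Finset.univ).congr fun _ _ => by simp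

theorem exists_finite {ι : Type*} [Finite ι] {Q : ι → ∀ M : Str.{u, w} J, E M → Prop}
    (h : ∀ i, Definable c (Q i)) : Definable c (fun M p => ∃ i, Q i M p) :=
  (forall_finite fun i => (h i).not).not.congr fun _ _ => by simp

theorem all {s : Srt J} {Q : ∀ M : Str.{u, w} J, E M → M.carrier s → Prop}
    (h : Definable (c.ext s) (fun M p => Q M p.1 p.2)) :
    Definable c (fun M p => ∀ a, Q M p a) := by
  obtain ⟨φ, hφ⟩ := h
  exact ⟨.all s φ, fun M p => forall_congr' fun a => hφ M (p, a)⟩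

theorem ex {s : Srt J} {Q : ∀ M : Str.{u, w} J, E M → M.carrier s → Prop}
    (h : Definable (c.ext s) (fun M p => Q M p.1 p.2)) :
    Definable c (fun M p => ∃ a, Q M p a) :=
  (all (Q := fun M p a => ¬ Q M p a) h.not).not.congr fun _ _ => by simp

variable {s t : Srt J} {a : ∀ M : Str.{u, w} J, E M → M.carrier s}
  {b : ∀ M : Str.{u, w} J, E M → M.carrier t}
  {a' a'' : ∀ M : Str.{u, w} J, E M → M.carrier s}

theorem le (ha : Reads c a) (hb : Reads c b) : Definable c (fun M p => M.le (a M p) (b M p)) := by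
  obtain ⟨x, hx⟩ := ha
  obtain ⟨y, hy⟩ := hb
  exact ⟨.le x y, fun M p => by simp only [Sat, hx, hy]⟩

theorem C (ha : Reads c a) (hb : Reads c b) : Definable c (fun M p => M.C (a M p) (b M p)) := by
  obtain ⟨x, hx⟩ := ha
  obtain ⟨y, hy⟩ := hb
  exact ⟨.C x y, fun M p => by simp only [Sat, hx, hy]⟩

theorem P (ha : Reads c a) (ha' : Reads c a') (ha'' : Reads c a'') :
    Definable c (fun M p => M.P (a M p) (a' M p) (a'' M p)) := by
  obtain ⟨x, hx⟩ := ha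
  obtain ⟨y, hy⟩ := ha'
  obtain ⟨z, hz⟩ := ha''
  exact ⟨.P x y z, fun M p => by simp only [Sat, hx, hy, hz]⟩

theorem eq (ha : Reads c a) (ha' : Reads c a') : Definable c (fun M p => a M p = a' M p) := by
  obtain ⟨x, hx⟩ := ha
  obtain ⟨y, hy⟩ := ha'
  exact ⟨.eq x y, fun M p => by simp only [Sat, hx, hy]⟩

theorem elt_eq (ha : Reads c a) (hb : Reads c b) :
    Definable c (fun M p => (⟨s, a M p⟩ : M.Elt) = ⟨t, b M p⟩) := by
  by_cases h : s = t
  · subst h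
    exact (eq ha hb).congr fun _ _ => by simp
  · exact (const False).congr fun _ _ => by simp [h]

end Definable

/-- The context with the variables of `c`, for parameters that are first sent along `f`. -/
def Ctx.comap {E' : Str.{u, w} J → Type (max u w)} (c : Ctx E) (f : ∀ M, E' M → E M) : Ctx E' where
  sorts := c.sorts
  val M p := c.val M (f M p)

theorem Reads.comap {E' : Str.{u, w} J → Type (max u w)} {c : Ctx E} {s : Srt J}
    {t : ∀ M : Str.{u, w} J, E M → M.carrier s} (h : Reads c t) (f : ∀ M, E' M → E M) :
    Reads (c.comap f) (fun M p => t M (f M p)) := by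
  obtain ⟨x, hx⟩ := h
  exact ⟨x, fun M p => hx M (f M p)⟩

theorem Definable.of_comap {E' : Str.{u, w} J → Type (max u w)} {c : Ctx E}
    {f : ∀ M, E' M → E M} {Q : ∀ M : Str.{u, w} J, E' M → Prop} (h : Definable (c.comap f) Q)
    {g : ∀ M, E M → E' M} (hg : ∀ M, Function.RightInverse (g M) (f M)) :
    Definable c (fun M p => Q M (g M p)) := by
  obtain ⟨φ, hφ⟩ := h
  exact ⟨φ, fun M p => by simpa only [Ctx.comap, hg M p] using hφ M (g M p)⟩

/-- Extension of a context by a finite block of variables. -/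
def Ctx.block {E : Str.{u, w} J → Type (max u w)} : ∀ {n : ℕ}, Ctx E → (σ : Fin n → Srt J) →
    Ctx (fun M => E M × ∀ i, M.carrier (σ i))
  | 0, c, _ => c.comap fun _ p => p.1
  | _ + 1, c, σ => ((c.ext (σ 0)).block fun i => σ i.succ).comap
      fun _ p => ((p.1, p.2 0), fun i => p.2 i.succ)

theorem Reads.succBlock {n : ℕ} {c : Ctx E} {σ : Fin n → Srt J} {s : Srt J}
    {t : ∀ M : Str.{u, w} J, E M → M.carrier s} (h : Reads c t) :
    Reads (c.block σ) (fun M p => t M p.1) := by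
  induction n generalizing E with
  | zero => exact h.comap _
  | succ n ih => exact (ih h.succ).comap _

theorem Reads.block {n : ℕ} {c : Ctx E} {σ : Fin n → Srt J} (i : Fin n) :
    Reads (c.block σ) (fun _ p => p.2 i) := by
  induction n generalizing E with
  | zero => exact i.elim0
  | succ n ih =>
    cases i using Fin.cases with
    | zero => exact (Reads.zero.succBlock).comap _
    | succ i => exact (ih (c := c.ext (σ 0)) i).comap _

theorem Definable.allBlock {n : ℕ} {c : Ctx E} {σ : Fin n → Srt J}
    {Q : ∀ M : Str.{u, w} J, E M → (∀ i, M.carrier (σ i)) → Prop}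
    (h : Definable (c.block σ) (fun M p => Q M p.1 p.2)) :
    Definable c (fun M p => ∀ y, Q M p y) := by
  induction n generalizing E with
  | zero =>
    refine (h.of_comap (g := fun M p => (p, fun i => i.elim0)) fun _ _ => rfl).congr fun M p => ?_
    exact ⟨fun H => H _, fun H y => (Subsingleton.elim _ y) ▸ H⟩
  | succ n ih =>
    have h' := h.of_comap
      (g := fun (M : Str.{u, w} J) (q : (E M × M.carrier (σ 0)) × ∀ i : Fin n,
        M.carrier (σ i.succ)) => (q.1.1, Fin.cons q.1.2 q.2)) fun _ _ => rfl
    have h'' := all (Q := fun M p a => ∀ y : ∀ i : Fin n, M.carrier (σ i.succ),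
      Q M p (Fin.cons a y)) (ih (Q := fun M (q : E M × M.carrier (σ 0)) y =>
        Q M q.1 (Fin.cons q.2 y)) h')
    refine h''.congr fun M p => ?_
    exact ⟨fun H a y => H _, fun H y => Fin.cons_self_tail y ▸ H (y 0) (Fin.tail y)⟩

theorem Definable.exBlock {n : ℕ} {c : Ctx E} {σ : Fin n → Srt J}
    {Q : ∀ M : Str.{u, w} J, E M → (∀ i, M.carrier (σ i)) → Prop}
    (h : Definable (c.block σ) (fun M p => Q M p.1 p.2)) :
    Definable c (fun M p => ∃ y, Q M p y) :=
  (allBlock (Q := fun M p a => ¬ Q M p a) h.not).not.congr fun _ _ => by simp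

end

/-- The empty context. -/
def Ctx.nil {J : Type u} : Ctx (fun _ : Str.{u, w} J => PUnit.{max u w + 1}) where
  sorts := []
  val _ _ := Env.nil

/-- The property `Q` of structures is expressed by a sentence. -/
def FirstOrder {J : Type u} (Q : Str.{u, w} J → Prop) : Prop :=
  Definable (Ctx.nil : Ctx (fun _ : Str.{u, w} J => PUnit.{max u w + 1})) (fun M _ => Q M)

theorem FirstOrder.exists_sentence {J : Type u} {Q : Str.{u, w} J → Prop} (h : FirstOrder Q) :
    ∃ φ : Sentence J, ∀ M : Str.{u, w} J, Models M φ ↔ Q M := by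
  obtain ⟨φ, hφ⟩ := h
  exact ⟨φ, fun M => hφ M ⟨⟩⟩

/-! ### First-order axioms for sorted complete systems -/

/-- The equivalence relation `∼`. -/
def Str.Sim {J : Type u} (M : Str.{u, w} J) {s t : Srt J} (a : M.carrier s) (b : M.carrier t) :
    Prop :=
  M.le a b ∧ M.le b a

theorem Str.Sim.symm {J : Type u} {M : Str.{u, w} J} {s t : Srt J} {a : M.carrier s}
    {b : M.carrier t} (h : M.Sim a b) : M.Sim b a :=
  ⟨h.2, h.1⟩

/-- The elements of the sort of `a` which are equivalent to `a`: for `a = gN`, all the cosets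
of `N`. -/
def Str.simClass {J : Type u} (M : Str.{u, w} J) {s : Srt J} (a : M.carrier s) :
    Set (M.carrier s) :=
  {b | M.Sim b a}

/-- Elements of the class of `c` are determined by their images in the classes of `a` and `b`: for
`a = gN₁`, `b = gN₂` and `c = gN` with `N ≤ N₁ ⊓ N₂`, this says that `N = N₁ ⊓ N₂`. -/
def Str.JointlyInjective {J : Type u} (M : Str.{u, w} J) {s t r : Srt J} (a : M.carrier s)
    (b : M.carrier t) (c : M.carrier r) : Prop :=
  ∀ (x y : M.carrier r) (a' : M.carrier s) (b' : M.carrier t), M.Sim x c → M.Sim y c →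
    M.Sim a' a → M.Sim b' b → M.C x a' → M.C y a' → M.C x b' → M.C y b' → x = y

/-- The axioms for `≤`: inclusion of the subgroups is a preorder. -/
structure OrderAxioms {J : Type u} (M : Str.{u, w} J) : Prop where
  le_refl : ∀ ⦃s : Srt J⦄ (a : M.carrier s), M.le a a
  le_trans : ∀ ⦃s t r : Srt J⦄ ⦃a : M.carrier s⦄ ⦃b : M.carrier t⦄ ⦃c : M.carrier r⦄,
    M.le a b → M.le b c → M.le a c

/-- The axioms for `C`: inclusion of cosets is a preorder that restricts to surjective maps between
the classes of comparable elements. -/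
structure CosetAxioms {J : Type u} (M : Str.{u, w} J) : Prop where
  C_refl : ∀ ⦃s : Srt J⦄ (a : M.carrier s), M.C a a
  C_trans : ∀ ⦃s t r : Srt J⦄ ⦃a : M.carrier s⦄ ⦃b : M.carrier t⦄ ⦃c : M.carrier r⦄,
    M.C a b → M.C b c → M.C a c
  C_le : ∀ ⦃s t : Srt J⦄ ⦃a : M.carrier s⦄ ⦃b : M.carrier t⦄, M.C a b → M.le a b
  exists_image : ∀ ⦃s t : Srt J⦄ ⦃a : M.carrier s⦄ ⦃b : M.carrier t⦄, M.le a b →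
    ∃ b' : M.carrier t, M.Sim b' b ∧ M.C a b'
  image_unique : ∀ ⦃s t : Srt J⦄ ⦃a : M.carrier s⦄ ⦃b b' : M.carrier t⦄, M.C a b → M.C a b' →
    M.Sim b b' → b = b'
  exists_preimage : ∀ ⦃s t : Srt J⦄ ⦃a : M.carrier s⦄ ⦃b : M.carrier t⦄, M.le a b →
    ∃ a' : M.carrier s, M.Sim a' a ∧ M.C a' b
  C_of_fiber : ∀ ⦃s t r : Srt J⦄ ⦃a : M.carrier s⦄ ⦃b : M.carrier t⦄ ⦃c : M.carrier r⦄,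
    M.C a b → (∀ a' : M.carrier s, M.Sim a' a → M.C a' b → M.C a' c) → M.C b c

/-- The axioms for `P`: it is the graph of a group law on each class, and the maps between classes
given by `C` are homomorphisms. -/
structure ProductAxioms {J : Type u} (M : Str.{u, w} J) : Prop where
  P_sim : ∀ ⦃s : Srt J⦄ ⦃a b c : M.carrier s⦄, M.P a b c → M.Sim a b ∧ M.Sim b c
  P_total : ∀ ⦃s : Srt J⦄ ⦃a b : M.carrier s⦄, M.Sim a b → ∃ c, M.P a b c
  P_unique : ∀ ⦃s : Srt J⦄ ⦃a b c c' : M.carrier s⦄, M.P a b c → M.P a b c' → c = c'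
  P_assoc : ∀ ⦃s : Srt J⦄ ⦃a b c x y z : M.carrier s⦄, M.P a b x → M.P x c y → M.P b c z →
    M.P a z y
  P_one : ∀ ⦃s : Srt J⦄ (a : M.carrier s), ∃ e : M.carrier s, M.Sim e a ∧
    ∀ b : M.carrier s, M.Sim b a → M.P e b b ∧ ∃ c, M.P c b e
  P_image : ∀ ⦃s t : Srt J⦄ ⦃a b c : M.carrier s⦄ ⦃x y z : M.carrier t⦄, M.P a b c →
    M.C a x → M.C b y → M.C c z → M.Sim x y → M.Sim y z → M.P x y z

/-- The axioms about the sorts, which reflect the clauses in the definition of sorting data. In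
`exists_C_iff`, the tuple `x` enumerates a normal subgroup of the class of `a`, that is an open
normal subgroup of the profinite group above the one of `a`. -/
structure SortAxioms {J : Type u} (Jsub : ℕ+ → Tup J → Tup J) (M : Str.{u, w} J) : Prop where
  encard_simClass_le : ∀ ⦃s : Srt J⦄ (a : M.carrier s), (M.simClass a).encard ≤ (s.1 : ℕ)
  exists_sim : ∀ ⦃s : Srt J⦄ ⦃m : ℕ+⦄ ⦃T : Tup J⦄ ⦃a : M.carrier s⦄, s.2.support ⊆ T.support →
    (M.simClass a).encard ≤ (m : ℕ) → ∃ b : M.carrier (m, T), M.Sim b a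
  nonempty_one : ∀ T : Tup J, ∃ _ : M.carrier (1, T), True
  le_one : ∀ ⦃T : Tup J⦄ ⦃t : Srt J⦄ (x : M.carrier (1, T)) (y : M.carrier t), M.le y x
  exists_jointlyInjective : ∀ ⦃s t : Srt J⦄ (a : M.carrier s) (b : M.carrier t),
    ∃ c : M.carrier (s.1 * t.1, s.2.append t.2), M.le c a ∧ M.le c b ∧ M.JointlyInjective a b c
  exists_C_iff : ∀ ⦃s : Srt J⦄ ⦃a : M.carrier s⦄ ⦃x : Fin s.1 → M.carrier s⦄,
    (∀ i, M.Sim (x i) a) → (∀ i j, ∃ l, M.P (x i) (x j) (x l)) →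
    (∀ (g y : M.carrier s) (i : Fin s.1), M.P g (x i) y → ∃ j, M.P (x j) g y) →
    ∃ b : M.carrier (s.1, Jsub s.1 s.2), ∀ h : M.carrier s, M.Sim h a → (M.C h b ↔ ∃ i, h = x i)

/-- First-order axioms for sorted complete systems. -/
structure SCSAxioms {J : Type u} (Jsub : ℕ+ → Tup J → Tup J) (M : Str.{u, w} J) : Prop extends
  OrderAxioms M, CosetAxioms M, ProductAxioms M, SortAxioms Jsub M

theorem encard_le_iff_forall_exists_eq {α : Type*} {S : Set α} {m : ℕ} :
    S.encard ≤ m ↔ ∀ x : Fin (m + 1) → α, (∀ i, x i ∈ S) → ∃ i j, i ≠ j ∧ x i = x j := by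
  constructor
  · intro h x hx
    by_contra! hne
    have hinj : Function.Injective x := fun i j hij => not_imp_not.1 (hne i j) hij
    have hle :=
      hinj.encard_range.trans <| (Set.encard_le_encard (Set.range_subset_iff.2 hx)).trans h
    rw [ENat.card_eq_coe_fintype_card, Fintype.card_fin] at hle
    exact absurd (Nat.cast_le.1 hle) (by lia)
  · intro h
    by_contra! hlt
    obtain ⟨t, ht, hcard⟩ := Set.exists_subset_encard_eq (k := ((m + 1 : ℕ) : ℕ∞))
      (by push_cast; exact Order.add_one_le_of_lt hlt)
    have := (Set.finite_of_encard_eq_coe hcard).to_subtype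
    obtain ⟨e⟩ : Nonempty (t ≃ Fin (m + 1)) :=
      ⟨Finite.equivFinOfCardEq (by rw [Nat.card_coe_set_eq, Set.ncard, hcard]; simp)⟩
    obtain ⟨i, j, hij, he⟩ := h (fun i => e.symm i) fun i => ht (e.symm i).2
    exact hij (e.symm.injective (Subtype.ext he))

/-- The structures with all the first-order properties that the members of `K` share. -/
def elementaryClosure {J : Type u} (K : Set (Str.{u, w} J)) : Set (Str.{u, w} J) :=
  {M | ∀ Q : Str.{u, w} J → Prop, FirstOrder Q → (∀ N ∈ K, Q N) → Q M}

namespace Definable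

variable {J : Type u} {E : Str.{u, w} J → Type (max u w)} {c : Ctx E} {s t r : Srt J}
  {a : ∀ M : Str.{u, w} J, E M → M.carrier s} {b : ∀ M : Str.{u, w} J, E M → M.carrier t}

theorem sim (ha : Reads c a) (hb : Reads c b) : Definable c (fun M p => M.Sim (a M p) (b M p)) :=
  (le ha hb).and (le hb ha)

theorem encard_simClass_le (ha : Reads c a) (m : ℕ) :
    Definable c (fun M p => (M.simClass (a M p)).encard ≤ m) := by
  simp only [encard_le_iff_forall_exists_eq]
  exact .allBlock <| .imp (.forall_finite fun i => .sim (.block i) ha.succBlock) <|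
    .exists_finite fun i => .exists_finite fun j => .and (.const _) <| .eq (.block i) (.block j)

theorem jointlyInjective {d : ∀ M : Str.{u, w} J, E M → M.carrier r} (ha : Reads c a)
    (hb : Reads c b) (hd : Reads c d) :
    Definable c (fun M p => M.JointlyInjective (a M p) (b M p) (d M p)) :=
  .all <| .all <| .all <| .all <|
    .imp (.sim .three hd.succ.succ.succ.succ) <| .imp (.sim .two hd.succ.succ.succ.succ) <|
    .imp (.sim .one ha.succ.succ.succ.succ) <| .imp (.sim .zero hb.succ.succ.succ.succ) <|
    .imp (.C .three .one) <| .imp (.C .two .one) <| .imp (.C .three .zero) <|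
    .imp (.C .two .zero) <| .eq .three .two

end Definable

section

variable {J : Type u} {Jsub : ℕ+ → Tup J → Tup J} {M : Str.{u, w} J} {K : Set (Str.{u, w} J)}

theorem prop_of_mem_elementaryClosure {Q : Str.{u, w} J → Prop} (hM : M ∈ elementaryClosure K)
    (hK : ∀ N ∈ K, Q N) (hQ : FirstOrder Q) : Q M :=
  hM Q hQ hK

theorem OrderAxioms.of_mem_elementaryClosure (hK : ∀ N ∈ K, OrderAxioms N)
    (hM : M ∈ elementaryClosure K) : OrderAxioms M where
  le_refl s := prop_of_mem_elementaryClosure hM (fun N h => (hK N h).le_refl (s := s))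
    (.all <| .le .zero .zero)
  le_trans s t r := prop_of_mem_elementaryClosure hM
    (fun N h => (hK N h).le_trans (s := s) (t := t) (r := r))
    (.all <| .all <| .all <| .imp (.le .two .one) <| .imp (.le .one .zero) <| .le .two .zero)

theorem CosetAxioms.of_mem_elementaryClosure (hK : ∀ N ∈ K, CosetAxioms N)
    (hM : M ∈ elementaryClosure K) : CosetAxioms M where
  C_refl s := prop_of_mem_elementaryClosure hM (fun N h => (hK N h).C_refl (s := s))
    (.all <| .C .zero .zero)
  C_trans s t r := prop_of_mem_elementaryClosure hM
    (fun N h => (hK N h).C_trans (s := s) (t := t) (r := r))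
    (.all <| .all <| .all <| .imp (.C .two .one) <| .imp (.C .one .zero) <| .C .two .zero)
  C_le s t := prop_of_mem_elementaryClosure hM (fun N h => (hK N h).C_le (s := s) (t := t))
    (.all <| .all <| .imp (.C .one .zero) <| .le .one .zero)
  exists_image s t := prop_of_mem_elementaryClosure hM
    (fun N h => (hK N h).exists_image (s := s) (t := t))
    (.all <| .all <| .imp (.le .one .zero) <| .ex <| .and (.sim .zero .one) (.C .two .zero))
  image_unique s t := prop_of_mem_elementaryClosure hM
    (fun N h => (hK N h).image_unique (s := s) (t := t))
    (.all <| .all <| .all <| .imp (.C .two .one) <| .imp (.C .two .zero) <|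
      .imp (.sim .one .zero) <| .eq .one .zero)
  exists_preimage s t := prop_of_mem_elementaryClosure hM
    (fun N h => (hK N h).exists_preimage (s := s) (t := t))
    (.all <| .all <| .imp (.le .one .zero) <| .ex <| .and (.sim .zero .two) (.C .zero .one))
  C_of_fiber s t r := prop_of_mem_elementaryClosure hM
    (fun N h => (hK N h).C_of_fiber (s := s) (t := t) (r := r))
    (.all <| .all <| .all <| .imp (.C .two .one) <| .imp
      (.all <| .imp (.sim .zero .three) <| .imp (.C .zero .two) <| .C .zero .one) <| .C .one .zero)

theorem ProductAxioms.of_mem_elementaryClosure (hK : ∀ N ∈ K, ProductAxioms N)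
    (hM : M ∈ elementaryClosure K) : ProductAxioms M where
  P_sim s := prop_of_mem_elementaryClosure hM (fun N h => (hK N h).P_sim (s := s))
    (.all <| .all <| .all <| .imp (.P .two .one .zero) <| .and (.sim .two .one) (.sim .one .zero))
  P_total s := prop_of_mem_elementaryClosure hM (fun N h => (hK N h).P_total (s := s))
    (.all <| .all <| .imp (.sim .one .zero) <| .ex <| .P .two .one .zero)
  P_unique s := prop_of_mem_elementaryClosure hM (fun N h => (hK N h).P_unique (s := s))
    (.all <| .all <| .all <| .all <| .imp (.P .three .two .one) <|
      .imp (.P .three .two .zero) <| .eq .one .zero)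
  P_assoc s := prop_of_mem_elementaryClosure hM (fun N h => (hK N h).P_assoc (s := s))
    (.all <| .all <| .all <| .all <| .all <| .all <| .imp (.P .five .four .two) <|
      .imp (.P .two .three .one) <| .imp (.P .four .three .zero) <| .P .five .zero .one)
  P_one s := prop_of_mem_elementaryClosure hM (fun N h => (hK N h).P_one (s := s))
    (.all <| .ex <| .and (.sim .zero .one) <| .all <| .imp (.sim .zero .two) <|
      .and (.P .one .zero .zero) <| .ex <| .P .zero .one .two)
  P_image s t := prop_of_mem_elementaryClosure hM (fun N h => (hK N h).P_image (s := s) (t := t))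
    (.all <| .all <| .all <| .all <| .all <| .all <| .imp (.P .five .four .three) <|
      .imp (.C .five .two) <| .imp (.C .four .one) <| .imp (.C .three .zero) <|
      .imp (.sim .two .one) <| .imp (.sim .one .zero) <| .P .two .one .zero)

theorem SortAxioms.of_mem_elementaryClosure (hK : ∀ N ∈ K, SortAxioms Jsub N)
    (hM : M ∈ elementaryClosure K) : SortAxioms Jsub M where
  encard_simClass_le s := prop_of_mem_elementaryClosure hM
    (fun N h => (hK N h).encard_simClass_le (s := s))
    (.all <| .encard_simClass_le .zero _)
  exists_sim s m T := prop_of_mem_elementaryClosure hM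
    (fun N h => (hK N h).exists_sim (s := s) (m := m) (T := T))
    (.all <| .imp (.const _) <| .imp (.encard_simClass_le .zero _) <| .ex <| .sim .zero .one)
  nonempty_one T := prop_of_mem_elementaryClosure hM (fun N h => (hK N h).nonempty_one T)
    (.ex <| .const True)
  le_one T t := prop_of_mem_elementaryClosure hM (fun N h => (hK N h).le_one (T := T) (t := t))
    (.all <| .all <| .le .zero .one)
  exists_jointlyInjective s t := prop_of_mem_elementaryClosure hM
    (fun N h => (hK N h).exists_jointlyInjective (s := s) (t := t))
    (.all <| .all <| .ex <| .and (.le .zero .two) <| .and (.le .zero .one) <|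
      .jointlyInjective .two .one .zero)
  exists_C_iff s := prop_of_mem_elementaryClosure hM (fun N h => (hK N h).exists_C_iff (s := s))
    (.all <| .allBlock <| .imp (.forall_finite fun i => .sim (.block i) (.succBlock .zero)) <|
      .imp (.forall_finite fun i => .forall_finite fun j => .exists_finite fun l =>
        .P (.block i) (.block j) (.block l)) <|
      .imp (.all <| .all <| .forall_finite fun i => .imp
        (.P .one (.succ <| .succ <| .block i) .zero) <| .exists_finite fun j =>
        .P (.succ <| .succ <| .block j) .one .zero) <|
      .ex <| .all <| .imp (.sim .zero (.succ <| .succ <| .succBlock .zero)) <|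
        .iff (.C .zero .one) <| .exists_finite fun i => .eq .zero (.succ <| .succ <| .block i))

theorem SCSAxioms.of_mem_elementaryClosure (hK : ∀ N ∈ K, SCSAxioms Jsub N)
    (hM : M ∈ elementaryClosure K) : SCSAxioms Jsub M where
  toOrderAxioms := .of_mem_elementaryClosure (fun N h => (hK N h).toOrderAxioms) hM
  toCosetAxioms := .of_mem_elementaryClosure (fun N h => (hK N h).toCosetAxioms) hM
  toProductAxioms := .of_mem_elementaryClosure (fun N h => (hK N h).toProductAxioms) hM
  toSortAxioms := .of_mem_elementaryClosure (fun N h => (hK N h).toSortAxioms) hM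

end

/-! ### The groups of a model of the axioms -/

section

variable {J : Type u} {Jsub : ℕ+ → Tup J → Tup J} {M : Str.{u, w} J}

/-- The element `c` is a greatest lower bound of `a` and `b`. -/
def Str.IsMeet (M : Str.{u, w} J) {s t r : Srt J} (a : M.carrier s) (b : M.carrier t)
    (c : M.carrier r) : Prop :=
  M.le c a ∧ M.le c b ∧ ∀ (q : Srt J) (d : M.carrier q), M.le d a → M.le d b → M.le d c

namespace SCSAxioms

/-- The elements of the sort of `a` which are equivalent to `a`, as a group: for `a = gN`, this is
`G ⧸ N`. -/
@[ext]
structure SimGroup (hM : SCSAxioms Jsub M) {s : Srt J} (a : M.carrier s) : Type w where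
  val : M.carrier s
  sim : M.Sim val a

section

variable (hM : SCSAxioms Jsub M) {s t r : Srt J}
include hM

theorem sim_refl (a : M.carrier s) : M.Sim a a :=
  ⟨hM.le_refl a, hM.le_refl a⟩

theorem sim_trans {a : M.carrier s} {b : M.carrier t} {c : M.carrier r} (h : M.Sim a b)
    (h' : M.Sim b c) : M.Sim a c :=
  ⟨hM.le_trans h.1 h'.1, hM.le_trans h'.2 h.2⟩

theorem eq_of_C {a b : M.carrier s} (h : M.C a b) (hab : M.Sim a b) : a = b :=
  hM.image_unique (hM.C_refl a) h hab

theorem simGroup_sim {a : M.carrier s} (x y : hM.SimGroup a) : M.Sim x.1 y.1 :=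
  hM.sim_trans x.2 y.2.symm

end

noncomputable instance (hM : SCSAxioms Jsub M) {s : Srt J} (a : M.carrier s) :
    Mul (hM.SimGroup a) where
  mul x y := ⟨(hM.P_total (hM.simGroup_sim x y)).choose,
    hM.sim_trans (hM.P_sim (hM.P_total (hM.simGroup_sim x y)).choose_spec).2.symm y.2⟩

noncomputable instance (hM : SCSAxioms Jsub M) {s : Srt J} (a : M.carrier s) :
    One (hM.SimGroup a) where
  one := ⟨(hM.P_one a).choose, (hM.P_one a).choose_spec.1⟩

section

variable (hM : SCSAxioms Jsub M) {s : Srt J} {a : M.carrier s}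
include hM

theorem P_mul (x y : hM.SimGroup a) : M.P x.1 y.1 (x * y).1 :=
  (hM.P_total (hM.simGroup_sim x y)).choose_spec

theorem P_iff_mul_eq (x y z : hM.SimGroup a) : M.P x.1 y.1 z.1 ↔ x * y = z :=
  ⟨fun h => SimGroup.ext (hM.P_unique (hM.P_mul x y) h), fun h => h ▸ hM.P_mul x y⟩

theorem exists_mul_eq_one (x : hM.SimGroup a) : ∃ y : hM.SimGroup a, y * x = 1 := by
  obtain ⟨y, hy⟩ := ((hM.P_one a).choose_spec.2 x.1 x.2).2
  exact ⟨⟨y, hM.sim_trans (hM.P_sim hy).1 x.2⟩, (hM.P_iff_mul_eq _ _ _).1 hy⟩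

end

noncomputable instance (hM : SCSAxioms Jsub M) {s : Srt J} (a : M.carrier s) :
    Inv (hM.SimGroup a) where
  inv x := (hM.exists_mul_eq_one x).choose

noncomputable instance (hM : SCSAxioms Jsub M) {s : Srt J} (a : M.carrier s) :
    Group (hM.SimGroup a) :=
  Group.ofLeftAxioms
    (fun x y z => ((hM.P_iff_mul_eq _ _ _).1
      (hM.P_assoc (hM.P_mul x y) (hM.P_mul _ z) (hM.P_mul y z))).symm)
    (fun x => (hM.P_iff_mul_eq _ _ _).1 ((hM.P_one a).choose_spec.2 x.1 x.2).1)
    (fun x => (hM.exists_mul_eq_one x).choose_spec)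

theorem finite_simClass (hM : SCSAxioms Jsub M) {s : Srt J} (a : M.carrier s) :
    (M.simClass a).Finite :=
  Set.finite_of_encard_le_coe (hM.encard_simClass_le a)

instance (hM : SCSAxioms Jsub M) {s : Srt J} (a : M.carrier s) : Finite (hM.SimGroup a) :=
  have := (hM.finite_simClass a).to_subtype
  Finite.of_injective (β := M.simClass a) (fun x => ⟨x.1, x.2⟩) fun _ _ h =>
    SimGroup.ext (Subtype.mk.inj h)

section

variable (hM : SCSAxioms Jsub M) {s t r : Srt J}
include hM

theorem card_simGroup (a : M.carrier s) : Nat.card (hM.SimGroup a) = (M.simClass a).ncard := by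
  rw [← Nat.card_coe_set_eq]
  exact Nat.card_congr ⟨fun x => ⟨x.1, x.2⟩, fun x => ⟨x.1, x.2⟩, fun _ => rfl, fun _ => rfl⟩

theorem encard_simClass_eq (a : M.carrier s) : (M.simClass a).encard = (M.simClass a).ncard :=
  (hM.finite_simClass a).cast_ncard_eq.symm

theorem ncard_simClass_le (a : M.carrier s) : (M.simClass a).ncard ≤ s.1 := by
  exact_mod_cast (hM.encard_simClass_eq a).symm.trans_le (hM.encard_simClass_le a)

theorem ncard_simClass_pos (a : M.carrier s) : 0 < (M.simClass a).ncard :=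
  (Set.ncard_pos (hM.finite_simClass a)).2 ⟨a, hM.sim_refl a⟩

theorem exists_sim_of_ncard_le {T : Tup J} (m : ℕ+) (a : M.carrier s)
    (hT : s.2.support ⊆ T.support) (hm : (M.simClass a).ncard ≤ m) :
    ∃ b : M.carrier (m, T), M.Sim b a :=
  hM.exists_sim hT (by rw [hM.encard_simClass_eq]; exact_mod_cast hm)

theorem exists_transition {a : M.carrier s} {b : M.carrier t} (hab : M.le a b)
    (x : hM.SimGroup a) : ∃ y : hM.SimGroup b, M.C x.1 y.1 := by
  obtain ⟨y, hy, hxy⟩ := hM.exists_image (hM.le_trans x.2.1 hab)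
  exact ⟨⟨y, hy⟩, hxy⟩

/-- The homomorphism between the groups of two comparable elements: for `a = gN` and `b = hN'`
with `N ≤ N'`, this is the canonical map `G ⧸ N → G ⧸ N'`. -/
noncomputable def transition {a : M.carrier s} {b : M.carrier t} (hab : M.le a b) :
    hM.SimGroup a →* hM.SimGroup b :=
  MonoidHom.mk' (fun x => (hM.exists_transition hab x).choose) fun x y =>
    ((hM.P_iff_mul_eq _ _ _).1 <| hM.P_image (hM.P_mul x y)
      (hM.exists_transition hab x).choose_spec (hM.exists_transition hab y).choose_spec
      (hM.exists_transition hab _).choose_spec (hM.simGroup_sim _ _) (hM.simGroup_sim _ _)).symm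

theorem C_transition {a : M.carrier s} {b : M.carrier t} (hab : M.le a b) (x : hM.SimGroup a) :
    M.C x.1 (hM.transition hab x).1 :=
  (hM.exists_transition hab x).choose_spec

theorem C_iff_transition_eq {a : M.carrier s} {b : M.carrier t} (hab : M.le a b)
    (x : hM.SimGroup a) (y : hM.SimGroup b) : M.C x.1 y.1 ↔ hM.transition hab x = y :=
  ⟨fun h => SimGroup.ext (hM.image_unique (hM.C_transition hab x) h (hM.simGroup_sim _ _)),
    fun h => h ▸ hM.C_transition hab x⟩

theorem transition_transition {a : M.carrier s} {b : M.carrier t} {c : M.carrier r}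
    (hab : M.le a b) (hbc : M.le b c) (x : hM.SimGroup a) :
    hM.transition hbc (hM.transition hab x) = hM.transition (hM.le_trans hab hbc) x :=
  ((hM.C_iff_transition_eq _ _ _).1
    (hM.C_trans (hM.C_transition hab x) (hM.C_transition hbc _))).symm

theorem transition_surjective {a : M.carrier s} {b : M.carrier t} (hab : M.le a b) :
    Function.Surjective (hM.transition hab) := by
  intro y
  obtain ⟨x, hx, hxy⟩ := hM.exists_preimage (hM.le_trans hab y.2.2)
  exact ⟨⟨x, hx⟩, (hM.C_iff_transition_eq hab _ _).1 hxy⟩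

theorem ncard_simClass_mono {a : M.carrier s} {b : M.carrier t} (hab : M.le a b) :
    (M.simClass b).ncard ≤ (M.simClass a).ncard := by
  rw [← hM.card_simGroup, ← hM.card_simGroup]
  exact Nat.card_le_card_of_surjective _ (hM.transition_surjective hab)

theorem ncard_simClass_congr {a : M.carrier s} {b : M.carrier t} (hab : M.Sim a b) :
    (M.simClass a).ncard = (M.simClass b).ncard :=
  le_antisymm (hM.ncard_simClass_mono hab.2) (hM.ncard_simClass_mono hab.1)

theorem exists_fin_surjective {a : M.carrier s} (K : Subgroup (hM.SimGroup a)) :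
    ∃ g : Fin s.1 → K, Function.Surjective g := by
  have card_le : Nat.card K ≤ s.1 :=
    (Subgroup.card_le_card_group K).trans ((hM.card_simGroup a).trans_le (hM.ncard_simClass_le a))
  have := Fintype.ofFinite K
  obtain ⟨f⟩ : Nonempty (K ↪ Fin s.1) :=
    Function.Embedding.nonempty_of_card_le (by simpa [Nat.card_eq_fintype_card] using card_le)
  exact ⟨_, Function.invFun_surjective f.injective⟩

theorem exists_C_iff_mem {a : M.carrier s} (K : Subgroup (hM.SimGroup a)) [hK : K.Normal] :
    ∃ b : M.carrier (s.1, Jsub s.1 s.2), ∀ x : hM.SimGroup a, M.C x.1 b ↔ x ∈ K := by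
  obtain ⟨g, hg⟩ := hM.exists_fin_surjective K
  have closed_mul (i j) : ∃ l, M.P (g i).1.1 (g j).1.1 (g l).1.1 := by
    obtain ⟨l, hl⟩ := hg (g i * g j)
    exact ⟨l, by rw [hM.P_iff_mul_eq, hl]; rfl⟩
  have normal (c y i) (h : M.P c (g i).1.1 y) : ∃ j, M.P (g j).1.1 c y := by
    have hc : M.Sim c a := hM.sim_trans (hM.P_sim h).1 (g i).1.2
    have hy : M.Sim y a := hM.sim_trans (hM.P_sim h).2.symm (g i).1.2
    have h' := (hM.P_iff_mul_eq ⟨c, hc⟩ (g i).1 ⟨y, hy⟩).1 h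
    obtain ⟨l, hl⟩ := hg ⟨⟨c, hc⟩ * (g i).1 * ⟨c, hc⟩⁻¹, hK.conj_mem _ (g i).2 _⟩
    exact ⟨l, (hM.P_iff_mul_eq (g l).1 ⟨c, hc⟩ ⟨y, hy⟩).2 (by rw [hl, ← h', inv_mul_cancel_right])⟩
  obtain ⟨b, hb⟩ := hM.exists_C_iff (fun i => (g i).1.2) closed_mul normal
  refine ⟨b, fun x => (hb x.1 x.2).trans ⟨?_, fun hx => ?_⟩⟩
  · rintro ⟨i, hi⟩
    exact SimGroup.ext hi ▸ (g i).2
  · obtain ⟨i, hi⟩ := hg ⟨x, hx⟩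
    exact ⟨i, by rw [hi]⟩

theorem exists_C_of_le {a : M.carrier s} {b : M.carrier t} (hab : M.le a b) :
    ∃ x : hM.SimGroup a, M.C x.1 b := by
  obtain ⟨x, hx, hxb⟩ := hM.exists_preimage hab
  exact ⟨⟨x, hx⟩, hxb⟩

theorem C_iff_forall_C {a : M.carrier s} {b : M.carrier t} {b' : M.carrier r} (hab : M.le a b) :
    M.C b b' ↔ ∀ y : hM.SimGroup a, M.C y.1 b → M.C y.1 b' := by
  refine ⟨fun h y hy => hM.C_trans hy h, fun h => ?_⟩
  obtain ⟨x, hx⟩ := hM.exists_C_of_le hab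
  exact hM.C_of_fiber hx fun y hy => h ⟨y, hM.sim_trans hy x.2⟩

theorem le_iff_C_one {a : M.carrier s} {b : M.carrier t} :
    M.le a b ↔ M.C (1 : hM.SimGroup a).1 (1 : hM.SimGroup b).1 :=
  ⟨fun h => (hM.C_iff_transition_eq h _ _).2 (map_one _), fun h =>
    hM.le_trans (1 : hM.SimGroup a).2.2 (hM.le_trans (hM.C_le h) (1 : hM.SimGroup b).2.1)⟩

theorem le_iff_ker_le_ker {a : M.carrier s} {b : M.carrier t} {b' : M.carrier r}
    (hab : M.le a b) (hab' : M.le a b') :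
    M.le b b' ↔ (hM.transition hab).ker ≤ (hM.transition hab').ker := by
  rw [hM.le_iff_C_one, hM.C_iff_forall_C (hM.le_trans hab (1 : hM.SimGroup b).2.2)]
  simp only [hM.C_iff_transition_eq hab, hM.C_iff_transition_eq hab']
  rfl

theorem sim_iff_ker_eq_ker {a : M.carrier s} {b : M.carrier t} {b' : M.carrier r}
    (hab : M.le a b) (hab' : M.le a b') :
    M.Sim b b' ↔ (hM.transition hab).ker = (hM.transition hab').ker := by
  rw [le_antisymm_iff, ← hM.le_iff_ker_le_ker, ← hM.le_iff_ker_le_ker]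
  rfl

theorem index_ker_transition {a : M.carrier s} {b : M.carrier t} (hab : M.le a b) :
    (hM.transition hab).ker.index = (M.simClass b).ncard := by
  rw [Subgroup.index_ker, MonoidHom.range_eq_top.2 (hM.transition_surjective hab),
    Subgroup.card_top, hM.card_simGroup]

theorem C_iff_inv_mul_mem_ker {a : M.carrier s} {b : M.carrier t} (hab : M.le a b)
    {x : hM.SimGroup a} (hx : M.C x.1 b) (y : hM.SimGroup a) :
    M.C y.1 b ↔ x⁻¹ * y ∈ (hM.transition hab).ker := by
  let b₀ : hM.SimGroup b := ⟨b, hM.sim_refl b⟩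
  rw [hM.C_iff_transition_eq hab x b₀] at hx
  rw [hM.C_iff_transition_eq hab y b₀, MonoidHom.mem_ker, map_mul, map_inv, inv_mul_eq_one, hx,
    eq_comm]

theorem ker_transition_eq_of_forall_C_iff_mem {a : M.carrier s} {b : M.carrier t}
    {K : Subgroup (hM.SimGroup a)} (h : ∀ x : hM.SimGroup a, M.C x.1 b ↔ x ∈ K) :
    ∃ hab : M.le a b, (hM.transition hab).ker = K := by
  have C_one : M.C (1 : hM.SimGroup a).1 b := (h 1).2 (one_mem K)
  have hab : M.le a b := hM.le_trans (1 : hM.SimGroup a).2.2 (hM.C_le C_one)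
  refine ⟨hab, Subgroup.ext fun x => ?_⟩
  rw [← h, hM.C_iff_inv_mul_mem_ker hab C_one, inv_one, one_mul]

theorem exists_ker_transition_eq {a : M.carrier s} (K : Subgroup (hM.SimGroup a)) [K.Normal] :
    ∃ (b : M.carrier (s.1, Jsub s.1 s.2)) (hab : M.le a b), (hM.transition hab).ker = K := by
  obtain ⟨b, hb⟩ := hM.exists_C_iff_mem K
  exact ⟨b, hM.ker_transition_eq_of_forall_C_iff_mem hb⟩

theorem ker_inf_ker_of_jointlyInjective {a : M.carrier s} {b : M.carrier t} {c : M.carrier r}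
    (hca : M.le c a) (hcb : M.le c b) (h : M.JointlyInjective a b c) :
    (hM.transition hca).ker ⊓ (hM.transition hcb).ker = ⊥ := by
  refine eq_bot_iff.2 fun x ⟨hxa, hxb⟩ => SimGroup.ext <|
    h x.1 (1 : hM.SimGroup c).1 (1 : hM.SimGroup a).1 (1 : hM.SimGroup b).1 x.2
      (1 : hM.SimGroup c).2 (1 : hM.SimGroup a).2 (1 : hM.SimGroup b).2 ?_ ?_ ?_ ?_
  · exact (hM.C_iff_transition_eq hca _ _).2 hxa
  · exact hM.le_iff_C_one.1 hca
  · exact (hM.C_iff_transition_eq hcb _ _).2 hxb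
  · exact hM.le_iff_C_one.1 hcb

theorem isMeet_of_jointlyInjective {a : M.carrier s} {b : M.carrier t} {c : M.carrier r}
    (hca : M.le c a) (hcb : M.le c b) (h : M.JointlyInjective a b c) : M.IsMeet a b c := by
  refine ⟨hca, hcb, fun q d hda hdb => ?_⟩
  obtain ⟨e, hec, hed, -⟩ := hM.exists_jointlyInjective c d
  refine (hM.le_iff_ker_le_ker hed hec).2 fun x hx => ?_
  have hxa := (hM.le_iff_ker_le_ker hed (hM.le_trans hed hda)).1 hda hx
  have hxb := (hM.le_iff_ker_le_ker hed (hM.le_trans hed hdb)).1 hdb hx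
  have hxab : hM.transition hec x ∈ (hM.transition hca).ker ⊓ (hM.transition hcb).ker :=
    ⟨(hM.transition_transition hec hca x).trans hxa,
      (hM.transition_transition hec hcb x).trans hxb⟩
  rwa [hM.ker_inf_ker_of_jointlyInjective hca hcb h] at hxab

theorem exists_isMeet (a : M.carrier s) (b : M.carrier t) :
    ∃ c : M.carrier (s.1 * t.1, s.2.append t.2), M.JointlyInjective a b c ∧ M.IsMeet a b c := by
  obtain ⟨c, hca, hcb, h⟩ := hM.exists_jointlyInjective a b
  exact ⟨c, h, hM.isMeet_of_jointlyInjective hca hcb h⟩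

theorem ker_transition_eq_inf_of_isMeet {q : Srt J} {a : M.carrier s} {b : M.carrier t}
    {c : M.carrier r} {d : M.carrier q} (hda : M.le d a) (hdb : M.le d b) (hdc : M.le d c)
    (hc : M.IsMeet a b c) :
    (hM.transition hdc).ker = (hM.transition hda).ker ⊓ (hM.transition hdb).ker := by
  obtain ⟨e, injective_e, he⟩ := hM.exists_isMeet a b
  have hde : M.le d e := he.2.2 _ _ hda hdb
  have sim_ce : M.Sim c e := ⟨he.2.2 _ _ hc.1 hc.2.1, hc.2.2 _ _ he.1 he.2.1⟩
  rw [(hM.sim_iff_ker_eq_ker hdc hde).1 sim_ce]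
  refine le_antisymm (le_inf ((hM.le_iff_ker_le_ker hde hda).1 he.1)
    ((hM.le_iff_ker_le_ker hde hdb).1 he.2.1)) fun x hx => ?_
  have image_mem : hM.transition hde x ∈ (hM.transition he.1).ker ⊓ (hM.transition he.2.1).ker :=
    ⟨(hM.transition_transition hde he.1 x).trans hx.1,
      (hM.transition_transition hde he.2.1 x).trans hx.2⟩
  rwa [hM.ker_inf_ker_of_jointlyInjective he.1 he.2.1 injective_e] at image_mem

theorem C_of_forall_le {a : M.carrier s} {b : M.carrier t}
    (hb : ∀ (r : Srt J) (x : M.carrier r), M.le x b) : M.C a b := by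
  obtain ⟨b', hb', hC⟩ := hM.exists_image (hb s a)
  obtain ⟨x, -⟩ := hM.nonempty_one t.2
  have ncard_le_one : (M.simClass b).ncard ≤ 1 := by
    rw [← hM.ncard_simClass_congr ⟨hb _ x, hM.le_one x b⟩]
    exact hM.ncard_simClass_le x
  rwa [← (Set.ncard_le_one (hM.finite_simClass b)).1 ncard_le_one b' hb' b (hM.sim_refl b)]

theorem exists_forall_le (s : Srt J) :
    ∃ b : M.carrier s, ∀ (r : Srt J) (x : M.carrier r), M.le x b := by
  obtain ⟨x, -⟩ := hM.nonempty_one s.2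
  obtain ⟨b, hb⟩ := hM.exists_sim_of_ncard_le s.1 x subset_rfl
    ((hM.ncard_simClass_le x).trans s.1.pos)
  exact ⟨b, fun r y => hM.le_trans (hM.le_one x y) hb.2⟩

end

end SCSAxioms

end

/-! ### Embeddings -/

section

variable {J : Type u} {K : Str.{u, w''} J} {N : Str.{u, w'} J} {M : Str.{u, w} J}

/-- Composition of embeddings. -/
def Emb.comp (g : Emb N K) (f : Emb M N) : Emb M K where
  toFun s a := g.toFun s (f.toFun s a)
  inj s := (g.inj s).comp (f.inj s)
  map_le a b := (g.map_le _ _).trans (f.map_le a b)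
  map_C a b := (g.map_C _ _).trans (f.map_C a b)
  map_P a b c := (g.map_P _ _ _).trans (f.map_P a b c)

/-- The inverse of a surjective embedding. -/
noncomputable def Emb.symm (f : Emb M N) (hf : ∀ s, Function.Surjective (f.toFun s)) :
    Emb N M where
  toFun s := Function.surjInv (hf s)
  inj s := Function.injective_surjInv (hf s)
  map_le a b := by rw [← f.map_le, Function.surjInv_eq (hf _), Function.surjInv_eq (hf _)]
  map_C a b := by rw [← f.map_C, Function.surjInv_eq (hf _), Function.surjInv_eq (hf _)]
  map_P a b c := by rw [← f.map_P, Function.surjInv_eq (hf _), Function.surjInv_eq (hf _),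
    Function.surjInv_eq (hf _)]

theorem Emb.symm_apply (f : Emb M N) (hf : ∀ s, Function.Surjective (f.toFun s)) {s : Srt J}
    (a : M.carrier s) : (f.symm hf).toFun s (f.toFun s a) = a :=
  Function.leftInverse_surjInv ⟨f.inj s, hf s⟩ a

theorem Emb.symm_surjective (f : Emb M N) (hf : ∀ s, Function.Surjective (f.toFun s)) (s : Srt J) :
    Function.Surjective ((f.symm hf).toFun s) :=
  fun a => ⟨_, f.symm_apply hf a⟩

theorem Iso.symm (h : Iso M N) : Iso N M := by
  obtain ⟨f, hf⟩ := h
  exact ⟨f.symm hf, f.symm_surjective hf⟩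

theorem Iso.trans (h : Iso M N) (h' : Iso N K) : Iso M K := by
  obtain ⟨f, hf⟩ := h
  obtain ⟨g, hg⟩ := h'
  exact ⟨g.comp f, fun s => (hg s).comp (hf s)⟩

theorem Emb.map_sim (f : Emb M N) {s t : Srt J} (a : M.carrier s) (b : M.carrier t) :
    N.Sim (f.toFun s a) (f.toFun t b) ↔ M.Sim a b :=
  and_congr (f.map_le a b) (f.map_le b a)

/-- The embedding of a substructure. -/
def inclusion (M : Str.{u, w} J) (A : Set M.Elt) : Emb (M.restrict A) M where
  toFun _ a := a.1
  inj _ := Subtype.val_injective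
  map_le _ _ := Iff.rfl
  map_C _ _ := Iff.rfl
  map_P _ _ _ := Iff.rfl

/-- An embedding whose values lie in `B`, as an embedding in the substructure `B`. -/
def Emb.codRestrict {B : Set N.Elt} (f : Emb M N) (h : ∀ s a, (⟨s, f.toFun s a⟩ : N.Elt) ∈ B) :
    Emb M (N.restrict B) where
  toFun s a := ⟨f.toFun s a, h s a⟩
  inj s _ _ hab := f.inj s (Subtype.mk.inj hab)
  map_le := f.map_le
  map_C := f.map_C
  map_P := f.map_P

/-- The action of an embedding on the elements of all sorts. -/
def Emb.elt (f : Emb M N) : M.Elt → N.Elt :=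
  Sigma.map id f.toFun

theorem Emb.elt_injective (f : Emb M N) : Function.Injective f.elt :=
  Function.injective_id.sigma_map f.inj

theorem Emb.mk_mem_image_elt {f : Emb M N} {X : Set M.Elt} {s : Srt J} {b : N.carrier s} :
    (⟨s, b⟩ : N.Elt) ∈ f.elt '' X ↔ ∃ a, (⟨s, a⟩ : M.Elt) ∈ X ∧ f.toFun s a = b := by
  constructor
  · rintro ⟨⟨t, a⟩, ha, hab⟩
    obtain rfl : t = s := congrArg Sigma.fst hab
    exact ⟨a, ha, eq_of_heq (Sigma.mk.inj hab).2⟩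
  · rintro ⟨a, ha, rfl⟩
    exact ⟨⟨s, a⟩, ha, rfl⟩

theorem Emb.iso_restrict_image (f : Emb M N) (B : Set M.Elt) :
    Iso (M.restrict B) (N.restrict (f.elt '' B)) := by
  refine ⟨(f.comp (inclusion M B)).codRestrict fun s a => ⟨⟨s, a.1⟩, a.2, rfl⟩, ?_⟩
  rintro s ⟨b, hb⟩
  obtain ⟨a, ha, rfl⟩ := Emb.mk_mem_image_elt.1 hb
  exact ⟨⟨a, ha⟩, rfl⟩

theorem Emb.codRestrict_surjective (f : Emb M N) (s : Srt J) : Function.Surjective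
    ((f.codRestrict (B := f.elt '' Set.univ) fun s a => ⟨⟨s, a⟩, trivial, rfl⟩).toFun s) := by
  rintro ⟨b, hb⟩
  obtain ⟨a, -, rfl⟩ := Emb.mk_mem_image_elt.1 hb
  exact ⟨a, rfl⟩

theorem Emb.iso_restrict_range (f : Emb M N) : Iso M (N.restrict (f.elt '' Set.univ)) :=
  ⟨_, f.codRestrict_surjective⟩

theorem Emb.exists_leftInverse (f : Emb M N) :
    ∃ r : Emb (N.restrict (f.elt '' Set.univ)) M, ∀ s a h, r.toFun s ⟨f.toFun s a, h⟩ = a :=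
  ⟨Emb.symm _ f.codRestrict_surjective, fun _ a _ =>
    Emb.symm_apply _ f.codRestrict_surjective a⟩

theorem IsSCS.of_iso {Jsub : ℕ+ → Tup J → Tup J} {M N : Str.{u, w} J} (hM : IsSCS Jsub M)
    (h : Iso M N) : IsSCS Jsub N := by
  obtain ⟨G, D, hG⟩ := hM
  exact ⟨G, D, hG.trans h⟩

end

/-! ### Subsystems -/

/-- Closure conditions which characterize the subsystems of a sorted complete system. -/
structure Closed {J : Type u} (Jsub : ℕ+ → Tup J → Tup J) (M : Str.{u, w} J) (A : Set M.Elt) :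
    Prop where
  sim : ∀ ⦃s t : Srt J⦄ ⦃a : M.carrier s⦄ ⦃b : M.carrier t⦄, (⟨s, a⟩ : M.Elt) ∈ A → M.Sim b a →
    s.2.support ⊆ t.2.support → (⟨t, b⟩ : M.Elt) ∈ A
  top : ∀ ⦃s : Srt J⦄ ⦃b : M.carrier s⦄, (∀ (t : Srt J) (x : M.carrier t), M.le x b) →
    (⟨s, b⟩ : M.Elt) ∈ A
  of_le : ∀ ⦃s t : Srt J⦄ ⦃a : M.carrier s⦄ ⦃b : M.carrier t⦄, (⟨s, a⟩ : M.Elt) ∈ A → M.le a b →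
    t.2 = Jsub s.1 s.2 → (⟨t, b⟩ : M.Elt) ∈ A
  isMeet : ∀ ⦃s t r : Srt J⦄ ⦃a : M.carrier s⦄ ⦃b : M.carrier t⦄ ⦃c : M.carrier r⦄,
    (⟨s, a⟩ : M.Elt) ∈ A → (⟨t, b⟩ : M.Elt) ∈ A → M.IsMeet a b c → r.2 = s.2.append t.2 →
    (⟨r, c⟩ : M.Elt) ∈ A

namespace Closed

variable {J : Type u} {Jsub : ℕ+ → Tup J → Tup J} {M : Str.{u, w} J} {A : Set M.Elt}

theorem univ : Closed Jsub M Set.univ where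
  sim _ _ _ _ _ _ _ := trivial
  top _ _ _ := trivial
  of_le _ _ _ _ _ _ _ := trivial
  isMeet _ _ _ _ _ _ _ _ _ _ := trivial

theorem sInter {𝒜 : Set (Set M.Elt)} (h : ∀ A ∈ 𝒜, Closed Jsub M A) :
    Closed Jsub M (⋂₀ 𝒜) where
  sim _ _ _ _ ha hab hst A hA := (h A hA).sim (ha A hA) hab hst
  top _ _ hb A hA := (h A hA).top hb
  of_le _ _ _ _ ha hab hst A hA := (h A hA).of_le (ha A hA) hab hst
  isMeet _ _ _ _ _ _ ha hb hc hr A hA := (h A hA).isMeet (ha A hA) (hb A hA) hc hr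

theorem setOf_le (hM : SCSAxioms Jsub M) (p : M.Elt) : Closed Jsub M {q | M.le p.2 q.2} where
  sim _ _ _ _ ha hab _ := hM.le_trans ha hab.2
  top _ _ hb := hb _ _
  of_le _ _ _ _ ha hab _ := hM.le_trans ha hab
  isMeet _ _ _ _ _ _ ha hb hc _ := hc.2.2 _ _ ha hb

theorem exists_forall_mem_le [Nonempty (Tup J)] (hM : SCSAxioms Jsub M) (hA : Closed Jsub M A)
    {S : Set M.Elt} (hS : S.Finite) (hSA : S ⊆ A) : ∃ p ∈ A, ∀ q ∈ S, M.le p.2 q.2 := by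
  induction S, hS using Set.Finite.induction_on with
  | empty =>
    obtain ⟨x, -⟩ := hM.nonempty_one (Classical.arbitrary (Tup J))
    exact ⟨⟨_, x⟩, hA.top fun t y => hM.le_one x y, by simp⟩
  | @insert a S _ _ ih =>
    obtain ⟨p, hpA, hp⟩ := ih ((Set.subset_insert a S).trans hSA)
    obtain ⟨c, -, hc⟩ := hM.exists_isMeet p.2 a.2
    refine ⟨⟨_, c⟩, hA.isMeet hpA (hSA (Set.mem_insert a S)) hc rfl, ?_⟩
    rintro q (rfl | hq)
    · exact hc.2.1
    · exact hM.le_trans hc.1 (hp q hq)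

theorem encard_simClass_restrict (hA : Closed Jsub M A) {s : Srt J}
    (a : (M.restrict A).carrier s) :
    ((M.restrict A).simClass a).encard = (M.simClass a.1).encard := by
  have image_eq : (inclusion M A).toFun s '' (M.restrict A).simClass a = M.simClass a.1 := by
    ext b
    refine ⟨?_, fun hb => ⟨⟨b, hA.sim a.2 hb subset_rfl⟩, hb, rfl⟩⟩
    rintro ⟨b, hb, rfl⟩
    exact hb
  rw [← image_eq, ((inclusion M A).inj s).encard_image]

section Axioms

variable (hM : SCSAxioms Jsub M) (hA : Closed Jsub M A)
include hM hA

theorem cosetAxioms : CosetAxioms (M.restrict A) where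
  C_refl _ a := hM.C_refl a.1
  C_trans _ _ _ _ _ _ h h' := hM.C_trans h h'
  C_le _ _ _ _ h := hM.C_le h
  exists_image _ _ _ b h := by
    obtain ⟨b', hb', hC⟩ := hM.exists_image h
    exact ⟨⟨b', hA.sim b.2 hb' subset_rfl⟩, hb', hC⟩
  image_unique _ _ _ _ _ h h' hb := Subtype.ext (hM.image_unique h h' hb)
  exists_preimage _ _ a _ h := by
    obtain ⟨a', ha', hC⟩ := hM.exists_preimage h
    exact ⟨⟨a', hA.sim a.2 ha' subset_rfl⟩, ha', hC⟩
  C_of_fiber _ _ _ a _ _ hb H := hM.C_of_fiber hb fun a' ha' hC =>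
    H ⟨a', hA.sim a.2 ha' subset_rfl⟩ ha' hC

theorem productAxioms : ProductAxioms (M.restrict A) where
  P_sim _ _ _ _ h := hM.P_sim h
  P_total _ _ b h := by
    obtain ⟨c, hc⟩ := hM.P_total h
    exact ⟨⟨c, hA.sim b.2 (hM.P_sim hc).2.symm subset_rfl⟩, hc⟩
  P_unique _ _ _ _ _ h h' := Subtype.ext (hM.P_unique h h')
  P_assoc _ _ _ _ _ _ _ hx hy hz := hM.P_assoc hx hy hz
  P_one _ a := by
    obtain ⟨e, he, h⟩ := hM.P_one a.1
    refine ⟨⟨e, hA.sim a.2 he subset_rfl⟩, he, fun b hb => ?_⟩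
    obtain ⟨one_mul, c, hc⟩ := h b.1 hb
    exact ⟨one_mul, ⟨c, hA.sim b.2 (hM.P_sim hc).1 subset_rfl⟩, hc⟩
  P_image _ _ _ _ _ _ _ _ h ha hb hc hab hbc := hM.P_image h ha hb hc hab hbc

theorem sortAxioms : SortAxioms Jsub (M.restrict A) where
  encard_simClass_le _ a := (hA.encard_simClass_restrict a).trans_le (hM.encard_simClass_le a.1)
  exists_sim _ _ _ a hT hm := by
    obtain ⟨b, hb⟩ := hM.exists_sim hT ((hA.encard_simClass_restrict a).ge.trans hm)
    exact ⟨⟨b, hA.sim a.2 hb hT⟩, hb⟩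
  nonempty_one T := by
    obtain ⟨x, -⟩ := hM.nonempty_one T
    exact ⟨⟨x, hA.top fun _ y => hM.le_one x y⟩, trivial⟩
  le_one _ _ x y := hM.le_one x.1 y.1
  exists_jointlyInjective _ _ a b := by
    obtain ⟨c, h, hc⟩ := hM.exists_isMeet a.1 b.1
    exact ⟨⟨c, hA.isMeet a.2 b.2 hc rfl⟩, hc.1, hc.2.1, fun x y a' b' hx hy ha hb hxa hya hxb hyb =>
      Subtype.ext (h x.1 y.1 a'.1 b'.1 hx hy ha hb hxa hya hxb hyb)⟩
  exists_C_iff s a x hx hmul hconj := by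
    obtain ⟨b, hb⟩ := hM.exists_C_iff (x := fun i => (x i).1) hx hmul fun g y i h => hconj
      ⟨g, hA.sim (x i).2 (hM.P_sim h).1 subset_rfl⟩
      ⟨y, hA.sim (x i).2 (hM.P_sim h).2.symm subset_rfl⟩ i h
    let i₀ : Fin s.1 := ⟨0, s.1.pos⟩
    have hC : M.C (x i₀).1 b := (hb _ (hx _)).2 ⟨_, rfl⟩
    refine ⟨⟨b, hA.of_le (x i₀).2 (hM.C_le hC) rfl⟩, fun h hh => ?_⟩
    exact (hb h.1 hh).trans (exists_congr fun i => Subtype.ext_iff.symm)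

theorem scsAxioms : SCSAxioms Jsub (M.restrict A) :=
  { hA.cosetAxioms hM, hA.productAxioms hM, hA.sortAxioms hM with
    le_refl := fun _ a => hM.le_refl a.1
    le_trans := fun _ _ _ _ _ _ h h' => hM.le_trans h h' }

end Axioms

end Closed

namespace SCSAxioms

variable {J : Type u} {Jsub : ℕ+ → Tup J → Tup J} {M : Str.{u, w} J} {A : Set M.Elt}
  {s t : Srt J} (hM : SCSAxioms Jsub M) (hA : SCSAxioms Jsub (M.restrict A))
include hM hA

theorem image_simClass_restrict (a : (M.restrict A).carrier s) :
    (inclusion M A).toFun s '' (M.restrict A).simClass a = M.simClass a.1 := by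
  have subset : (inclusion M A).toFun s '' (M.restrict A).simClass a ⊆ M.simClass a.1 := by
    rintro _ ⟨x, hx, rfl⟩
    exact hx
  -- The class of `a` also has a copy in the sort of `A` that only has room for its part in `A`.
  refine Set.eq_of_subset_of_ncard_le subset ?_ (hM.finite_simClass _)
  rw [Set.ncard_image_of_injective _ ((inclusion M A).inj s)]
  obtain ⟨b, hb⟩ := hA.exists_sim_of_ncard_le ⟨_, hA.ncard_simClass_pos a⟩ a subset_rfl le_rfl
  exact (hM.ncard_simClass_congr (a := b.1) (b := a.1) hb).symm.trans_le (hM.ncard_simClass_le b.1)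

theorem ncard_simClass_restrict (a : (M.restrict A).carrier s) :
    ((M.restrict A).simClass a).ncard = (M.simClass a.1).ncard := by
  rw [← hM.image_simClass_restrict hA, Set.ncard_image_of_injective _ ((inclusion M A).inj s)]

theorem mem_of_sim (a : (M.restrict A).carrier s) {b : M.carrier s} (h : M.Sim b a.1) :
    (⟨s, b⟩ : M.Elt) ∈ A := by
  obtain ⟨x, -, rfl⟩ := (hM.image_simClass_restrict hA a).ge h
  exact x.2

theorem mem_of_sim_of_support_subset (a : (M.restrict A).carrier s) {b : M.carrier t}
    (h : M.Sim b a.1) (hst : s.2.support ⊆ t.2.support) : (⟨t, b⟩ : M.Elt) ∈ A := by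
  obtain ⟨b', hb'⟩ := hA.exists_sim_of_ncard_le t.1 a hst <| by
    rw [hM.ncard_simClass_restrict hA, ← hM.ncard_simClass_congr h]
    exact hM.ncard_simClass_le b
  exact hM.mem_of_sim hA b' (hM.sim_trans h (Str.Sim.symm hb'))

/-- The inclusion of the group of an element of a substructure in its group in the whole
structure. -/
noncomputable def simGroupInclusion (a : (M.restrict A).carrier s) :
    hA.SimGroup a →* hM.SimGroup a.1 :=
  MonoidHom.mk' (fun x => ⟨x.1.1, x.2⟩) fun x y =>
    ((hM.P_iff_mul_eq ⟨x.1.1, x.2⟩ ⟨y.1.1, y.2⟩ ⟨(x * y).1.1, (x * y).2⟩).1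
      (hA.P_mul x y)).symm

theorem closed_of_restrict : Closed Jsub M A where
  sim _ _ a _ ha hab hst := hM.mem_of_sim_of_support_subset hA ⟨a, ha⟩ hab hst
  top s _ hb := by
    obtain ⟨x, -⟩ := hA.nonempty_one s.2
    exact hM.mem_of_sim_of_support_subset hA x ⟨hM.le_one _ _, hb _ _⟩ subset_rfl
  of_le s _ a b ha hab hst := by
    let a' : (M.restrict A).carrier s := ⟨a, ha⟩
    obtain ⟨b', hb'⟩ :=
      hA.exists_C_iff_mem (a := a') ((hM.transition hab).ker.comap (hM.simGroupInclusion hA a'))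
    obtain ⟨hab', ker_eq⟩ := hM.ker_transition_eq_of_forall_C_iff_mem (K := (hM.transition hab).ker)
      fun x => hb' ⟨⟨x.1, hM.mem_of_sim hA a' x.2⟩, x.2⟩
    have sim : M.Sim b'.1 b := (hM.sim_iff_ker_eq_ker hab' hab).2 ker_eq
    exact hM.mem_of_sim_of_support_subset hA b' sim.symm (by rw [hst])
  isMeet s t _ a b c ha hb hc hr := by
    let a' : (M.restrict A).carrier s := ⟨a, ha⟩
    let b' : (M.restrict A).carrier t := ⟨b, hb⟩
    obtain ⟨d, hd, hda, hdb, -⟩ := hA.exists_isMeet a' b'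
    have isMeet_d : M.IsMeet a b d.1 := hM.isMeet_of_jointlyInjective hda hdb
      fun x y p q hx hy hp hq hxp hyp hxq hyq => congrArg Subtype.val <|
        hd ⟨x, hM.mem_of_sim hA d hx⟩ ⟨y, hM.mem_of_sim hA d hy⟩ ⟨p, hM.mem_of_sim hA a' hp⟩
          ⟨q, hM.mem_of_sim hA b' hq⟩ hx hy hp hq hxp hyp hxq hyq
    exact hM.mem_of_sim_of_support_subset hA d
      ⟨isMeet_d.2.2 _ _ hc.1 hc.2.1, hc.2.2 _ _ isMeet_d.1 isMeet_d.2.1⟩ (by rw [hr])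

end SCSAxioms

/-! ### Representations of structures by sorted profinite groups -/

/-- A description of the structure `M` by open normal subgroups and cosets of a sorted profinite
group: `a` stands for a coset of `ker a`, whose elements `g` are those with `mem a g`. It amounts to
an isomorphism `M ≃ systemOf G D`, but avoids the dependent types that occur in the latter. -/
structure Rep {J : Type u} {Jsub : ℕ+ → Tup J → Tup J} (M : Str.{u, w} J)
    (G : ProfiniteGrp.{w'}) (D : SortingData Jsub G) where
  ker : ∀ {s : Srt J}, M.carrier s → OpenNormalSubgroup G
  mem : ∀ {s : Srt J}, M.carrier s → G → Prop
  index_le : ∀ {s : Srt J} (a : M.carrier s), (ker a).toSubgroup.index ≤ s.1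
  sort_mem : ∀ {s : Srt J} (a : M.carrier s), s.2 ∈ D.F (ker a)
  exists_mem : ∀ {s : Srt J} (a : M.carrier s), ∃ g, mem a g
  mem_iff : ∀ {s : Srt J} {a : M.carrier s} {g : G}, mem a g → ∀ h, mem a h ↔ g⁻¹ * h ∈ ker a
  le_iff : ∀ {s t : Srt J} (a : M.carrier s) (b : M.carrier t), M.le a b ↔ ker a ≤ ker b
  C_iff : ∀ {s t : Srt J} (a : M.carrier s) (b : M.carrier t),
    M.C a b ↔ ∀ g, mem a g → mem b g
  P_iff : ∀ {s : Srt J} (a b c : M.carrier s), M.P a b c ↔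
    ker a = ker b ∧ ker b = ker c ∧ ∃ g h, mem a g ∧ mem b h ∧ mem c (g * h)
  eq_of_mem : ∀ {s : Srt J} {a b : M.carrier s}, ker a = ker b → ∀ {g}, mem a g → mem b g → a = b
  exists_elt : ∀ (s : Srt J) (N : OpenNormalSubgroup G), N.toSubgroup.index ≤ s.1 →
    s.2 ∈ D.F N → ∀ g, ∃ a : M.carrier s, ker a = N ∧ mem a g

theorem exists_subgroup_coe_eq {G : Type*} [Group G] {N : Subgroup G} [N.Normal] [N.FiniteIndex]
    {U : Set G} (hne : U.Nonempty) (hmul : ∀ g ∈ U, ∀ h ∈ U, g * h ∈ U)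
    (hN : ∀ g ∈ U, ∀ n ∈ N, g * n ∈ U) : ∃ K : Subgroup G, (K : Set G) = U ∧ N ≤ K := by
  have index_pos := Nat.pos_of_ne_zero (Subgroup.FiniteIndex.index_ne_zero (H := N))
  have pow_mem (g) (hg : g ∈ U) (n : ℕ) (hn : 0 < n) : g ^ n ∈ U := by
    induction n, hn using Nat.le_induction with
    | base => simpa using hg
    | succ n _ ih => exact pow_succ g n ▸ hmul _ ih _ hg
  have one_mem : 1 ∈ U := by
    obtain ⟨g, hg⟩ := hne
    simpa using hN _ (pow_mem g hg _ index_pos) _ (N.inv_mem (N.pow_index_mem g))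
  have inv_mem (g) (hg : g ∈ U) : g⁻¹ ∈ U := by
    have := hN _ (pow_mem g hg (N.index + (N.index - 1)) (by lia)) _
      (N.inv_mem (N.pow_mem (N.pow_index_mem g) 2))
    convert this using 1
    rw [← pow_mul, eq_mul_inv_iff_mul_eq, inv_mul_eq_iff_eq_mul, ← pow_succ']
    congr 1
    lia
  refine ⟨⟨⟨⟨U, fun {g h} hg hh => hmul g hg h hh⟩, one_mem⟩, fun {g} => inv_mem g⟩, rfl, ?_⟩
  exact fun n hn => by simpa using hN 1 one_mem n hn

section

variable {J : Type u} {Jsub : ℕ+ → Tup J → Tup J}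

/-- The description of the system of a sorted profinite group. -/
def systemRep (G : ProfiniteGrp.{w}) (D : SortingData Jsub G) : Rep (systemOf G D) G D where
  ker a := a.1.1
  mem a g := (QuotientGroup.mk g : G ⧸ a.1.1.toSubgroup) = a.2
  index_le a := a.1.2.1
  sort_mem a := a.1.2.2
  exists_mem a := QuotientGroup.mk_surjective a.2
  mem_iff {s a g} hg h := by
    rw [← hg, eq_comm]
    exact QuotientGroup.eq
  le_iff a b := Iff.rfl
  C_iff a b := Iff.rfl
  P_iff {s} a b c := by
    constructor
    · rintro ⟨N, x, y, rfl, rfl, rfl⟩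
      obtain ⟨g, rfl⟩ := QuotientGroup.mk_surjective x
      obtain ⟨h, rfl⟩ := QuotientGroup.mk_surjective y
      exact ⟨rfl, rfl, g, h, rfl, rfl, rfl⟩
    · obtain ⟨⟨N, hN⟩, x⟩ := a
      obtain ⟨⟨N', hN'⟩, y⟩ := b
      obtain ⟨⟨N'', hN''⟩, z⟩ := c
      rintro ⟨h, h', g, g', hg, hg', hg''⟩
      dsimp only at h h'
      subst h h'
      dsimp only at hg hg' hg''
      subst hg hg' hg''
      exact ⟨⟨N, hN⟩, _, _, rfl, rfl, rfl⟩
  eq_of_mem {s a b} h g hg hg' := by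
    obtain ⟨⟨N, hN⟩, x⟩ := a
    obtain ⟨⟨N', hN'⟩, y⟩ := b
    dsimp only at h
    subst h
    dsimp only at hg hg'
    rw [← hg, ← hg']
  exists_elt s N hN hs g := ⟨⟨⟨N, hN, hs⟩, QuotientGroup.mk g⟩, rfl, rfl⟩

/-- Transport of a description along an isomorphism. -/
def Rep.comap {M : Str.{u, w} J} {N : Str.{u, w'} J} {G : ProfiniteGrp.{w''}}
    {D : SortingData Jsub G} (R : Rep N G D) (f : Emb M N)
    (hf : ∀ s, Function.Surjective (f.toFun s)) : Rep M G D where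
  ker a := R.ker (f.toFun _ a)
  mem a g := R.mem (f.toFun _ a) g
  index_le a := R.index_le _
  sort_mem a := R.sort_mem _
  exists_mem a := R.exists_mem _
  mem_iff hg h := R.mem_iff hg h
  le_iff a b := (f.map_le a b).symm.trans (R.le_iff _ _)
  C_iff a b := (f.map_C a b).symm.trans (R.C_iff _ _)
  P_iff a b c := (f.map_P a b c).symm.trans (R.P_iff _ _ _)
  eq_of_mem h _ hg hg' := f.inj _ (R.eq_of_mem h hg hg')
  exists_elt s N hN hs g := by
    obtain ⟨b, hb⟩ := R.exists_elt s N hN hs g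
    obtain ⟨a, rfl⟩ := hf s b
    exact ⟨a, hb⟩

theorem Rep.iso {M : Str.{u, w} J} {N : Str.{u, w'} J} {G : ProfiniteGrp.{w''}}
    {D : SortingData Jsub G} (R : Rep M G D) (R' : Rep N G D) : Iso M N := by
  have exists_same_coset (s : Srt J) (a : M.carrier s) :
      ∃ b : N.carrier s, R'.ker b = R.ker a ∧ ∀ g, R'.mem b g ↔ R.mem a g := by
    obtain ⟨g, hg⟩ := R.exists_mem a
    obtain ⟨b, hb, hg'⟩ := R'.exists_elt s (R.ker a) (R.index_le a) (R.sort_mem a) g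
    exact ⟨b, hb, fun h => by rw [R.mem_iff hg, R'.mem_iff hg', hb]⟩
  choose f hf hf' using exists_same_coset
  refine ⟨⟨f, fun s a b hab => ?_, fun a b => ?_, fun a b => ?_, fun a b c => ?_⟩, fun s b => ?_⟩
  · obtain ⟨g, hg⟩ := R.exists_mem a
    refine R.eq_of_mem ?_ hg ?_
    · rw [← hf, hab, hf]
    · rwa [← hf', ← hab, hf']
  · rw [R.le_iff, R'.le_iff, hf, hf]
  · simp only [R.C_iff, R'.C_iff, hf']
  · simp only [R.P_iff, R'.P_iff, hf, hf']
  · obtain ⟨g, hg⟩ := R'.exists_mem b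
    obtain ⟨a, ha, hg'⟩ := R.exists_elt s (R'.ker b) (R'.index_le b) (R'.sort_mem b) g
    exact ⟨a, R'.eq_of_mem ((hf s a).trans ha) ((hf' s a g).2 hg') hg⟩

theorem IsSCS.exists_rep {M : Str.{u, w} J} (hM : IsSCS Jsub M) :
    ∃ (G : ProfiniteGrp.{w}) (D : SortingData Jsub G), Nonempty (Rep M G D) := by
  obtain ⟨G, D, h⟩ := hM
  obtain ⟨f, hf⟩ := h.symm
  exact ⟨G, D, ⟨(systemRep G D).comap f hf⟩⟩

theorem Rep.isSCS {M : Str.{u, w} J} {G : ProfiniteGrp.{w}} {D : SortingData Jsub G}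
    (R : Rep M G D) : IsSCS Jsub M :=
  ⟨G, D, (systemRep G D).iso R⟩

namespace Rep

variable {M : Str.{u, w} J} {G : ProfiniteGrp.{w'}} {D : SortingData Jsub G} (R : Rep M G D)
  {s t : Srt J}

include R

theorem sim_iff (a : M.carrier s) (b : M.carrier t) : M.Sim a b ↔ R.ker a = R.ker b := by
  rw [Str.Sim, R.le_iff, R.le_iff]
  exact ⟨fun h => le_antisymm h.1 h.2, fun h => ⟨h.le, h.ge⟩⟩

theorem mem_mul {a : M.carrier s} {g n : G} (hg : R.mem a g) (hn : n ∈ R.ker a) :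
    R.mem a (g * n) := by
  rwa [R.mem_iff hg, inv_mul_cancel_left]

theorem exists_coset (a : M.carrier s) (g : G) :
    ∃ b : M.carrier s, R.ker b = R.ker a ∧ R.mem b g :=
  R.exists_elt s _ (R.index_le a) (R.sort_mem a) g

theorem C_of_mem {a : M.carrier s} {b : M.carrier t} (h : R.ker a ≤ R.ker b) {g : G}
    (hg : R.mem a g) (hg' : R.mem b g) : M.C a b :=
  (R.C_iff _ _).2 fun k hk => (R.mem_iff hg' k).2 (h ((R.mem_iff hg k).1 hk))

theorem ker_le_of_C {a : M.carrier s} {b : M.carrier t} (h : M.C a b) : R.ker a ≤ R.ker b := by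
  intro n hn
  obtain ⟨g, hg⟩ := R.exists_mem a
  have hgn := (R.C_iff _ _).1 h _ (R.mem_mul hg hn)
  rwa [R.mem_iff ((R.C_iff _ _).1 h g hg), inv_mul_cancel_left] at hgn

theorem mem_of_P {a b c : M.carrier s} (h : M.P a b c) {g k : G} (hg : R.mem a g)
    (hk : R.mem b k) : R.mem c (g * k) := by
  obtain ⟨hab, hbc, g', k', hg', hk', hgk⟩ := (R.P_iff _ _ _).1 h
  rw [R.mem_iff hgk]
  rw [R.mem_iff hg', hab, hbc] at hg
  rw [R.mem_iff hk', hbc] at hk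
  have : (g' * k')⁻¹ * (g * k) = (k'⁻¹ * (g'⁻¹ * g) * k'⁻¹⁻¹) * (k'⁻¹ * k) := by group
  rw [this]
  exact mul_mem ((R.ker c).isNormal'.conj_mem _ hg _) hk

theorem finiteIndex_ker (a : M.carrier s) : (R.ker a).toSubgroup.FiniteIndex :=
  have := Subgroup.quotient_finite_of_isOpen _ (R.ker a).toOpenSubgroup.isOpen
  Subgroup.finiteIndex_of_finite_quotient

theorem encard_simClass (a : M.carrier s) :
    (M.simClass a).encard = (R.ker a).toSubgroup.index := by
  have := R.finiteIndex_ker a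
  choose f ker_f mem_f using fun q : G ⧸ (R.ker a).toSubgroup => R.exists_coset a q.out
  have f_injective : Function.Injective f := fun q q' h => by
    rw [← q.out_eq', ← q'.out_eq']
    have := (R.mem_iff (mem_f q) q'.out).1 (h ▸ mem_f q')
    rw [ker_f] at this
    exact QuotientGroup.eq.2 this
  have range_f : Set.range f = M.simClass a := by
    refine Set.Subset.antisymm ?_ fun b hb => ?_
    · rintro _ ⟨q, rfl⟩
      exact (R.sim_iff _ _).2 (ker_f q)
    · obtain ⟨g, hg⟩ := R.exists_mem b
      have hb := (R.sim_iff _ _).1 hb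
      refine ⟨QuotientGroup.mk g, R.eq_of_mem ((ker_f _).trans hb.symm) (mem_f _) ?_⟩
      rw [R.mem_iff hg, hb]
      exact QuotientGroup.eq.1 (Quotient.out_eq' _).symm
  rw [← range_f, ← Set.image_univ, f_injective.encard_image, Set.encard_univ,
    ENat.card_eq_coe_natCard]
  rfl

theorem orderAxioms : OrderAxioms M where
  le_refl _ a := (R.le_iff a a).2 le_rfl
  le_trans _ _ _ _ _ _ h h' :=
    (R.le_iff _ _).2 (((R.le_iff _ _).1 h).trans ((R.le_iff _ _).1 h'))

theorem cosetAxioms : CosetAxioms M where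
  C_refl _ a := (R.C_iff a a).2 fun _ h => h
  C_trans _ _ _ _ _ _ h h' :=
    (R.C_iff _ _).2 fun g hg => (R.C_iff _ _).1 h' g ((R.C_iff _ _).1 h g hg)
  C_le _ _ _ _ h := (R.le_iff _ _).2 (R.ker_le_of_C h)
  exists_image _ _ a b h := by
    obtain ⟨g, hg⟩ := R.exists_mem a
    obtain ⟨b', hb', hg'⟩ := R.exists_coset b g
    exact ⟨b', (R.sim_iff _ _).2 hb', R.C_of_mem (hb' ▸ (R.le_iff _ _).1 h) hg hg'⟩
  image_unique _ _ a _ _ h h' hb := by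
    obtain ⟨g, hg⟩ := R.exists_mem a
    exact R.eq_of_mem ((R.sim_iff _ _).1 hb) ((R.C_iff _ _).1 h g hg) ((R.C_iff _ _).1 h' g hg)
  exists_preimage _ _ a b h := by
    obtain ⟨g, hg⟩ := R.exists_mem b
    obtain ⟨a', ha', hg'⟩ := R.exists_coset a g
    exact ⟨a', (R.sim_iff _ _).2 ha', R.C_of_mem (ha' ▸ (R.le_iff _ _).1 h) hg' hg⟩
  C_of_fiber _ _ _ a b b' hab H := by
    refine (R.C_iff _ _).2 fun g hg => ?_
    obtain ⟨a', ha', hg'⟩ := R.exists_coset a g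
    have hab' : M.C a' b := R.C_of_mem (ha' ▸ R.ker_le_of_C hab) hg' hg
    exact (R.C_iff _ _).1 (H a' ((R.sim_iff _ _).2 ha') hab') g hg'

theorem productAxioms : ProductAxioms M where
  P_sim _ a b c h := by
    obtain ⟨hab, hbc, -⟩ := (R.P_iff _ _ _).1 h
    exact ⟨(R.sim_iff _ _).2 hab, (R.sim_iff _ _).2 hbc⟩
  P_total _ a b h := by
    obtain ⟨g, hg⟩ := R.exists_mem a
    obtain ⟨k, hk⟩ := R.exists_mem b
    obtain ⟨c, hc, hgk⟩ := R.exists_coset b (g * k)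
    exact ⟨c, (R.P_iff _ _ _).2 ⟨(R.sim_iff _ _).1 h, hc.symm, g, k, hg, hk, hgk⟩⟩
  P_unique _ a b c c' h h' := by
    obtain ⟨g, hg⟩ := R.exists_mem a
    obtain ⟨k, hk⟩ := R.exists_mem b
    have hbc := ((R.P_iff _ _ _).1 h).2.1
    have hbc' := ((R.P_iff _ _ _).1 h').2.1
    exact R.eq_of_mem (hbc.symm.trans hbc') (R.mem_of_P h hg hk) (R.mem_of_P h' hg hk)
  P_assoc _ a b c x y z hx hy hz := by
    obtain ⟨g, hg⟩ := R.exists_mem a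
    obtain ⟨k, hk⟩ := R.exists_mem b
    obtain ⟨l, hl⟩ := R.exists_mem c
    obtain ⟨hab, -, -⟩ := (R.P_iff _ _ _).1 hx
    obtain ⟨-, hcy, -⟩ := (R.P_iff _ _ _).1 hy
    obtain ⟨hbc, hcz, -⟩ := (R.P_iff _ _ _).1 hz
    refine (R.P_iff _ _ _).2 ⟨hab.trans (hbc.trans hcz), hcz.symm.trans hcy, g, k * l, hg,
      R.mem_of_P hz hk hl, ?_⟩
    rw [← mul_assoc]
    exact R.mem_of_P hy (R.mem_of_P hx hg hk) hl
  P_one _ a := by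
    obtain ⟨e, he, one_mem⟩ := R.exists_coset a 1
    refine ⟨e, (R.sim_iff _ _).2 he, fun b hb => ?_⟩
    rw [R.sim_iff] at hb
    obtain ⟨g, hg⟩ := R.exists_mem b
    obtain ⟨c, hc, hgc⟩ := R.exists_coset a g⁻¹
    exact ⟨(R.P_iff _ _ _).2 ⟨he.trans hb.symm, rfl, 1, g, one_mem, hg, by simpa using hg⟩,
      c, (R.P_iff _ _ _).2 ⟨hc.trans hb.symm, hb.trans he.symm, g⁻¹, g, hgc, hg,
        by simpa using one_mem⟩⟩
  P_image _ _ a b c a' b' c' h ha hb hc hab hbc := by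
    obtain ⟨g, hg⟩ := R.exists_mem a
    obtain ⟨k, hk⟩ := R.exists_mem b
    exact (R.P_iff _ _ _).2 ⟨(R.sim_iff _ _).1 hab, (R.sim_iff _ _).1 hbc, g, k,
      (R.C_iff _ _).1 ha _ hg, (R.C_iff _ _).1 hb _ hk, (R.C_iff _ _).1 hc _ (R.mem_of_P h hg hk)⟩

theorem jointlyInjective_of_ker_eq_inf {r : Srt J} {a : M.carrier s} {b : M.carrier t}
    {c : M.carrier r} (hc : R.ker c = R.ker a ⊓ R.ker b) : M.JointlyInjective a b c := by
  intro x y a' b' hx hy ha hb hxa hya hxb hyb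
  rw [R.sim_iff] at hx hy ha hb
  obtain ⟨g, hg⟩ := R.exists_mem x
  obtain ⟨k, hk⟩ := R.exists_mem y
  have mem_a : k⁻¹ * g ∈ R.ker a :=
    ha ▸ (R.mem_iff ((R.C_iff _ _).1 hya _ hk) _).1 ((R.C_iff _ _).1 hxa _ hg)
  have mem_b : k⁻¹ * g ∈ R.ker b :=
    hb ▸ (R.mem_iff ((R.C_iff _ _).1 hyb _ hk) _).1 ((R.C_iff _ _).1 hxb _ hg)
  refine R.eq_of_mem (hx.trans hy.symm) hg ((R.mem_iff hk _).2 ?_)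
  rw [hy, hc]
  exact ⟨mem_a, mem_b⟩

theorem exists_openNormalSubgroup {ι : Type*} [Nonempty ι] {a : M.carrier s}
    {x : ι → M.carrier s} (hx : ∀ i, M.Sim (x i) a) (hmul : ∀ i j, ∃ l, M.P (x i) (x j) (x l))
    (hconj : ∀ g y i, M.P g (x i) y → ∃ j, M.P (x j) g y) :
    ∃ N : OpenNormalSubgroup G, R.ker a ≤ N ∧ ∀ g, g ∈ N ↔ ∃ i, R.mem (x i) g := by
  have ker_x (i) : R.ker (x i) = R.ker a := (R.sim_iff _ _).1 (hx i)
  have := R.finiteIndex_ker a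
  have := (R.ker a).isNormal'
  obtain ⟨K, hK, hle⟩ := exists_subgroup_coe_eq (N := (R.ker a).toSubgroup)
    (U := {g | ∃ i, R.mem (x i) g})
    (by
      obtain ⟨g, hg⟩ := R.exists_mem (x (Classical.arbitrary ι))
      exact ⟨g, _, hg⟩)
    (by
      rintro g ⟨i, hg⟩ h ⟨j, hh⟩
      obtain ⟨l, hl⟩ := hmul i j
      exact ⟨l, R.mem_of_P hl hg hh⟩)
    (by
      rintro g ⟨i, hg⟩ n hn
      exact ⟨i, R.mem_mul hg (ker_x i ▸ hn)⟩)
  have mem_K (g) : g ∈ K ↔ ∃ i, R.mem (x i) g := Set.ext_iff.1 hK g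
  have conj_mem (g) (hg : g ∈ K) (c) : c * g * c⁻¹ ∈ K := by
    obtain ⟨i, hg⟩ := (mem_K g).1 hg
    obtain ⟨c', hc', hcm⟩ := R.exists_coset (x i) c
    obtain ⟨y, hy, hym⟩ := R.exists_coset (x i) (c * g)
    obtain ⟨j, hj⟩ := hconj c' y i ((R.P_iff _ _ _).2 ⟨hc', hy.symm, c, g, hcm, hg, hym⟩)
    obtain ⟨k, hk⟩ := R.exists_mem (x j)
    have hkc := (R.mem_iff hym _).1 (R.mem_of_P hj hk hcm)
    rw [hy, ker_x] at hkc
    refine (mem_K _).2 ⟨j, (R.mem_iff hk _).2 ?_⟩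
    have : k⁻¹ * (c * g * c⁻¹) = c * ((c * g)⁻¹ * (k * c))⁻¹ * c⁻¹ := by group
    rw [ker_x, this]
    exact (R.ker a).isNormal'.conj_mem _ (inv_mem hkc) c
  exact ⟨{ toSubgroup := K
           isOpen' := Subgroup.isOpen_mono hle (R.ker a).toOpenSubgroup.isOpen
           isNormal' := ⟨conj_mem⟩ }, hle, mem_K⟩

theorem sortAxioms : SortAxioms Jsub M where
  encard_simClass_le _ a := R.encard_simClass a ▸ Nat.cast_le.2 (R.index_le a)
  exists_sim _ m T a hT hm := by
    rw [R.encard_simClass, Nat.cast_le] at hm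
    obtain ⟨b, hb, -⟩ := R.exists_elt (m, T) (R.ker a) hm ((D.root _ _).1 (R.sort_mem a) hT) 1
    exact ⟨b, (R.sim_iff _ _).2 hb⟩
  nonempty_one T := by
    obtain ⟨b, -⟩ := R.exists_elt (1, T) ⟨⊤, inferInstanceAs (⊤ : Subgroup G).Normal⟩
      (Subgroup.index_top (G := G)).le (by rw [D.whole _ rfl]; exact Set.mem_univ _) 1
    exact ⟨b, trivial⟩
  le_one T t x y := by
    have index_eq_one : (R.ker x).toSubgroup.index = 1 :=
      le_antisymm (R.index_le x) (Nat.pos_of_ne_zero (R.finiteIndex_ker x).index_ne_zero)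
    exact (R.le_iff _ _).2 fun g _ => (Subgroup.index_eq_one.1 index_eq_one).ge (Subgroup.mem_top g)
  exists_jointlyInjective s t a b := by
    obtain ⟨c, hc, -⟩ := R.exists_elt (s.1 * t.1, s.2.append t.2) (R.ker a ⊓ R.ker b)
      (Subgroup.index_inf_le.trans (Nat.mul_le_mul (R.index_le a) (R.index_le b)))
      (D.inter _ _ _ _ (R.sort_mem a) (R.sort_mem b)) 1
    exact ⟨c, (R.le_iff _ _).2 (hc.trans_le inf_le_left),
      (R.le_iff _ _).2 (hc.trans_le inf_le_right), R.jointlyInjective_of_ker_eq_inf hc⟩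
  exists_C_iff s a x hx hmul hconj := by
    have : Nonempty (Fin s.1) := ⟨⟨0, s.1.pos⟩⟩
    obtain ⟨N, hle, mem_N⟩ := R.exists_openNormalSubgroup hx hmul hconj
    have := R.finiteIndex_ker a
    have index_le : N.toSubgroup.index ≤ s.1 := (Subgroup.index_antitone hle).trans (R.index_le a)
    obtain ⟨b, hb, one_mem⟩ := R.exists_elt (s.1, Jsub s.1 s.2) N index_le
      (D.up _ _ _ _ hle (R.index_le a) (R.sort_mem a)) 1
    have mem_b (g) : R.mem b g ↔ ∃ i, R.mem (x i) g := by
      rw [R.mem_iff one_mem, inv_one, one_mul, hb, mem_N]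
    refine ⟨b, fun h hh => ⟨fun hC => ?_, ?_⟩⟩
    · obtain ⟨g, hg⟩ := R.exists_mem h
      obtain ⟨i, hi⟩ := (mem_b g).1 ((R.C_iff _ _).1 hC g hg)
      have ker_h : R.ker h = R.ker (x i) :=
        ((R.sim_iff _ _).1 hh).trans ((R.sim_iff _ _).1 (hx i)).symm
      exact ⟨i, R.eq_of_mem ker_h hg hi⟩
    · rintro ⟨i, rfl⟩
      exact (R.C_iff _ _).2 fun g hg => (mem_b g).2 ⟨i, hg⟩

theorem scsAxioms : SCSAxioms Jsub M :=
  { R.orderAxioms, R.cosetAxioms, R.productAxioms, R.sortAxioms with }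

end Rep

theorem IsSCS.scsAxioms {M : Str.{u, w} J} (hM : IsSCS Jsub M) : SCSAxioms Jsub M := by
  obtain ⟨G, D, ⟨R⟩⟩ := hM.exists_rep
  exact R.scsAxioms

theorem IsSCS.nonempty_tup {M : Str.{u, w} J} (hM : IsSCS Jsub M) : Nonempty (Tup J) := by
  obtain ⟨G, D, -⟩ := hM
  exact (D.nonempty ⟨⊤, inferInstanceAs (⊤ : Subgroup G).Normal⟩).to_type

end

/-! ### The profinite group of a model of the axioms -/

section

variable {J : Type u} {Jsub : ℕ+ → Tup J → Tup J} {M : Str.{u, w} J}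

namespace SCSAxioms

instance (hM : SCSAxioms Jsub M) {s : Srt J} (a : M.carrier s) :
    TopologicalSpace (hM.SimGroup a) := ⊥

instance (hM : SCSAxioms Jsub M) {s : Srt J} (a : M.carrier s) :
    DiscreteTopology (hM.SimGroup a) := ⟨rfl⟩

/-- The families that are compatible with the transition maps out of the group of `p`. -/
def threadsFrom (hM : SCSAxioms Jsub M) (p : M.Elt) : Set (∀ q : M.Elt, hM.SimGroup q.2) :=
  {x | ∀ (q : M.Elt) (h : M.le p.2 q.2), hM.transition h (x p) = x q}

/-- The inverse limit of the groups of the elements of `M`. -/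
def threads (hM : SCSAxioms Jsub M) : Subgroup (∀ p : M.Elt, hM.SimGroup p.2) where
  carrier := {x | ∀ p, x ∈ hM.threadsFrom p}
  mul_mem' {x y} hx hy p q h := by
    rw [Pi.mul_apply, Pi.mul_apply, map_mul, hx p q h, hy p q h]
  one_mem' p q h := map_one _
  inv_mem' {x} hx p q h := by
    rw [Pi.inv_apply, Pi.inv_apply, map_inv, hx p q h]

variable (hM : SCSAxioms Jsub M) {s t r : Srt J}

theorem isClosed_threadsFrom (p : M.Elt) : IsClosed (hM.threadsFrom p) := by
  simp only [threadsFrom, Set.ofPred_forall]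
  exact isClosed_iInter fun q => isClosed_iInter fun h => isClosed_eq
    (continuous_of_discreteTopology.comp (continuous_apply p)) (continuous_apply q)

theorem threadsFrom_subset {p q : M.Elt} (hpq : M.le p.2 q.2) :
    hM.threadsFrom p ⊆ hM.threadsFrom q := by
  intro x hx r hqr
  rw [← hx q hpq, hM.transition_transition]
  exact hx r _

theorem exists_mem_threadsFrom (p : M.Elt) (z : hM.SimGroup p.2) :
    ∃ x ∈ hM.threadsFrom p, x p = z := by
  classical
  let x : ∀ q : M.Elt, hM.SimGroup q.2 := fun q =>
    if h : M.le p.2 q.2 then hM.transition h z else 1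
  have x_eq (q) (h : M.le p.2 q.2) : x q = hM.transition h z := dif_pos h
  have x_self : x p = z :=
    (x_eq p (hM.le_refl _)).trans ((hM.C_iff_transition_eq _ _ _).1 (hM.C_refl _))
  exact ⟨x, fun q h => by rw [x_self, x_eq q h], x_self⟩

theorem isClosed_threads : IsClosed (hM.threads : Set (∀ p : M.Elt, hM.SimGroup p.2)) := by
  have : (hM.threads : Set (∀ p : M.Elt, hM.SimGroup p.2)) = ⋂ p, hM.threadsFrom p :=
    Set.ext fun _ => Set.mem_iInter.symm
  exact this ▸ isClosed_iInter hM.isClosed_threadsFrom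

instance : CompactSpace hM.threads :=
  isCompact_iff_compactSpace.1 hM.isClosed_threads.isCompact

/-- The profinite group that the elements of `M` are the cosets of. -/
noncomputable def profiniteGroup : ProfiniteGrp.{max u w} := ProfiniteGrp.of hM.threads

/-- The projection of the profinite group of `M` to the group of `a`. -/
noncomputable def proj (a : M.carrier s) : hM.profiniteGroup →* hM.SimGroup a :=
  (Pi.evalMonoidHom (fun p : M.Elt => hM.SimGroup p.2) ⟨s, a⟩).comp hM.threads.subtype

theorem continuous_proj (a : M.carrier s) : Continuous (hM.proj a) :=
  (continuous_apply (⟨s, a⟩ : M.Elt)).comp continuous_subtype_val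

theorem transition_proj {a : M.carrier s} {b : M.carrier t} (h : M.le a b)
    (g : hM.profiniteGroup) : hM.transition h (hM.proj a g) = hM.proj b g :=
  g.2 ⟨s, a⟩ ⟨t, b⟩ h

theorem proj_surjective (a : M.carrier s) : Function.Surjective (hM.proj a) := by
  intro y
  let Z : {q : M.Elt // M.le q.2 a} → Set (∀ p : M.Elt, hM.SimGroup p.2) := fun q =>
    {x | x ⟨s, a⟩ = y} ∩ hM.threadsFrom q
  have Z_closed (q) : IsClosed (Z q) :=
    (isClosed_eq (continuous_apply _) continuous_const).inter (hM.isClosed_threadsFrom q)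
  have Z_nonempty (q) : (Z q).Nonempty := by
    obtain ⟨z, rfl⟩ := hM.transition_surjective q.2 y
    obtain ⟨x, hx, rfl⟩ := hM.exists_mem_threadsFrom q z
    exact ⟨x, (hx ⟨s, a⟩ q.2).symm, hx⟩
  have Z_directed : Directed (· ⊇ ·) Z := fun q q' => by
    obtain ⟨c, -, hcq, hcq', -⟩ := hM.exists_isMeet q.1.2 q'.1.2
    exact ⟨⟨⟨_, c⟩, hM.le_trans hcq q.2⟩,
      Set.inter_subset_inter_right _ (hM.threadsFrom_subset (p := ⟨_, c⟩) hcq),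
      Set.inter_subset_inter_right _ (hM.threadsFrom_subset (p := ⟨_, c⟩) hcq')⟩
  have : Nonempty {q : M.Elt // M.le q.2 a} := ⟨⟨⟨s, a⟩, hM.le_refl a⟩⟩
  obtain ⟨x, hx⟩ := IsCompact.nonempty_iInter_of_directed_nonempty_isCompact_isClosed Z Z_directed
    Z_nonempty (fun q => (Z_closed q).isCompact) Z_closed
  rw [Set.mem_iInter] at hx
  refine ⟨⟨x, fun p => ?_⟩, (hx ⟨⟨s, a⟩, hM.le_refl a⟩).1⟩
  obtain ⟨c, -, hca, hcp, -⟩ := hM.exists_isMeet a p.2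
  exact hM.threadsFrom_subset (p := ⟨_, c⟩) hcp (hx ⟨⟨_, c⟩, hca⟩).2

/-- The kernel of the projection to the group of `a`: the subgroup `N` for `a = gN`. -/
noncomputable def kernel (a : M.carrier s) : OpenNormalSubgroup hM.profiniteGroup where
  toSubgroup := (hM.proj a).ker
  isOpen' := (isOpen_discrete ({1} : Set (hM.SimGroup a))).preimage (hM.continuous_proj a)
  isNormal' := inferInstanceAs (hM.proj a).ker.Normal

theorem mem_kernel {a : M.carrier s} {g : hM.profiniteGroup} :
    g ∈ hM.kernel a ↔ hM.proj a g = 1 :=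
  Iff.rfl

theorem index_kernel (a : M.carrier s) :
    (hM.kernel a).toSubgroup.index = (M.simClass a).ncard := by
  change (hM.proj a).ker.index = _
  rw [Subgroup.index_ker, MonoidHom.range_eq_top.2 (hM.proj_surjective a), Subgroup.card_top,
    hM.card_simGroup]

theorem kernel_le_iff {a : M.carrier s} {b : M.carrier t} :
    hM.kernel a ≤ hM.kernel b ↔ M.le a b := by
  refine ⟨fun h => ?_, fun h g hg => ?_⟩
  · obtain ⟨c, -, hca, hcb, -⟩ := hM.exists_isMeet a b
    refine (hM.le_iff_ker_le_ker hca hcb).2 fun x hx => ?_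
    obtain ⟨g, rfl⟩ := hM.proj_surjective c x
    rw [MonoidHom.mem_ker, hM.transition_proj] at hx ⊢
    exact h hx
  · rw [mem_kernel] at hg ⊢
    rw [← hM.transition_proj h, hg, map_one]

theorem kernel_eq_iff {a : M.carrier s} {b : M.carrier t} :
    hM.kernel a = hM.kernel b ↔ M.Sim a b := by
  rw [le_antisymm_iff, kernel_le_iff, kernel_le_iff, Str.Sim]

theorem kernel_eq_inf_of_jointlyInjective {a : M.carrier s} {b : M.carrier t} {c : M.carrier r}
    (hca : M.le c a) (hcb : M.le c b) (h : M.JointlyInjective a b c) :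
    hM.kernel c = hM.kernel a ⊓ hM.kernel b := by
  refine le_antisymm (le_inf (hM.kernel_le_iff.2 hca) (hM.kernel_le_iff.2 hcb)) ?_
  rintro g ⟨hga, hgb⟩
  have : hM.proj c g ∈ (hM.transition hca).ker ⊓ (hM.transition hcb).ker :=
    ⟨(hM.transition_proj hca g).trans hga, (hM.transition_proj hcb g).trans hgb⟩
  rwa [hM.ker_inf_ker_of_jointlyInjective hca hcb h] at this

theorem exists_kernel_le [Nonempty (Tup J)] (N : OpenNormalSubgroup hM.profiniteGroup) :
    ∃ p : M.Elt, hM.kernel p.2 ≤ N := by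
  obtain ⟨U, hU, hUN⟩ := isOpen_induced_iff.1 N.toOpenSubgroup.isOpen
  have mem_U (g : hM.profiniteGroup) : g.1 ∈ U ↔ g ∈ N := Set.ext_iff.1 hUN g
  obtain ⟨I, V, hV, hVU⟩ := isOpen_pi_iff.1 hU 1 ((mem_U 1).2 (one_mem N))
  obtain ⟨p, -, hp⟩ := Closed.univ.exists_forall_mem_le hM I.finite_toSet (Set.subset_univ _)
  refine ⟨p, fun g hg => (mem_U g).1 <| hVU fun q hq => ?_⟩
  have proj_eq_one : g.1 q = 1 := hM.kernel_le_iff.2 (hp q hq) hg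
  exact proj_eq_one ▸ (hV q hq).2

theorem exists_kernel_eq_of_kernel_le {N : OpenNormalSubgroup hM.profiniteGroup}
    {a : M.carrier s} (haN : hM.kernel a ≤ N) :
    ∃ b : M.carrier (s.1, Jsub s.1 s.2), hM.kernel b = N := by
  have : (N.toSubgroup.map (hM.proj a)).Normal := N.isNormal'.map _ (hM.proj_surjective a)
  obtain ⟨b, hab, ker_eq⟩ := hM.exists_ker_transition_eq (N.toSubgroup.map (hM.proj a))
  refine ⟨b, SetLike.ext fun g => ?_⟩
  rw [mem_kernel, ← hM.transition_proj hab, ← MonoidHom.mem_ker, ker_eq, ← Subgroup.mem_comap,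
    Subgroup.comap_map_eq_self haN]
  rfl

theorem exists_kernel_eq [Nonempty (Tup J)] (N : OpenNormalSubgroup hM.profiniteGroup) :
    ∃ p : M.Elt, hM.kernel p.2 = N := by
  obtain ⟨p, hp⟩ := hM.exists_kernel_le N
  obtain ⟨b, hb⟩ := hM.exists_kernel_eq_of_kernel_le hp
  exact ⟨⟨_, b⟩, hb⟩

theorem exists_kernel_eq_kernel {m : ℕ+} {T : Tup J} (a : M.carrier s)
    (hT : s.2.support ⊆ T.support) (hm : (hM.kernel a).toSubgroup.index ≤ m) :
    ∃ b : M.carrier (m, T), hM.kernel b = hM.kernel a := by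
  rw [index_kernel] at hm
  obtain ⟨b, hb⟩ := hM.exists_sim_of_ncard_le m a hT hm
  exact ⟨b, hM.kernel_eq_iff.2 hb⟩

theorem index_kernel_le (a : M.carrier s) : (hM.kernel a).toSubgroup.index ≤ s.1 :=
  (hM.index_kernel a).trans_le (hM.ncard_simClass_le a)

/-- The tuples `T` such that `N` is the subgroup of an element of sort `(k, T)` for some `k`. -/
def tuples (N : OpenNormalSubgroup hM.profiniteGroup) : Set (Tup J) :=
  {T | ∃ (k : ℕ+) (a : M.carrier (k, T)), hM.kernel a = N}

theorem mem_tuples_of_support_subset {N : OpenNormalSubgroup hM.profiniteGroup} {T T' : Tup J}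
    (hT : T ∈ hM.tuples N) (hTT' : T.support ⊆ T'.support) : T' ∈ hM.tuples N := by
  obtain ⟨k, a, rfl⟩ := hT
  exact ⟨k, hM.exists_kernel_eq_kernel a hTT' (hM.index_kernel_le a)⟩

theorem tuples_eq_univ {N : OpenNormalSubgroup hM.profiniteGroup} (hN : N.toSubgroup = ⊤) :
    hM.tuples N = Set.univ := by
  refine Set.eq_univ_of_forall fun T => ?_
  obtain ⟨x, -⟩ := hM.nonempty_one T
  have index_eq_one : (hM.kernel x).toSubgroup.index = 1 :=
    le_antisymm (hM.index_kernel_le x)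
      ((hM.ncard_simClass_pos x).trans_eq (hM.index_kernel x).symm)
  rw [Subgroup.index_eq_one, ← hN] at index_eq_one
  exact ⟨1, x, SetLike.ext fun g => SetLike.ext_iff.1 index_eq_one g⟩

theorem jsub_mem_tuples {N₁ N₂ : OpenNormalSubgroup hM.profiniteGroup} {k : ℕ+} {T : Tup J}
    (hN : N₁ ≤ N₂) (hk : N₁.toSubgroup.index ≤ k) (hT : T ∈ hM.tuples N₁) :
    Jsub k T ∈ hM.tuples N₂ := by
  obtain ⟨l, a, rfl⟩ := hT
  obtain ⟨a', ha'⟩ := hM.exists_kernel_eq_kernel a subset_rfl hk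
  exact ⟨k, hM.exists_kernel_eq_of_kernel_le (ha'.trans_le hN)⟩

theorem append_mem_tuples {N₁ N₂ : OpenNormalSubgroup hM.profiniteGroup} {T₁ T₂ : Tup J}
    (h₁ : T₁ ∈ hM.tuples N₁) (h₂ : T₂ ∈ hM.tuples N₂) :
    T₁.append T₂ ∈ hM.tuples (N₁ ⊓ N₂) := by
  obtain ⟨k₁, a, rfl⟩ := h₁
  obtain ⟨k₂, b, rfl⟩ := h₂
  obtain ⟨c, hc, hca, hcb, -⟩ := hM.exists_isMeet a b
  exact ⟨k₁ * k₂, c, hM.kernel_eq_inf_of_jointlyInjective hca hcb hc⟩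

/-- The sorting data on the profinite group of `M`. -/
def sortingData [Nonempty (Tup J)] : SortingData Jsub hM.profiniteGroup where
  F := hM.tuples
  nonempty N := by
    obtain ⟨p, hp⟩ := hM.exists_kernel_eq N
    exact ⟨p.1.2, p.1.1, p.2, hp⟩
  whole _ := hM.tuples_eq_univ
  root _ T := ⟨fun h _ => hM.mem_tuples_of_support_subset h, fun h => h (subset_refl T.support)⟩
  perm N T T' h := ⟨fun hT => hM.mem_tuples_of_support_subset hT fun _ => h.mem_iff.1,
    fun hT => hM.mem_tuples_of_support_subset hT fun _ => h.mem_iff.2⟩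
  up _ _ _ _ := hM.jsub_mem_tuples
  inter _ _ _ _ := hM.append_mem_tuples
  conj N₁ N₂ g h := by
    have : N₁ = N₂ := SetLike.ext fun x => by
      have := N₁.isNormal'.mem_comm_iff (a := g * x) (b := g⁻¹)
      rw [inv_mul_cancel_left] at this
      exact this.symm.trans (h x).symm
    rw [this]

theorem exists_proj_val_eq (a : M.carrier s) : ∃ g, (hM.proj a g).val = a := by
  obtain ⟨g, hg⟩ := hM.proj_surjective a ⟨a, hM.sim_refl a⟩
  exact ⟨g, by rw [hg]⟩

theorem proj_val_eq_iff {a : M.carrier s} {g : hM.profiniteGroup} (hg : (hM.proj a g).val = a)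
    (h : hM.profiniteGroup) : (hM.proj a h).val = a ↔ g⁻¹ * h ∈ hM.kernel a := by
  rw [mem_kernel, map_mul, map_inv, inv_mul_eq_one, SimGroup.ext_iff, hg, eq_comm]

theorem proj_val_congr {a b : M.carrier s} (h : M.Sim a b) (g : hM.profiniteGroup) :
    (hM.proj a g).val = (hM.proj b g).val := by
  refine hM.eq_of_C ?_ (hM.sim_trans (hM.proj a g).2 (hM.sim_trans h (hM.proj b g).2.symm))
  rw [← hM.transition_proj h.1]
  exact hM.C_transition _ _

theorem C_iff_forall_proj_val_eq (a : M.carrier s) (b : M.carrier t) :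
    M.C a b ↔ ∀ g, (hM.proj a g).val = a → (hM.proj b g).val = b := by
  constructor
  · intro h g hg
    have hab := hM.C_transition (hM.C_le h) (hM.proj a g)
    rw [hM.transition_proj, hg] at hab
    exact hM.image_unique hab h (hM.proj b g).2
  · intro h
    obtain ⟨g, hg⟩ := hM.exists_proj_val_eq a
    have kernel_le : hM.kernel a ≤ hM.kernel b := fun n hn => by
      have := h (g * n) ((hM.proj_val_eq_iff hg _).2 (by rwa [inv_mul_cancel_left]))
      rwa [hM.proj_val_eq_iff (h g hg), inv_mul_cancel_left] at this
    have hab := hM.C_transition (hM.kernel_le_iff.1 kernel_le) (hM.proj a g)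
    rwa [hM.transition_proj, hg, h g hg] at hab

theorem P_iff_proj_val_mul_eq {a b c : M.carrier s} (hab : M.Sim a b) (hbc : M.Sim b c)
    {g k : hM.profiniteGroup} (hg : (hM.proj a g).val = a) (hk : (hM.proj b k).val = b) :
    M.P a b c ↔ (hM.proj c (g * k)).val = c := by
  have P_proj := hM.P_mul (hM.proj c g) (hM.proj c k)
  rw [hM.proj_val_congr (hM.sim_trans hab hbc).symm g, hM.proj_val_congr hbc.symm k, hg, hk,
    ← map_mul] at P_proj
  exact ⟨hM.P_unique P_proj, fun h => by rwa [h] at P_proj⟩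

/-- The description of `M` by its profinite group. -/
noncomputable def rep [Nonempty (Tup J)] : Rep M hM.profiniteGroup hM.sortingData where
  ker := hM.kernel
  mem a g := (hM.proj a g).val = a
  index_le := hM.index_kernel_le
  sort_mem {s} a := ⟨s.1, a, rfl⟩
  exists_mem := hM.exists_proj_val_eq
  mem_iff := hM.proj_val_eq_iff
  le_iff _ _ := hM.kernel_le_iff.symm
  C_iff := hM.C_iff_forall_proj_val_eq
  P_iff a b c := by
    simp only [kernel_eq_iff]
    refine ⟨fun h => ?_, fun ⟨hab, hbc, g, k, hg, hk, h⟩ =>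
      (hM.P_iff_proj_val_mul_eq hab hbc hg hk).2 h⟩
    obtain ⟨hab, hbc⟩ := hM.P_sim h
    obtain ⟨g, hg⟩ := hM.exists_proj_val_eq a
    obtain ⟨k, hk⟩ := hM.exists_proj_val_eq b
    exact ⟨hab, hbc, g, k, hg, hk, (hM.P_iff_proj_val_mul_eq hab hbc hg hk).1 h⟩
  eq_of_mem h _ hg hg' := by rw [← hg, ← hg', hM.proj_val_congr (hM.kernel_eq_iff.1 h)]
  exists_elt s N hN hs g := by
    obtain ⟨k, a, rfl⟩ := hs
    obtain ⟨b, hb⟩ := hM.exists_kernel_eq_kernel a subset_rfl hN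
    have sim_b := (hM.proj b g).2
    exact ⟨(hM.proj b g).val, (hM.kernel_eq_iff.2 sim_b).trans hb, hM.proj_val_congr sim_b g⟩

theorem isSCS [Nonempty (Tup J)] {M : Str.{u, max u v} J} (hM : SCSAxioms Jsub M) : IsSCS Jsub M :=
  Rep.isSCS (G := hM.profiniteGroup) hM.rep

end SCSAxioms

end

/-! ### Generated subsystems -/

section

variable {J : Type u} {Jsub : ℕ+ → Tup J → Tup J}

/-- The locally full hull of a set of elements. -/
def Str.fullHull (M : Str.{u, w} J) (X : Set M.Elt) : Set M.Elt :=
  {p | ∃ b : M.carrier p.1, (⟨p.1, b⟩ : M.Elt) ∈ X ∧ M.Sim p.2 b}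

/-- The set `X` is finite and locally full, and it has a least element: these are the presystems of
which a first-order formula can speak. -/
structure IsFrame (M : Str.{u, w} J) (X : Set M.Elt) : Prop where
  finite : X.Finite
  locallyFull : LocallyFull M X
  exists_least : ∃ p ∈ X, ∀ q ∈ X, M.le p.2 q.2

section FullHull

variable {M : Str.{u, w} J} {A X : Set M.Elt} (hM : SCSAxioms Jsub M)
include hM

theorem SCSAxioms.subset_fullHull : X ⊆ M.fullHull X :=
  fun p hp => ⟨p.2, hp, hM.sim_refl p.2⟩

theorem SCSAxioms.finite_fullHull (hX : X.Finite) : (M.fullHull X).Finite := by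
  refine (hX.biUnion fun q _ => (hM.finite_simClass q.2).image (Sigma.mk q.1)).subset ?_
  rintro ⟨s, a⟩ ⟨b, hb, hab⟩
  exact Set.mem_biUnion hb ⟨a, hab, rfl⟩

theorem SCSAxioms.locallyFull_fullHull : LocallyFull M (M.fullHull X) := by
  rintro s a b ⟨c, hc, hac⟩ hab hba
  exact ⟨c, hc, hM.sim_trans ⟨hba, hab⟩ hac⟩

omit hM in
theorem Closed.fullHull_subset (hA : Closed Jsub M A) (h : X ⊆ A) : M.fullHull X ⊆ A := by
  rintro ⟨s, a⟩ ⟨b, hb, hab⟩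
  exact hA.sim (h hb) hab subset_rfl

theorem IsSubsystem.closed (hA : IsSubsystem Jsub M A) : Closed Jsub M A :=
  hM.closed_of_restrict hA.scsAxioms

theorem SCSAxioms.closed_generated (X : Set M.Elt) : Closed Jsub M (generated Jsub M X) :=
  Closed.sInter fun _ hA => hA.1.closed hM

omit hM in
theorem subset_generated (X : Set M.Elt) : X ⊆ generated Jsub M X :=
  fun _ hp _ hA => hA.2 hp

end FullHull

variable [Nonempty (Tup J)] {M N : Str.{u, max u v} J} {A X Y : Set M.Elt}
  (hM : SCSAxioms Jsub M)
include hM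

theorem Closed.isSubsystem (hA : Closed Jsub M A) : IsSubsystem Jsub M A :=
  SCSAxioms.isSCS.{u, v} (hA.scsAxioms hM)

theorem Closed.generated_subset (hA : Closed Jsub M A) (h : X ⊆ A) : generated Jsub M X ⊆ A :=
  fun _ hp => hp A ⟨hA.isSubsystem.{u, v} hM, h⟩

theorem SCSAxioms.generated_subset_generated (h : X ⊆ generated Jsub M Y) :
    generated Jsub M X ⊆ generated Jsub M Y :=
  (hM.closed_generated Y).generated_subset.{u, v} hM h

theorem Closed.image (hN : SCSAxioms Jsub N) (f : Emb M N) (hA : Closed Jsub M A) :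
    Closed Jsub N (f.elt '' A) :=
  hN.closed_of_restrict ((hA.isSubsystem.{u, v} hM).of_iso (f.iso_restrict_image A)).scsAxioms

theorem SCSAxioms.exists_map_eq_of_sim (hN : SCSAxioms Jsub N) (f : Emb M N) {s : Srt J}
    {a : M.carrier s} {b : N.carrier s} (h : N.Sim b (f.toFun s a)) : ∃ c, f.toFun s c = b := by
  have closed_image := Closed.univ.image.{u, v} hM hN f
  obtain ⟨c, -, hc⟩ := Emb.mk_mem_image_elt.1 <|
    closed_image.sim (Emb.mk_mem_image_elt.2 ⟨a, trivial, rfl⟩) h subset_rfl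
  exact ⟨c, hc⟩

theorem Closed.preimage (hN : SCSAxioms Jsub N) (f : Emb M N) {B : Set N.Elt}
    (hB : Closed Jsub N B) (hBf : B ⊆ Set.range f.elt) : Closed Jsub M (f.elt ⁻¹' B) := by
  have iso := f.iso_restrict_image (f.elt ⁻¹' B)
  rw [Set.image_preimage_eq_iff.2 hBf] at iso
  exact hM.closed_of_restrict ((hB.isSubsystem.{u, v} hN).of_iso iso.symm).scsAxioms

theorem SCSAxioms.image_generated (hN : SCSAxioms Jsub N) (f : Emb M N) (X : Set M.Elt) :
    f.elt '' generated Jsub M X = generated Jsub N (f.elt '' X) := by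
  have closed_range : Closed Jsub N (Set.range f.elt) :=
    Set.image_univ (f := f.elt) ▸ Closed.univ.image.{u, v} hM hN f
  apply subset_antisymm
  · have subset_range : generated Jsub N (f.elt '' X) ⊆ Set.range f.elt :=
      closed_range.generated_subset.{u, v} hN (Set.image_subset_range _ _)
    exact Set.image_subset_iff.2 <|
      ((hN.closed_generated _).preimage.{u, v} hM hN f subset_range).generated_subset.{u, v} hM <|
        Set.image_subset_iff.1 (subset_generated _)
  · exact ((hM.closed_generated X).image.{u, v} hM hN f).generated_subset.{u, v} hN
      (Set.image_mono (subset_generated X))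

theorem SCSAxioms.exists_least_generated (hX : X.Finite) :
    ∃ p ∈ generated Jsub M X, ∀ q ∈ generated Jsub M X, M.le p.2 q.2 := by
  obtain ⟨p, hp, h⟩ := (hM.closed_generated X).exists_forall_mem_le hM hX (subset_generated X)
  exact ⟨p, hp, (Closed.setOf_le hM p).generated_subset.{u, v} hM h⟩

theorem IsFrame.exists_forall_mem_generated_le (hX : IsFrame M X) :
    ∃ p ∈ X, ∀ q ∈ generated Jsub M X, M.le p.2 q.2 := by
  obtain ⟨p, hp, h⟩ := hX.exists_least
  exact ⟨p, hp, (Closed.setOf_le hM p).generated_subset.{u, v} hM h⟩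

theorem IsFrame.isPresystem (hX : IsFrame M X) : IsPresystem Jsub M X := by
  obtain ⟨p, hp, h⟩ := hX.exists_forall_mem_generated_le.{u, v} hM
  exact ⟨hX.locallyFull, fun q hq => ⟨p, hp, h q hq⟩⟩

theorem SCSAxioms.exists_isFrame (hX : X.Finite) :
    ∃ Y, IsFrame M Y ∧ X ⊆ Y ∧ generated Jsub M Y = generated Jsub M X := by
  obtain ⟨p, hp, p_le⟩ := hM.exists_least_generated.{u, v} hX
  let Y := M.fullHull (insert p X)
  have hpY : p ∈ Y := hM.subset_fullHull (Set.mem_insert p X)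
  have hXY : X ⊆ Y := (Set.subset_insert p X).trans hM.subset_fullHull
  have hYX : Y ⊆ generated Jsub M X :=
    (hM.closed_generated X).fullHull_subset (Set.insert_subset hp (subset_generated X))
  refine ⟨Y, ⟨hM.finite_fullHull (hX.insert p), hM.locallyFull_fullHull, p, hpY,
    fun q hq => p_le q (hYX hq)⟩, hXY, ?_⟩
  exact subset_antisymm (hM.generated_subset_generated.{u, v} hYX)
    (hM.generated_subset_generated.{u, v} (hXY.trans (subset_generated Y)))

theorem LocallyFull.image (hN : SCSAxioms Jsub N) (f : Emb M N) (hX : LocallyFull M X) :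
    LocallyFull N (f.elt '' X) := by
  intro s _ b ha hab hba
  obtain ⟨a, haX, rfl⟩ := Emb.mk_mem_image_elt.1 ha
  obtain ⟨b, rfl⟩ := hM.exists_map_eq_of_sim.{u, v} hN f ⟨hba, hab⟩
  exact Emb.mk_mem_image_elt.2
    ⟨b, hX s a b haX ((f.map_le a b).1 hab) ((f.map_le b a).1 hba), rfl⟩

theorem IsFrame.image (hN : SCSAxioms Jsub N) (f : Emb M N) (hX : IsFrame M X) :
    IsFrame N (f.elt '' X) where
  finite := hX.finite.image _
  locallyFull := hX.locallyFull.image.{u, v} hM hN f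
  exists_least := by
    obtain ⟨p, hp, h⟩ := hX.exists_least
    refine ⟨f.elt p, ⟨p, hp, rfl⟩, ?_⟩
    rintro _ ⟨q, hq, rfl⟩
    exact (f.map_le _ _).2 (h q hq)

end

/-! ### Extension of finite partial isomorphisms -/

section Corresponds

variable {J : Type u} {Jsub : ℕ+ → Tup J → Tup J} {M : Str.{u, w} J} {M' : Str.{u, w'} J}
  {s t r s₀ : Srt J} {hM : SCSAxioms Jsub M} {hM' : SCSAxioms Jsub M'} {a₀ : M.carrier s₀}
  {a₀' : M'.carrier s₀} (θ : hM.SimGroup a₀ ≃* hM'.SimGroup a₀')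

/-- The elements `b ≥ a₀` and `b' ≥ a₀'` correspond to each other under an isomorphism `θ` of the
groups of `a₀` and `a₀'`: for `a₀ = gN` and `b = hL`, the coset of `L` given by `b` is mapped by `θ`
to the one given by `b'`. -/
structure Corresponds (b : M.carrier s) (b' : M'.carrier s) : Prop where
  le : M.le a₀ b
  le' : M'.le a₀' b'
  C_iff : ∀ x : hM.SimGroup a₀, M.C x.1 b ↔ M'.C (θ x).1 b'

namespace Corresponds

variable {θ} {b : M.carrier s} {b' : M'.carrier s} {d : M.carrier t} {d' : M'.carrier t}

theorem symm (h : Corresponds θ b b') : Corresponds θ.symm b' b :=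
  ⟨h.le', h.le, fun x => by rw [h.C_iff, MulEquiv.apply_symm_apply]⟩

theorem C_of_C (hb : Corresponds θ b b') (hd : Corresponds θ d d') (h : M.C b d) :
    M'.C b' d' := by
  rw [hM'.C_iff_forall_C hb.le']
  intro y hy
  obtain ⟨x, rfl⟩ := θ.surjective y
  exact (hd.C_iff x).1 (hM.C_trans ((hb.C_iff x).2 hy) h)

theorem C_iff_C (hb : Corresponds θ b b') (hd : Corresponds θ d d') : M.C b d ↔ M'.C b' d' :=
  ⟨hb.C_of_C hd, hb.symm.C_of_C hd.symm⟩

theorem ker_eq_comap (hb : Corresponds θ b b') :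
    (hM.transition hb.le).ker = (hM'.transition hb.le').ker.comap θ.toMonoidHom := by
  obtain ⟨y, hy⟩ := hM.exists_C_of_le hb.le
  ext x
  have mem_ker_iff := hM.C_iff_inv_mul_mem_ker hb.le hy (y * x)
  have map_mem_ker_iff := hM'.C_iff_inv_mul_mem_ker hb.le' ((hb.C_iff y).1 hy) (θ (y * x))
  rw [inv_mul_cancel_left] at mem_ker_iff
  rw [map_mul, inv_mul_cancel_left, ← map_mul] at map_mem_ker_iff
  exact mem_ker_iff.symm.trans ((hb.C_iff _).trans map_mem_ker_iff)

theorem of_ker_eq_comap (hb : M.le a₀ b) (hb' : M'.le a₀' b')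
    (h : (hM.transition hb).ker = (hM'.transition hb').ker.comap θ.toMonoidHom)
    {x : hM.SimGroup a₀} (hx : M.C x.1 b) (hx' : M'.C (θ x).1 b') : Corresponds θ b b' where
  le := hb
  le' := hb'
  C_iff y := by
    rw [hM.C_iff_inv_mul_mem_ker hb hx, hM'.C_iff_inv_mul_mem_ker hb' hx', h, ← map_inv, ← map_mul]
    rfl

theorem le_of_le (hb : Corresponds θ b b') (hd : Corresponds θ d d') (h : M.le b d) :
    M'.le b' d' := by
  rw [hM.le_iff_ker_le_ker hb.le hd.le, hb.ker_eq_comap, hd.ker_eq_comap,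
    Subgroup.comap_le_comap_of_surjective θ.surjective] at h
  exact (hM'.le_iff_ker_le_ker hb.le' hd.le').2 h

theorem le_iff_le (hb : Corresponds θ b b') (hd : Corresponds θ d d') : M.le b d ↔ M'.le b' d' :=
  ⟨hb.le_of_le hd, hb.symm.le_of_le hd.symm⟩

theorem sim_of_sim (hb : Corresponds θ b b') (hd : Corresponds θ d d') (h : M.Sim b d) :
    M'.Sim b' d' :=
  ⟨hb.le_of_le hd h.1, hd.le_of_le hb h.2⟩

theorem right_unique {b₁ b₂ : M'.carrier s} (h₁ : Corresponds θ b b₁)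
    (h₂ : Corresponds θ b b₂) : b₁ = b₂ :=
  hM'.eq_of_C (h₁.C_of_C h₂ (hM.C_refl b)) (h₁.sim_of_sim h₂ (hM.sim_refl b))

theorem P_of_P {b₁ b₂ b₃ : M.carrier s} {b₁' b₂' b₃' : M'.carrier s} (h₁ : Corresponds θ b₁ b₁')
    (h₂ : Corresponds θ b₂ b₂') (h₃ : Corresponds θ b₃ b₃') (h : M.P b₁ b₂ b₃) :
    M'.P b₁' b₂' b₃' := by
  obtain ⟨sim₁₂, sim₂₃⟩ := hM.P_sim h
  obtain ⟨x₁, hx₁⟩ := hM.exists_C_of_le h₁.le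
  obtain ⟨x₂, hx₂⟩ := hM.exists_C_of_le h₂.le
  have C_mul : M.C (x₁ * x₂).1 b₃ := by
    have map_x₁ := (hM.C_iff_transition_eq h₃.le x₁ ⟨b₁, hM.sim_trans sim₁₂ sim₂₃⟩).1 hx₁
    have map_x₂ := (hM.C_iff_transition_eq h₃.le x₂ ⟨b₂, sim₂₃⟩).1 hx₂
    rw [hM.C_iff_transition_eq h₃.le _ ⟨b₃, hM.sim_refl _⟩, map_mul, map_x₁, map_x₂,
      ← hM.P_iff_mul_eq]
    exact h
  have C_mul' : M'.C (θ x₁ * θ x₂).1 b₃' := map_mul θ x₁ x₂ ▸ (h₃.C_iff _).1 C_mul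
  exact hM'.P_image (hM'.P_mul (θ x₁) (θ x₂)) ((h₁.C_iff x₁).1 hx₁) ((h₂.C_iff x₂).1 hx₂) C_mul'
    (h₁.sim_of_sim h₂ sim₁₂) (h₂.sim_of_sim h₃ sim₂₃)

theorem P_iff_P {b₁ b₂ b₃ : M.carrier s} {b₁' b₂' b₃' : M'.carrier s}
    (h₁ : Corresponds θ b₁ b₁') (h₂ : Corresponds θ b₂ b₂') (h₃ : Corresponds θ b₃ b₃') :
    M.P b₁ b₂ b₃ ↔ M'.P b₁' b₂' b₃' :=
  ⟨h₁.P_of_P h₂ h₃, h₁.symm.P_of_P h₂.symm h₃.symm⟩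

theorem exists_of_ker_eq_comap (hd : M.le a₀ d) (hb' : M'.le a₀' b')
    (h : (hM.transition hd).ker = (hM'.transition hb').ker.comap θ.toMonoidHom)
    (hst : s.2.support ⊆ t.2.support) : ∃ d' : M'.carrier t, Corresponds θ d d' := by
  have ncard_eq : (M.simClass d).ncard = (M'.simClass b').ncard := by
    rw [← hM.index_ker_transition hd, h, Subgroup.index_comap_of_surjective _ θ.surjective,
      hM'.index_ker_transition]
  obtain ⟨e, he⟩ := hM'.exists_sim_of_ncard_le t.1 b' hst
    (ncard_eq ▸ hM.ncard_simClass_le d)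
  obtain ⟨x, hx⟩ := hM.exists_C_of_le hd
  obtain ⟨d', hd'e, hxd'⟩ := hM'.exists_image
    (hM'.le_trans (θ x).2.1 (hM'.le_trans hb' he.2))
  have sim_d'b' : M'.Sim d' b' := hM'.sim_trans hd'e he
  have hd' : M'.le a₀' d' := hM'.le_trans hb' sim_d'b'.2
  refine ⟨d', of_ker_eq_comap hd hd' ?_ hx hxd'⟩
  rw [h, (hM'.sim_iff_ker_eq_ker hd' hb').1 sim_d'b']

theorem exists_of_sim (hb : Corresponds θ b b') (hd : M.Sim d b)
    (hst : s.2.support ⊆ t.2.support) : ∃ d' : M'.carrier t, Corresponds θ d d' := by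
  have hd₀ : M.le a₀ d := hM.le_trans hb.le hd.2
  refine exists_of_ker_eq_comap hd₀ hb.le' ?_ hst
  rw [(hM.sim_iff_ker_eq_ker hd₀ hb.le).1 hd, hb.ker_eq_comap]

theorem exists_of_le (hb : Corresponds θ b b') (hbd : M.le b d) (ht : t.2 = Jsub s.1 s.2) :
    ∃ d' : M'.carrier t, Corresponds θ d d' := by
  have hd : M.le a₀ d := hM.le_trans hb.le hbd
  let K : Subgroup (hM'.SimGroup a₀') := (hM.transition hd).ker.comap θ.symm.toMonoidHom
  have ker_le_K : (hM'.transition hb.le').ker ≤ K := by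
    rw [hb.symm.ker_eq_comap]
    exact Subgroup.comap_mono ((hM.le_iff_ker_le_ker hb.le hd).1 hbd)
  have : (K.map (hM'.transition hb.le')).Normal :=
    (Subgroup.normal_comap _).map _ (hM'.transition_surjective _)
  obtain ⟨e, hbe, ker_e⟩ := hM'.exists_ker_transition_eq (K.map (hM'.transition hb.le'))
  have he : M'.le a₀' e := hM'.le_trans hb.le' hbe
  have ker_eq_K : (hM'.transition he).ker = K := by
    rw [← Subgroup.comap_map_eq_self ker_le_K, ← ker_e]
    ext x
    rw [Subgroup.mem_comap, MonoidHom.mem_ker, MonoidHom.mem_ker, hM'.transition_transition]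
  refine exists_of_ker_eq_comap hd he ?_ (by rw [ht])
  ext x
  simp [ker_eq_K, K]

theorem exists_of_isMeet (hb : Corresponds θ b b') (hd : Corresponds θ d d') {c : M.carrier r}
    (hc : M.IsMeet b d c) (hr : r.2 = s.2.append t.2) :
    ∃ c' : M'.carrier r, Corresponds θ c c' := by
  obtain ⟨e, -, he⟩ := hM'.exists_isMeet b' d'
  refine exists_of_ker_eq_comap (hc.2.2 _ _ hb.le hd.le) (he.2.2 _ _ hb.le' hd.le') ?_ (by rw [hr])
  rw [hM.ker_transition_eq_inf_of_isMeet hb.le hd.le _ hc,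
    hM'.ker_transition_eq_inf_of_isMeet hb.le' hd.le' _ he, hb.ker_eq_comap, hd.ker_eq_comap,
    Subgroup.comap_inf]

theorem exists_of_forall_le {b : M.carrier s} (hb : ∀ (r : Srt J) (x : M.carrier r), M.le x b) :
    ∃ b' : M'.carrier s, Corresponds θ b b' := by
  obtain ⟨b', hb'⟩ := hM'.exists_forall_le s
  exact ⟨b', hb _ _, hb' _ _, fun x =>
    iff_of_true (hM.C_of_forall_le hb) (hM'.C_of_forall_le hb')⟩

variable (θ) in
theorem closed : Closed Jsub M {p | ∃ b', Corresponds θ p.2 b'} where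
  sim := fun _ _ _ _ ⟨_, h⟩ hab hst => h.exists_of_sim hab hst
  top _ _ hb := exists_of_forall_le hb
  of_le := fun _ _ _ _ ⟨_, h⟩ hab ht => h.exists_of_le hab ht
  isMeet := fun _ _ _ _ _ _ ⟨_, h⟩ ⟨_, h'⟩ hc hr => h.exists_of_isMeet h' hc hr

end Corresponds

end Corresponds

section PartialIso

variable {J : Type u} {Jsub : ℕ+ → Tup J → Tup J} {M' : Str.{u, w'} J} {M : Str.{u, w} J}

/-- The multiplication relation, as a relation between elements of all sorts. -/
def Str.PElt (M : Str.{u, w} J) (p q r : M.Elt) : Prop :=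
  ∃ (s : Srt J) (a b c : M.carrier s), p = ⟨s, a⟩ ∧ q = ⟨s, b⟩ ∧ r = ⟨s, c⟩ ∧ M.P a b c

theorem Str.PElt_mk {s : Srt J} {a b c : M.carrier s} :
    M.PElt ⟨s, a⟩ ⟨s, b⟩ ⟨s, c⟩ ↔ M.P a b c := by
  constructor
  · rintro ⟨t, a', b', c', ha, hb, hc, h⟩
    obtain rfl : s = t := congrArg Sigma.fst ha
    rw [eq_of_heq (Sigma.mk.inj ha).2, eq_of_heq (Sigma.mk.inj hb).2,
      eq_of_heq (Sigma.mk.inj hc).2]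
    exact h
  · exact fun h => ⟨s, a, b, c, rfl, rfl, rfl, h⟩

/-- A partial isomorphism of structures: a relation between their elements which preserves the
sorts and, in both directions, the basic relations. -/
structure PartialIso (T : M.Elt → M'.Elt → Prop) : Prop where
  sort : ∀ {p p'}, T p p' → p.1 = p'.1
  le : ∀ {p p' q q'}, T p p' → T q q' → (M.le p.2 q.2 ↔ M'.le p'.2 q'.2)
  C : ∀ {p p' q q'}, T p p' → T q q' → (M.C p.2 q.2 ↔ M'.C p'.2 q'.2)
  P : ∀ {p p' q q' r r'}, T p p' → T q q' → T r r' → (M.PElt p q r ↔ M'.PElt p' q' r')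

namespace PartialIso

variable (hM : SCSAxioms Jsub M) (hM' : SCSAxioms Jsub M') {T : M.Elt → M'.Elt → Prop}
  (hT : PartialIso T)
include hT

theorem flip : PartialIso (flip T) where
  sort h := (hT.sort h).symm
  le h h' := (hT.le h h').symm
  C h h' := (hT.C h h').symm
  P h h' h'' := (hT.P h h' h'').symm

include hM hM'

theorem right_unique {p : M.Elt} {p' q' : M'.Elt} (h : T p p') (h' : T p q') : p' = q' := by
  have sort_eq : p'.1 = q'.1 := (hT.sort h).symm.trans (hT.sort h')
  have le : M'.le p'.2 q'.2 := (hT.le h h').1 (hM.le_refl p.2)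
  have ge : M'.le q'.2 p'.2 := (hT.le h' h).1 (hM.le_refl p.2)
  have C : M'.C p'.2 q'.2 := (hT.C h h').1 (hM.C_refl p.2)
  obtain ⟨s, a⟩ := p'
  obtain ⟨t, b⟩ := q'
  obtain rfl : s = t := sort_eq
  exact congrArg (Sigma.mk s) (hM'.eq_of_C C ⟨le, ge⟩)

theorem left_unique {p q : M.Elt} {p' : M'.Elt} (h : T p p') (h' : T q p') : p = q :=
  hT.flip.right_unique hM' hM h h'

theorem exists_simGroup {s : Srt J} {a : M.carrier s} {a' : M'.carrier s}
    (h : T ⟨s, a⟩ ⟨s, a'⟩) (hdom : LocallyFull M {p | ∃ p', T p p'}) (x : hM.SimGroup a) :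
    ∃ x' : hM'.SimGroup a', T ⟨s, x.1⟩ ⟨s, x'.1⟩ := by
  obtain ⟨⟨t, x'⟩, hx⟩ := hdom s a x.1 ⟨_, h⟩ x.2.2 x.2.1
  obtain rfl : s = t := hT.sort hx
  exact ⟨⟨x', (hT.le hx h).1 x.2.1, (hT.le h hx).1 x.2.2⟩, hx⟩

theorem exists_mulEquiv {s : Srt J} {a : M.carrier s} {a' : M'.carrier s}
    (h : T ⟨s, a⟩ ⟨s, a'⟩) (hdom : LocallyFull M {p | ∃ p', T p p'})
    (hran : LocallyFull M' {p' | ∃ p, T p p'}) :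
    ∃ θ : hM.SimGroup a ≃* hM'.SimGroup a', ∀ x, T ⟨s, x.1⟩ ⟨s, (θ x).1⟩ := by
  choose f hf using hT.exists_simGroup hM hM' h hdom
  have f_mul (x y) : f (x * y) = f x * f y := by
    rw [eq_comm, ← hM'.P_iff_mul_eq, ← Str.PElt_mk, ← hT.P (hf x) (hf y) (hf (x * y)), Str.PElt_mk]
    exact hM.P_mul x y
  have f_injective : Function.Injective f := fun x y hxy =>
    SCSAxioms.SimGroup.ext <| eq_of_heq <| (Sigma.mk.inj <|
      hT.left_unique hM hM' (hf x) (hxy ▸ hf y)).2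
  have f_surjective : Function.Surjective f := fun x' => by
    obtain ⟨x, hx⟩ := hT.flip.exists_simGroup hM' hM h hran x'
    exact ⟨x, SCSAxioms.SimGroup.ext <| eq_of_heq <| (Sigma.mk.inj <|
      hT.right_unique hM hM' (hf x) hx).2⟩
  exact ⟨MulEquiv.ofBijective (MonoidHom.mk' f f_mul) ⟨f_injective, f_surjective⟩, hf⟩

end PartialIso

end PartialIso

section

variable {J : Type u} {Jsub : ℕ+ → Tup J → Tup J} [Nonempty (Tup J)] {M M' : Str.{u, max u v} J}
  {s t : Srt J}

theorem Corresponds.exists_emb {hM : SCSAxioms Jsub M} {hM' : SCSAxioms Jsub M'}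
    {a : M.carrier s} {a' : M'.carrier s} (θ : hM.SimGroup a ≃* hM'.SimGroup a')
    {X : Set M.Elt} (hX : ∀ p ∈ X, ∃ b', Corresponds θ p.2 b') :
    ∃ f : Emb (M.restrict (generated Jsub M X)) M', ∀ t b, Corresponds θ b.1 (f.toFun t b) := by
  have subset := (Corresponds.closed θ).generated_subset.{u, v} hM hX
  choose f hf using fun t (b : (M.restrict (generated Jsub M X)).carrier t) => subset b.2
  refine ⟨⟨f, fun t b c hbc => Subtype.ext ?_, fun b c => ((hf _ b).le_iff_le (hf _ c)).symm,
    fun b c => ((hf _ b).C_iff_C (hf _ c)).symm,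
    fun b c d => ((hf _ b).P_iff_P (hf _ c) (hf _ d)).symm⟩, hf⟩
  exact (hf t b).symm.right_unique (hbc ▸ (hf t c).symm)

theorem PartialIso.exists_emb (hM : SCSAxioms Jsub M) (hM' : SCSAxioms Jsub M')
    {T : M.Elt → M'.Elt → Prop} (hT : PartialIso T) (hdom : IsFrame M {p | ∃ p', T p p'})
    (hran : LocallyFull M' {p' | ∃ p, T p p'}) :
    ∃ f : Emb (M.restrict (generated Jsub M {p | ∃ p', T p p'})) M',
      ∀ p p', T p p' → ∀ hp : p ∈ generated Jsub M {p | ∃ p', T p p'},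
        f.elt ⟨p.1, ⟨p.2, hp⟩⟩ = p' := by
  obtain ⟨⟨s, a⟩, ⟨⟨s', a'⟩, h⟩, a_le⟩ := hdom.exists_least
  obtain rfl : s = s' := hT.sort h
  obtain ⟨θ, hθ⟩ := hT.exists_mulEquiv hM hM' h hdom.locallyFull hran
  have corresponds {t : Srt J} {b : M.carrier t} {b' : M'.carrier t} (hb : T ⟨t, b⟩ ⟨t, b'⟩) :
      Corresponds θ b b' :=
    ⟨a_le _ ⟨_, hb⟩, (hT.le h hb).1 (a_le _ ⟨_, hb⟩), fun x => hT.C (hθ x) hb⟩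
  obtain ⟨f, hf⟩ := Corresponds.exists_emb.{u, v} θ (X := {p | ∃ p', T p p'}) <| by
    rintro ⟨t, b⟩ ⟨⟨t', b'⟩, hb⟩
    obtain rfl : t = t' := hT.sort hb
    exact ⟨b', corresponds hb⟩
  refine ⟨f, ?_⟩
  rintro ⟨t, b⟩ ⟨t', b'⟩ hb hp
  obtain rfl : t = t' := hT.sort hb
  exact congrArg (Sigma.mk t) ((hf t ⟨b, hp⟩).right_unique (corresponds hb))

theorem Emb.le_of_eqOn_least (hM : SCSAxioms Jsub M) (hM' : SCSAxioms Jsub M') {f g : Emb M M'}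
    {a : M.carrier s} (ha : ∀ (t : Srt J) (b : M.carrier t), M.le a b)
    (h : ∀ x, M.Sim x a → f.toFun s x = g.toFun s x) (b : M.carrier t) :
    M'.le (f.toFun t b) (g.toFun t b) := by
  obtain ⟨x, hx, hxb⟩ := hM.exists_preimage (ha t b)
  refine hM'.C_le (hM'.C_of_fiber ((f.map_C x b).2 hxb) fun y hy hC => ?_)
  obtain ⟨z, rfl⟩ := hM.exists_map_eq_of_sim.{u, v} hM' f hy
  rw [h z (hM.sim_trans ((f.map_sim z x).1 hy) hx)]
  exact (g.map_C z b).2 ((f.map_C z b).1 hC)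

theorem Emb.eq_of_eqOn_least (hM : SCSAxioms Jsub M) (hM' : SCSAxioms Jsub M') {f g : Emb M M'}
    {a : M.carrier s} (ha : ∀ (t : Srt J) (b : M.carrier t), M.le a b)
    (h : ∀ x, M.Sim x a → f.toFun s x = g.toFun s x) (b : M.carrier t) :
    f.toFun t b = g.toFun t b := by
  obtain ⟨x, hx, hxb⟩ := hM.exists_preimage (ha t b)
  have C_g : M'.C (f.toFun s x) (g.toFun t b) := h x hx ▸ (g.map_C x b).2 hxb
  exact hM'.image_unique ((f.map_C x b).2 hxb) C_g ⟨le_of_eqOn_least.{u, v} hM hM' ha h b,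
    le_of_eqOn_least.{u, v} hM hM' ha (fun y hy => (h y hy).symm) b⟩

end

/-! ### Finite tuples -/

section

variable {J : Type u} {M : Str.{u, w} J} {M' : Str.{u, w'} J} {N : Str.{u, w''} J} {n : ℕ}
  {σ : Fin n → Srt J} {I : Set (Fin n)}

/-- The members of a tuple with index in `I`. -/
def entries (e : ∀ i, M.carrier (σ i)) (I : Set (Fin n)) : Set M.Elt :=
  (fun i => ⟨σ i, e i⟩) '' I

theorem mk_mem_entries {e : ∀ i, M.carrier (σ i)} {i : Fin n} (hi : i ∈ I) :
    (⟨σ i, e i⟩ : M.Elt) ∈ entries e I :=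
  ⟨i, hi, rfl⟩

theorem image_elt_entries (f : Emb M N) (e : ∀ i, M.carrier (σ i)) (I : Set (Fin n)) :
    f.elt '' entries e I = entries (fun i => f.toFun _ (e i)) I :=
  Set.image_image _ _ _

theorem exists_entries_eq {X : Set M.Elt} (hX : X.Finite) :
    ∃ (n : ℕ) (σ : Fin n → Srt J) (e : ∀ i, M.carrier (σ i)), entries e Set.univ = X := by
  obtain ⟨n, f, -, rfl⟩ := hX.fin_param
  exact ⟨n, fun i => (f i).1, fun i => (f i).2, Set.image_univ⟩

theorem locallyFull_entries_iff {e : ∀ i, M.carrier (σ i)} :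
    LocallyFull M (entries e I) ↔ ∀ i ∈ I, ∀ y : M.carrier (σ i), M.Sim y (e i) →
      ∃ j ∈ I, (⟨σ j, e j⟩ : M.Elt) = ⟨σ i, y⟩ := by
  constructor
  · exact fun h i hi y hy => h _ _ y (mk_mem_entries hi) hy.2 hy.1
  · rintro h s a b ⟨i, hi, hia⟩ hab hba
    obtain rfl : σ i = s := congrArg Sigma.fst hia
    obtain rfl : e i = a := eq_of_heq (Sigma.mk.inj hia).2
    exact h i hi b ⟨hba, hab⟩

theorem isFrame_entries_iff {e : ∀ i, M.carrier (σ i)} :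
    IsFrame M (entries e I) ↔
      LocallyFull M (entries e I) ∧ ∃ i ∈ I, ∀ j ∈ I, M.le (e i) (e j) := by
  constructor
  · rintro ⟨-, h, _, ⟨i, hi, rfl⟩, hle⟩
    exact ⟨h, i, hi, fun j hj => hle _ (mk_mem_entries hj)⟩
  · rintro ⟨h, i, hi, hle⟩
    exact ⟨(Set.toFinite I).image _, h, _, mk_mem_entries hi, Set.forall_mem_image.2 hle⟩

theorem PartialIso.mono {T T' : M.Elt → M'.Elt → Prop} (hT : PartialIso T)
    (h : ∀ p p', T' p p' → T p p') : PartialIso T' where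
  sort hp := hT.sort (h _ _ hp)
  le hp hq := hT.le (h _ _ hp) (h _ _ hq)
  C hp hq := hT.C (h _ _ hp) (h _ _ hq)
  P hp hq hr := hT.P (h _ _ hp) (h _ _ hq) (h _ _ hr)

theorem Emb.map_PElt (f : Emb M N) (p q r : M.Elt) :
    N.PElt (f.elt p) (f.elt q) (f.elt r) ↔ M.PElt p q r := by
  constructor
  · obtain ⟨s, a⟩ := p
    obtain ⟨t, b⟩ := q
    obtain ⟨r, c⟩ := r
    rintro ⟨s', a', b', c', ha, hb, hc, h⟩
    obtain rfl : s = s' := congrArg Sigma.fst ha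
    obtain rfl : t = s := congrArg Sigma.fst hb
    obtain rfl : r = t := congrArg Sigma.fst hc
    exact Str.PElt_mk.2 ((f.map_P a b c).1 (Str.PElt_mk.1 ⟨_, _, _, _, ha, hb, hc, h⟩))
  · rintro ⟨s, a, b, c, rfl, rfl, rfl, h⟩
    exact Str.PElt_mk.2 ((f.map_P a b c).2 h)

theorem Emb.partialIso (f : Emb N M) (g : Emb N M') :
    PartialIso fun p p' => ∃ q, f.elt q = p ∧ g.elt q = p' where
  sort := by
    rintro _ _ ⟨q, rfl, rfl⟩
    rfl
  le := by
    rintro _ _ _ _ ⟨q, rfl, rfl⟩ ⟨r, rfl, rfl⟩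
    exact (f.map_le _ _).trans (g.map_le _ _).symm
  C := by
    rintro _ _ _ _ ⟨q, rfl, rfl⟩ ⟨r, rfl, rfl⟩
    exact (f.map_C _ _).trans (g.map_C _ _).symm
  P := by
    rintro _ _ _ _ _ _ ⟨q, rfl, rfl⟩ ⟨r, rfl, rfl⟩ ⟨k, rfl, rfl⟩
    exact (f.map_PElt _ _ _).trans (g.map_PElt _ _ _).symm

/-- The tuples `e` and `e'` satisfy the same atomic formulas in the variables with index in `I`. -/
def SameType (I : Set (Fin n)) (e : ∀ i, M.carrier (σ i)) (e' : ∀ i, M'.carrier (σ i)) : Prop :=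
  PartialIso fun (p : M.Elt) (p' : M'.Elt) => ∃ i ∈ I, ⟨σ i, e i⟩ = p ∧ ⟨σ i, e' i⟩ = p'

theorem PartialIso.sameType {T : M.Elt → M'.Elt → Prop} (hT : PartialIso T)
    {e : ∀ i, M.carrier (σ i)} {e' : ∀ i, M'.carrier (σ i)}
    (h : ∀ i ∈ I, T ⟨σ i, e i⟩ ⟨σ i, e' i⟩) : SameType I e e' := by
  refine hT.mono ?_
  rintro _ _ ⟨i, hi, rfl, rfl⟩
  exact h i hi

theorem Emb.sameType (f : Emb N M) (g : Emb N M') (e : ∀ i, N.carrier (σ i)) :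
    SameType I (fun i => f.toFun _ (e i)) (fun i => g.toFun _ (e i)) :=
  (f.partialIso g).sameType fun i _ => ⟨⟨σ i, e i⟩, rfl, rfl⟩

theorem sameType_iff {e : ∀ i, M.carrier (σ i)} {e' : ∀ i, M'.carrier (σ i)} :
    SameType I e e' ↔
      (∀ i ∈ I, ∀ j ∈ I, (M.le (e i) (e j) ↔ M'.le (e' i) (e' j))) ∧
      (∀ i ∈ I, ∀ j ∈ I, (M.C (e i) (e j) ↔ M'.C (e' i) (e' j))) ∧
      ∀ i ∈ I, ∀ j ∈ I, ∀ k ∈ I,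
        (M.PElt ⟨_, e i⟩ ⟨_, e j⟩ ⟨_, e k⟩ ↔ M'.PElt ⟨_, e' i⟩ ⟨_, e' j⟩ ⟨_, e' k⟩) := by
  constructor
  · have related {i} (hi : i ∈ I) : ∃ j ∈ I, (⟨σ j, e j⟩ : M.Elt) = ⟨σ i, e i⟩ ∧
        (⟨σ j, e' j⟩ : M'.Elt) = ⟨σ i, e' i⟩ := ⟨i, hi, rfl, rfl⟩
    exact fun h => ⟨fun i hi j hj => h.le (related hi) (related hj),
      fun i hi j hj => h.C (related hi) (related hj),
      fun i hi j hj k hk => h.P (related hi) (related hj) (related hk)⟩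
  · rintro ⟨hle, hC, hP⟩
    refine ⟨?_, ?_, ?_, ?_⟩
    · rintro _ _ ⟨i, -, rfl, rfl⟩
      rfl
    · rintro _ _ _ _ ⟨i, hi, rfl, rfl⟩ ⟨j, hj, rfl, rfl⟩
      exact hle i hi j hj
    · rintro _ _ _ _ ⟨i, hi, rfl, rfl⟩ ⟨j, hj, rfl, rfl⟩
      exact hC i hi j hj
    · rintro _ _ _ _ _ _ ⟨i, hi, rfl, rfl⟩ ⟨j, hj, rfl, rfl⟩ ⟨k, hk, rfl, rfl⟩
      exact hP i hi j hj k hk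

end

/-! ### Definability of properties of tuples -/

namespace Definable

variable {J : Type u} {E : Str.{u, w} J → Type (max u w)} {c : Ctx E} {n : ℕ} {σ : Fin n → Srt J}
  {I : Set (Fin n)} {e e' : ∀ M : Str.{u, w} J, E M → ∀ i, M.carrier (σ i)}

theorem pElt {s t r : Srt J} {a : ∀ M : Str.{u, w} J, E M → M.carrier s}
    {b : ∀ M : Str.{u, w} J, E M → M.carrier t} {d : ∀ M : Str.{u, w} J, E M → M.carrier r}
    (ha : Reads c a) (hb : Reads c b) (hd : Reads c d) :
    Definable c (fun M p => M.PElt ⟨s, a M p⟩ ⟨t, b M p⟩ ⟨r, d M p⟩) := by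
  by_cases h : s = t ∧ s = r
  · obtain ⟨rfl, rfl⟩ := h
    exact (Definable.P ha hb hd).congr fun _ _ => Str.PElt_mk
  · refine (Definable.const False).congr fun M p => iff_false_intro ?_
    rintro ⟨q, x, y, z, hx, hy, hz, -⟩
    exact h ⟨(congrArg Sigma.fst hx).trans (congrArg Sigma.fst hy).symm,
      (congrArg Sigma.fst hx).trans (congrArg Sigma.fst hz).symm⟩

theorem locallyFull_entries (he : ∀ i, Reads c (fun M p => e M p i)) :
    Definable c (fun M p => LocallyFull M (entries (e M p) I)) :=
  Definable.congr (.forall_finite fun i => .imp (.const _) <| .all <|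
    .imp (.sim .zero (he i).succ) <| .exists_finite fun j => .and (.const _) <|
    .elt_eq (he j).succ .zero) fun _ _ => locallyFull_entries_iff

theorem isFrame_entries (he : ∀ i, Reads c (fun M p => e M p i)) :
    Definable c (fun M p => IsFrame M (entries (e M p) I)) :=
  Definable.congr (.and (.locallyFull_entries he) <| .exists_finite fun i => .and (.const _) <|
    .forall_finite fun j => .imp (.const _) <| .le (he i) (he j)) fun _ _ => isFrame_entries_iff

theorem sameType_of_atomic {N : ∀ M : Str.{u, w} J, E M → Str.{u, w'} J}
    {d : ∀ M p i, (N M p).carrier (σ i)}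
    (hle : ∀ i j, Definable c (fun M p => (N M p).le (d M p i) (d M p j)))
    (hC : ∀ i j, Definable c (fun M p => (N M p).C (d M p i) (d M p j)))
    (hP : ∀ i j k, Definable c
      (fun M p => (N M p).PElt ⟨_, d M p i⟩ ⟨_, d M p j⟩ ⟨_, d M p k⟩))
    (he : ∀ i, Reads c (fun M p => e M p i)) :
    Definable c (fun M p => SameType I (d M p) (e M p)) := by
  refine Definable.congr ?_ fun M p => sameType_iff
  refine .and ?_ <| .and ?_ ?_
  · exact .forall_finite fun i => .imp (.const _) <| .forall_finite fun j => .imp (.const _) <|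
      .iff (hle i j) (.le (he i) (he j))
  · exact .forall_finite fun i => .imp (.const _) <| .forall_finite fun j => .imp (.const _) <|
      .iff (hC i j) (.C (he i) (he j))
  · exact .forall_finite fun i => .imp (.const _) <| .forall_finite fun j => .imp (.const _) <|
      .forall_finite fun k => .imp (.const _) <| .iff (hP i j k) (.pElt (he i) (he j) (he k))

theorem sameType (he : ∀ i, Reads c (fun M p => e M p i))
    (he' : ∀ i, Reads c (fun M p => e' M p i)) :
    Definable c (fun M p => SameType I (e M p) (e' M p)) :=
  .sameType_of_atomic (fun i j => .le (he i) (he j)) (fun i j => .C (he i) (he j))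
    (fun i j k => .pElt (he i) (he j) (he k)) he'

end Definable

section

variable {J : Type u} {n : ℕ} (σ : Fin n → Srt J) (I : Set (Fin n))

/-- An instance of the co-sorted embedding property that a first-order sentence can express. The
tuple `e` enumerates a frame of the larger subsystem, `I` selects a frame of the smaller one, and
`z` and `x` are the values on these frames of the embedding to be extended and of its extension. -/
def TupleExtension (M : Str.{u, w} J) : Prop :=
  ∀ e z : ∀ i, M.carrier (σ i), IsFrame M (entries e Set.univ) → IsFrame M (entries e I) →
    SameType I e z → LocallyFull M (entries z I) →
    ∃ x : ∀ i, M.carrier (σ i), (∀ i ∈ I, x i = z i) ∧ SameType Set.univ e x ∧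
      LocallyFull M (entries x Set.univ)

theorem firstOrder_tupleExtension : FirstOrder (TupleExtension.{u, w} σ I) :=
  .allBlock <| .allBlock <|
    .imp (.isFrame_entries fun i => .succBlock <| .block i) <|
    .imp (.isFrame_entries fun i => .succBlock <| .block i) <|
    .imp (.sameType (fun i => .succBlock <| .block i) fun i => .block i) <|
    .imp (.locallyFull_entries fun i => .block i) <|
    .exBlock <| .and (.forall_finite fun i => .imp (.const _) <|
      .eq (.block i) (.succBlock <| .block i)) <|
    .and (.sameType (fun i => .succBlock <| .succBlock <| .block i) fun i => .block i) <|
    .locallyFull_entries fun i => .block i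

variable {σ} in
theorem firstOrder_exists_sameType {N : Str.{u, w'} J} (d : ∀ i, N.carrier (σ i)) :
    FirstOrder fun M : Str.{u, w} J =>
      ∃ x : ∀ i, M.carrier (σ i), SameType Set.univ d x ∧ LocallyFull M (entries x Set.univ) :=
  .exBlock <| .and (.sameType_of_atomic (fun _ _ => .const _) (fun _ _ => .const _)
    (fun _ _ _ => .const _) fun i => .block i) <| .locallyFull_entries fun i => .block i

end

/-! ### Embeddings of finitely generated systems -/

section

variable {J : Type u} {Jsub : ℕ+ → Tup J → Tup J} {M : Str.{u, w} J}

/-- The identity embedding. -/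
def Emb.refl (M : Str.{u, w} J) : Emb M M where
  toFun _ := id
  inj _ := Function.injective_id
  map_le _ _ := Iff.rfl
  map_C _ _ := Iff.rfl
  map_P _ _ _ := Iff.rfl

theorem image_inclusion_univ (B : Set M.Elt) : (inclusion M B).elt '' Set.univ = B := by
  ext ⟨s, a⟩
  exact Emb.mk_mem_image_elt.trans
    ⟨fun ⟨b, _, hba⟩ => hba ▸ b.2, fun ha => ⟨⟨a, ha⟩, trivial, rfl⟩⟩

theorem LocallyFull.of_image {N : Str.{u, w'} J} {f : Emb M N} {X : Set M.Elt}
    (h : LocallyFull N (f.elt '' X)) : LocallyFull M X := by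
  intro s a b ha hab hba
  obtain ⟨c, hc, hcb⟩ := Emb.mk_mem_image_elt.1 <|
    h s _ (f.toFun s b) ⟨_, ha, rfl⟩ ((f.map_le a b).2 hab) ((f.map_le b a).2 hba)
  exact f.inj s hcb ▸ hc

theorem omitted_iff {A : Str.{u, w} J} : Omitted Jsub A M ↔ ¬ Occurs Jsub A M := by
  simp only [Omitted, Occurs, not_exists, not_and]

theorem Expresses.omitted {A : Str.{u, w} J} {φ : Sentence J}
    (h : Expresses Jsub φ (Occurs Jsub A)) :
    Expresses Jsub (.imp φ .falsum) (Omitted Jsub A) :=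
  fun M hM => (not_congr (h M hM)).trans omitted_iff.symm

end

section

variable {J : Type u} {Jsub : ℕ+ → Tup J → Tup J} [Nonempty (Tup J)]
  {M M' A B S : Str.{u, max u v} J}

theorem SameType.exists_emb (hM : SCSAxioms Jsub M) (hM' : SCSAxioms Jsub M') {n : ℕ}
    {σ : Fin n → Srt J} {I : Set (Fin n)} {e : ∀ i, M.carrier (σ i)}
    {e' : ∀ i, M'.carrier (σ i)} (h : SameType I e e') (he : IsFrame M (entries e I))
    (he' : LocallyFull M' (entries e' I)) :
    ∃ f : Emb (M.restrict (generated Jsub M (entries e I))) M',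
      ∀ i ∈ I, ∀ hi : (⟨σ i, e i⟩ : M.Elt) ∈ generated Jsub M (entries e I),
        f.toFun (σ i) ⟨e i, hi⟩ = e' i := by
  have dom : {p | ∃ p' : M'.Elt, ∃ i ∈ I, (⟨σ i, e i⟩ : M.Elt) = p ∧ ⟨σ i, e' i⟩ = p'} =
      entries e I :=
    Set.ext fun p => ⟨fun ⟨_, i, hi, hp, _⟩ => ⟨i, hi, hp⟩, fun ⟨i, hi, hp⟩ => ⟨_, i, hi, hp, rfl⟩⟩
  have ran : {p' | ∃ p : M.Elt, ∃ i ∈ I, ⟨σ i, e i⟩ = p ∧ (⟨σ i, e' i⟩ : M'.Elt) = p'} =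
      entries e' I :=
    Set.ext fun p => ⟨fun ⟨_, i, hi, _, hp⟩ => ⟨i, hi, hp⟩, fun ⟨i, hi, hp⟩ => ⟨_, i, hi, rfl, hp⟩⟩
  have exists_emb := PartialIso.exists_emb.{u, v} hM hM' h (dom ▸ he) (ran ▸ he')
  rw [dom] at exists_emb
  obtain ⟨f, hf⟩ := exists_emb
  exact ⟨f, fun i hi hg => eq_of_heq (Sigma.mk.inj (hf _ _ ⟨i, hi, rfl, rfl⟩ hg)).2⟩

theorem SCSAxioms.isFGSubsystem_generated (hM : SCSAxioms Jsub M) {X : Set M.Elt}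
    (hX : X.Finite) : IsFGSubsystem Jsub M (generated Jsub M X) :=
  ⟨(hM.closed_generated X).isSubsystem.{u, v} hM, X, hX, rfl⟩

theorem IsFGSubsystem.isFGSystem_restrict (hM : SCSAxioms Jsub M) {B : Set M.Elt}
    (hB : IsFGSubsystem Jsub M B) : IsFGSystem Jsub (M.restrict B) := by
  obtain ⟨hB, X, hX, hXB⟩ := hB
  let ι := inclusion M B
  have image_preimage : ι.elt '' (ι.elt ⁻¹' X) = X := by
    rw [Set.image_preimage_eq_iff, ← Set.image_univ, image_inclusion_univ, ← hXB]
    exact subset_generated X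
  refine ⟨hB, ι.elt ⁻¹' X, hX.preimage ι.elt_injective.injOn, ?_⟩
  apply ι.elt_injective.image_injective
  rw [hB.scsAxioms.image_generated.{u, v} hM, image_preimage, hXB, image_inclusion_univ]

theorem IsFGSystem.image (hA : IsFGSystem Jsub A) (hM : SCSAxioms Jsub M) (f : Emb A M) :
    IsFGSubsystem Jsub M (f.elt '' Set.univ) := by
  obtain ⟨hA, X, hX, hXA⟩ := hA
  rw [← hXA, hA.scsAxioms.image_generated.{u, v} hM]
  exact hM.isFGSubsystem_generated.{u, v} (hX.image _)

theorem IsFGSystem.exists_isFrame (hA : IsFGSystem Jsub A) :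
    ∃ X, IsFrame A X ∧ generated Jsub A X = Set.univ := by
  obtain ⟨hA, X, hX, hXA⟩ := hA
  obtain ⟨Y, hY, -, hYX⟩ := hA.scsAxioms.exists_isFrame.{u, v} hX
  exact ⟨Y, hY, hYX.trans hXA⟩

theorem inCoFSIm_iff (hA : IsFGSystem Jsub A) (hM : SCSAxioms Jsub M) :
    InCoFSIm Jsub M A ↔ Nonempty (Emb A M) := by
  constructor
  · rintro ⟨B, -, iso⟩
    obtain ⟨f, -⟩ := iso.symm
    exact ⟨(inclusion M B).comp f⟩
  · rintro ⟨f⟩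
    exact ⟨_, hA.image.{u, v} hM f, f.iso_restrict_range.symm⟩

theorem occurs_iff (hA : IsFGSystem Jsub A) (hM : SCSAxioms Jsub M) :
    Occurs Jsub A M ↔ Nonempty (Emb A M) := by
  constructor
  · rintro ⟨X, -, -, iso⟩
    obtain ⟨f, -⟩ := iso.symm
    exact ⟨(inclusion M _).comp f⟩
  · rintro ⟨f⟩
    obtain ⟨X, hX, hXA⟩ := hA.exists_isFrame.{u, v}
    have hfX := hX.image.{u, v} hA.1.scsAxioms hM f
    refine ⟨f.elt '' X, hfX.finite, hfX.isPresystem.{u, v} hM, ?_⟩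
    rw [← hA.1.scsAxioms.image_generated.{u, v} hM, hXA]
    exact f.iso_restrict_range.symm

theorem exists_expresses_occurs (hA : IsFGSystem Jsub A) :
    ∃ φ : Sentence J, Expresses Jsub φ (Occurs Jsub A) := by
  obtain ⟨X, hX, hXA⟩ := hA.exists_isFrame.{u, v}
  obtain ⟨n, σ, d, rfl⟩ := exists_entries_eq hX.finite
  obtain ⟨φ, hφ⟩ := (firstOrder_exists_sameType d).exists_sentence
  refine ⟨φ, fun M hM => (hφ M).trans <| Iff.trans ?_ (occurs_iff.{u, v} hA hM.scsAxioms).symm⟩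
  constructor
  · rintro ⟨x, hdx, hx⟩
    obtain ⟨f, -⟩ := hdx.exists_emb.{u, v} hA.1.scsAxioms hM.scsAxioms hX hx
    exact ⟨f.comp ((Emb.refl A).codRestrict fun _ _ => hXA ▸ trivial)⟩
  · rintro ⟨f⟩
    refine ⟨fun i => f.toFun _ (d i), (Emb.refl A).sameType f d, ?_⟩
    rw [← image_elt_entries]
    exact (hX.image.{u, v} hA.1.scsAxioms hM.scsAxioms f).locallyFull

/-! ### The co-sorted embedding property is first-order -/

theorem CoSEP.tupleExtension (hM : SCSAxioms Jsub M) (hco : CoSEP Jsub M) {n : ℕ}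
    (σ : Fin n → Srt J) (I : Set (Fin n)) : TupleExtension σ I M := by
  intro e z he heI hez hz
  obtain ⟨f, hf⟩ := hez.exists_emb.{u, v} hM hM heI hz
  have generated_subset :=
    hM.generated_subset_generated.{u, v} ((Set.image_mono (Set.subset_univ I)).trans
      (subset_generated (entries e Set.univ)))
  let ι := (inclusion M (generated Jsub M (entries e I))).codRestrict
    fun _ a => generated_subset a.2
  obtain ⟨g, hg⟩ := hco _ _ (hM.isFGSubsystem_generated.{u, v} he.finite)
    (hM.isFGSubsystem_generated.{u, v} heI.finite) ι f
  let d (i) : (M.restrict (generated Jsub M (entries e Set.univ))).carrier (σ i) :=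
    ⟨e i, subset_generated _ (mk_mem_entries trivial)⟩
  refine ⟨fun i => g.toFun _ (d i), fun i hi => ?_, (inclusion M _).sameType g d, ?_⟩
  · have he_mem := subset_generated (Jsub := Jsub) _ (mk_mem_entries (e := e) hi)
    exact (hg _ ⟨e i, he_mem⟩).trans (hf i hi he_mem)
  · have full_image : LocallyFull M ((inclusion M _).elt '' entries d Set.univ) := by
      rw [image_elt_entries]
      exact he.locallyFull
    rw [← image_elt_entries]
    exact full_image.of_image.image.{u, v} ((hM.closed_generated _).scsAxioms hM) hM g

theorem PartialIso.exists_emb_of_tupleExtension (hM : SCSAxioms Jsub M)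
    (h : ∀ (n : ℕ) (σ : Fin n → Srt J) (I : Set (Fin n)), TupleExtension σ I M)
    {T : M.Elt → M.Elt → Prop} (hT : PartialIso T) (hdom : IsFrame M {p | ∃ p', T p p'})
    (hran : LocallyFull M {p' | ∃ p, T p p'}) {Z : Set M.Elt} (hZ : IsFrame M Z)
    (hdomZ : {p | ∃ p', T p p'} ⊆ Z) :
    ∃ f : Emb (M.restrict (generated Jsub M Z)) M,
      ∀ p p', T p p' → ∀ hp : p ∈ generated Jsub M Z, f.elt ⟨p.1, ⟨p.2, hp⟩⟩ = p' := by
  obtain ⟨n, σ, e, rfl⟩ := exists_entries_eq hZ.finite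
  let I : Set (Fin n) := {i | ∃ p', T ⟨σ i, e i⟩ p'}
  have exists_value (i) : ∃ z : M.carrier (σ i), i ∈ I → T ⟨σ i, e i⟩ ⟨σ i, z⟩ := by
    by_cases hi : i ∈ I
    · obtain ⟨⟨s, z⟩, hz⟩ := hi
      obtain rfl : σ i = s := hT.sort hz
      exact ⟨z, fun _ => hz⟩
    · exact ⟨e i, fun hi' => absurd hi' hi⟩
  choose z hz using exists_value
  have eq_entries {p p'} (hp : T p p') : ∃ i ∈ I, ⟨σ i, e i⟩ = p ∧ ⟨σ i, z i⟩ = p' := by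
    obtain ⟨i, -, rfl⟩ := hdomZ ⟨p', hp⟩
    exact ⟨i, ⟨p', hp⟩, rfl, hT.right_unique hM hM (hz i ⟨p', hp⟩) hp⟩
  have dom : {p | ∃ p', T p p'} = entries e I := by
    ext p
    refine ⟨fun ⟨p', hp⟩ => ?_, ?_⟩
    · obtain ⟨i, hi, hip, -⟩ := eq_entries hp
      exact ⟨i, hi, hip⟩
    · rintro ⟨i, hi, rfl⟩
      exact hi
  have ran : {p' | ∃ p, T p p'} = entries z I := by
    ext p'
    refine ⟨fun ⟨p, hp⟩ => ?_, ?_⟩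
    · obtain ⟨i, hi, -, hip⟩ := eq_entries hp
      exact ⟨i, hi, hip⟩
    · rintro ⟨i, hi, rfl⟩
      exact ⟨_, hz i hi⟩
  obtain ⟨x, hxz, hex, hx⟩ := h n σ I e z hZ (dom ▸ hdom) (hT.sameType hz) (ran ▸ hran)
  obtain ⟨f, hf⟩ := hex.exists_emb.{u, v} hM hM hZ hx
  refine ⟨f, fun p p' hp => ?_⟩
  obtain ⟨i, hi, rfl, rfl⟩ := eq_entries hp
  exact fun hp_mem => congrArg (Sigma.mk (σ i)) ((hf i trivial hp_mem).trans (hxz i hi))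

theorem CoSEP.of_tupleExtension (hM : SCSAxioms Jsub M)
    (h : ∀ (n : ℕ) (σ : Fin n → Srt J) (I : Set (Fin n)), TupleExtension σ I M) :
    CoSEP Jsub M := by
  rintro _ B ⟨-, X, hX, rfl⟩ hB p f
  have hB' := hB.isFGSystem_restrict.{u, v} hM
  have hBax := hB'.1.scsAxioms
  obtain ⟨Y, hY, hYB⟩ := hB'.exists_isFrame.{u, v}
  let k := (inclusion M (generated Jsub M X)).comp p
  let T (q q' : M.Elt) : Prop := ∃ r ∈ Y, k.elt r = q ∧ f.elt r = q'
  have hT : PartialIso T :=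
    (k.partialIso f).mono fun _ _ ⟨r, _, hr⟩ => ⟨r, hr⟩
  have dom : {q | ∃ q', T q q'} = k.elt '' Y :=
    Set.ext fun q => ⟨fun ⟨_, r, hr, hq, _⟩ => ⟨r, hr, hq⟩, fun ⟨r, hr, hq⟩ => ⟨_, r, hr, hq, rfl⟩⟩
  have ran : {q' | ∃ q, T q q'} = f.elt '' Y :=
    Set.ext fun q => ⟨fun ⟨_, r, hr, _, hq⟩ => ⟨r, hr, hq⟩, fun ⟨r, hr, hq⟩ => ⟨_, r, hr, rfl, hq⟩⟩
  have k_mem (r) : k.elt r ∈ generated Jsub M X := (p.elt r).2.2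
  obtain ⟨Z, hZ, hXZ, hZX⟩ := hM.exists_isFrame.{u, v} (hX.union (hY.finite.image k.elt))
  have generated_eq : generated Jsub M Z = generated Jsub M X := hZX.trans <| subset_antisymm
    (hM.generated_subset_generated.{u, v} <| Set.union_subset (subset_generated X) <|
      Set.image_subset_iff.2 fun r _ => k_mem r)
    (hM.generated_subset_generated.{u, v} <| Set.subset_union_left.trans (subset_generated _))
  have exists_emb := hT.exists_emb_of_tupleExtension.{u, v} hM h
    (dom ▸ hY.image.{u, v} hBax hM k) (ran ▸ (hY.image.{u, v} hBax hM f).locallyFull) hZ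
    (dom ▸ Set.subset_union_right.trans hXZ)
  rw [generated_eq] at exists_emb
  obtain ⟨g, hg⟩ := exists_emb
  obtain ⟨⟨s, a⟩, ha, a_le⟩ := hY.exists_forall_mem_generated_le.{u, v} hBax
  refine ⟨g, fun t b => Emb.eq_of_eqOn_least.{u, v} (f := g.comp p) (a := a) hBax hM
    (fun t b => a_le ⟨t, b⟩ (hYB ▸ trivial)) (fun x hx => ?_) b⟩
  have hxY := hY.locallyFull s a x ha hx.2 hx.1
  exact eq_of_heq (Sigma.mk.inj (hg _ _ ⟨_, hxY, rfl, rfl⟩ (k_mem ⟨s, x⟩))).2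

theorem CoSEP.exists_extension (hS : SCSAxioms Jsub S) (hco : CoSEP Jsub S)
    (hA : IsFGSystem Jsub A) (hB : IsFGSystem Jsub B) (p : Emb B A) (f : Emb B S) (k : Emb A S) :
    ∃ g : Emb A S, ∀ s b, g.toFun s (p.toFun s b) = f.toFun s b := by
  obtain ⟨r, hr⟩ := (k.comp p).exists_leftInverse
  let ι := (inclusion S ((k.comp p).elt '' Set.univ)).codRestrict (B := k.elt '' Set.univ) <| by
    rintro s ⟨_, hb⟩
    obtain ⟨b, -, rfl⟩ := Emb.mk_mem_image_elt.1 hb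
    exact ⟨⟨s, p.toFun s b⟩, trivial, rfl⟩
  obtain ⟨g, hg⟩ := hco _ _ (hA.image.{u, v} hS k) (hB.image.{u, v} hS (k.comp p)) ι (f.comp r)
  refine ⟨g.comp (k.codRestrict fun s a => ⟨⟨s, a⟩, trivial, rfl⟩), fun s b => ?_⟩
  exact (hg s ⟨_, ⟨⟨s, b⟩, trivial, rfl⟩⟩).trans (congrArg (f.toFun s) (hr s b _))

end

/-! ### Back and forth -/

theorem isModel_union_iff {J : Type u} {M : Str.{u, w} J} {T T' : Set (Sentence J)} :
    IsModel M (T ∪ T') ↔ IsModel M T ∧ IsModel M T' :=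
  forall₂_or_left

section

variable {J : Type u} {Jsub : ℕ+ → Tup J → Tup J} {M S : Str.{u, max u v} J}

/-- The assignments `e` and `e'` are the images of one assignment under two embeddings of a finitely
generated system. -/
def Similar (Jsub : ℕ+ → Tup J → Tup J) {Γ : List (Srt J)} (e : Env M Γ) (e' : Env S Γ) : Prop :=
  ∃ A : Str.{u, max u v} J, IsFGSystem Jsub A ∧ ∃ (f : Emb A M) (g : Emb A S) (d : Env A Γ),
    (∀ s x, e s x = f.toFun s (d s x)) ∧ ∀ s x, e' s x = g.toFun s (d s x)

variable {Γ : List (Srt J)} {e : Env M Γ} {e' : Env S Γ}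

theorem Similar.symm (h : Similar Jsub e e') : Similar Jsub e' e := by
  obtain ⟨A, hA, f, g, d, he, he'⟩ := h
  exact ⟨A, hA, g, f, d, he', he⟩

variable [Nonempty (Tup J)]

theorem Similar.forth (hM : SCSAxioms Jsub M) (hS : SCSAxioms Jsub S) (hco : CoSEP Jsub S)
    (hMS : ∀ A : Str.{u, max u v} J, IsFGSystem Jsub A → Nonempty (Emb A M) → Nonempty (Emb A S))
    (h : Similar Jsub e e') {s : Srt J} (a : M.carrier s) :
    ∃ b : S.carrier s, Similar Jsub (Env.cons a e) (Env.cons b e') := by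
  obtain ⟨A, hA, f, g, d, he, he'⟩ := h
  obtain ⟨X, hX, hXA⟩ := hA.2
  let B := generated Jsub M (insert ⟨s, a⟩ (f.elt '' X))
  have hB : IsFGSystem Jsub (M.restrict B) := (hM.isFGSubsystem_generated.{u, v}
    ((hX.image f.elt).insert ⟨s, a⟩)).isFGSystem_restrict.{u, v} hM
  have image_subset : f.elt '' Set.univ ⊆ B := by
    rw [← hXA, hA.1.scsAxioms.image_generated.{u, v} hM]
    exact hM.generated_subset_generated.{u, v} ((Set.subset_insert _ _).trans (subset_generated _))
  let p : Emb A (M.restrict B) := f.codRestrict fun t b => image_subset ⟨⟨t, b⟩, trivial, rfl⟩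
  let a' : (M.restrict B).carrier s := ⟨a, subset_generated _ (Set.mem_insert _ _)⟩
  obtain ⟨k⟩ := hMS _ hB ⟨inclusion M B⟩
  obtain ⟨q, hq⟩ := hco.exists_extension.{u, v} hS hB hA p g k
  refine ⟨q.toFun s a', _, hB, inclusion M B, q, Env.cons a' fun t x => p.toFun t (d t x), ?_, ?_⟩
  · rintro t (_ | x)
    exacts [rfl, he t _]
  · rintro t (_ | x)
    exacts [rfl, (he' t _).trans (hq t _).symm]

theorem Similar.sat_iff (hM : SCSAxioms Jsub M) (hS : SCSAxioms Jsub S) (hcoM : CoSEP Jsub M)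
    (hcoS : CoSEP Jsub S)
    (hMS : ∀ A : Str.{u, max u v} J, IsFGSystem Jsub A →
      (Nonempty (Emb A M) ↔ Nonempty (Emb A S))) (φ : Fml J Γ)
    (h : Similar Jsub e e') : Sat M φ e ↔ Sat S φ e' := by
  induction φ with
  | falsum => exact Iff.rfl
  | eq x y =>
    obtain ⟨A, -, f, g, d, he, he'⟩ := h
    rw [Sat, Sat, he, he, he', he', (f.inj _).eq_iff, (g.inj _).eq_iff]
  | le x y =>
    obtain ⟨A, -, f, g, d, he, he'⟩ := h
    rw [Sat, Sat, he, he, he', he', f.map_le, g.map_le]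
  | C x y =>
    obtain ⟨A, -, f, g, d, he, he'⟩ := h
    rw [Sat, Sat, he, he, he', he', f.map_C, g.map_C]
  | P x y z =>
    obtain ⟨A, -, f, g, d, he, he'⟩ := h
    rw [Sat, Sat, he, he, he, he', he', he', f.map_P, g.map_P]
  | imp φ ψ ihφ ihψ => exact imp_congr (ihφ h) (ihψ h)
  | all s φ ih =>
    constructor
    · intro sat b
      obtain ⟨a, ha⟩ := h.symm.forth.{u, v} hS hM hcoM (fun A hA => (hMS A hA).2) b
      exact (ih ha.symm).1 (sat a)
    · intro sat a
      obtain ⟨b, hb⟩ := h.forth.{u, v} hM hS hcoS (fun A hA => (hMS A hA).1) a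
      exact (ih hb).2 (sat b)

theorem models_iff (hM : SCSAxioms Jsub M) (hS : SCSAxioms Jsub S) (hcoM : CoSEP Jsub M)
    (hcoS : CoSEP Jsub S)
    (hMS : ∀ A : Str.{u, max u v} J, IsFGSystem Jsub A →
      (Nonempty (Emb A M) ↔ Nonempty (Emb A S))) (φ : Sentence J) :
    Models M φ ↔ Models S φ := by
  have hA := (hM.isFGSubsystem_generated.{u, v} Set.finite_empty).isFGSystem_restrict.{u, v} hM
  have f := inclusion M (generated Jsub M ∅)
  obtain ⟨g⟩ := (hMS _ hA).1 ⟨f⟩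
  exact Similar.sat_iff.{u, v} hM hS hcoM hcoS hMS φ
    ⟨_, hA, f, g, Env.nil, (fun _ x => nomatch x), fun _ x => nomatch x⟩

variable (M) in
theorem isModel_SCSSEP_iff :
    IsModel M (SCSSEP.{u, max u v} Jsub) ↔ IsSCS Jsub M ∧ CoSEP Jsub M := by
  refine ⟨fun h => ?_, fun h φ hφ => hφ M h.1 h.2⟩
  let K : Set (Str.{u, max u v} J) := {N | IsSCS Jsub N ∧ CoSEP Jsub N}
  have mem_closure : M ∈ elementaryClosure K := by
    intro Q hQ hK
    obtain ⟨φ, hφ⟩ := hQ.exists_sentence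
    exact (hφ M).1 (h φ fun N hN hco => (hφ N).2 (hK N ⟨hN, hco⟩))
  have hM : SCSAxioms Jsub M :=
    SCSAxioms.of_mem_elementaryClosure (fun N hN => hN.1.scsAxioms) mem_closure
  refine ⟨hM.isSCS.{u, v}, CoSEP.of_tupleExtension.{u, v} hM fun n σ I => ?_⟩
  exact prop_of_mem_elementaryClosure mem_closure
    (fun N hN => hN.2.tupleExtension.{u, v} hN.1.scsAxioms σ I) (firstOrder_tupleExtension σ I)

theorem isModel_occurrenceAxioms_iff (hM : IsSCS Jsub M) (hS : SCSAxioms Jsub S) :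
    IsModel M (OccurrenceAxioms Jsub S) ↔
      ∀ A : Str.{u, max u v} J, IsFGSystem Jsub A → Nonempty (Emb A S) → Nonempty (Emb A M) := by
  constructor
  · intro h A hA hAS
    obtain ⟨φ, hφ⟩ := exists_expresses_occurs.{u, v} hA
    rw [← occurs_iff.{u, v} hA hM.scsAxioms, ← hφ M hM]
    exact h φ ⟨A, hA, (inCoFSIm_iff.{u, v} hA hS).2 hAS, hφ⟩
  · rintro h φ ⟨A, hA, hAS, hφ⟩
    rw [hφ M hM, occurs_iff.{u, v} hA hM.scsAxioms]
    exact h A hA ((inCoFSIm_iff.{u, v} hA hS).1 hAS)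

theorem isModel_omissionAxioms_iff (hM : IsSCS Jsub M) (hS : SCSAxioms Jsub S) :
    IsModel M (OmissionAxioms Jsub S) ↔
      ∀ A : Str.{u, max u v} J, IsFGSystem Jsub A → Nonempty (Emb A M) → Nonempty (Emb A S) := by
  constructor
  · intro h A hA
    contrapose
    intro hAS
    obtain ⟨φ, hφ⟩ := exists_expresses_occurs.{u, v} hA
    rw [← occurs_iff.{u, v} hA hM.scsAxioms, ← omitted_iff, ← hφ.omitted M hM]
    exact h _ ⟨A, hA, mt (inCoFSIm_iff.{u, v} hA hS).1 hAS, hφ.omitted⟩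
  · rintro h φ ⟨A, hA, hAS, hφ⟩
    rw [hφ M hM, omitted_iff, occurs_iff.{u, v} hA hM.scsAxioms]
    exact fun hAM => hAS ((inCoFSIm_iff.{u, v} hA hS).2 (h A hA hAM))

end

end SortedSystem

open SortedSystem in
theorem mainTheorem5_general {J : Type u} (Jsub : ℕ+ → Tup J → Tup J)
    (S : Str.{u, max u v} J) (hS : IsSCS Jsub S) (hco : CoSEP Jsub S) :
    (∀ M : Str.{u, max u v} J,
      IsModel M (SCSSEP.{u, max u v} Jsub) ↔ IsSCS Jsub M ∧ CoSEP Jsub M) ∧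
    (∀ A : Str.{u, max u v} J, IsFGSystem Jsub A →
      (∃ φ : Sentence J, Expresses Jsub φ (Occurs Jsub A)) ∧
      (∃ φ : Sentence J, Expresses Jsub φ (Omitted Jsub A))) ∧
    IsAxiomatizedBy.{u, max u v} (Th S)
      (SCSSEP.{u, max u v} Jsub ∪ OccurrenceAxioms Jsub S ∪ OmissionAxioms Jsub S) := by
  have := hS.nonempty_tup
  have hS' := hS.scsAxioms
  have axioms_S : IsModel S (SCSSEP Jsub ∪ OccurrenceAxioms Jsub S ∪ OmissionAxioms Jsub S) :=
    isModel_union_iff.2 ⟨isModel_union_iff.2 ⟨(isModel_SCSSEP_iff.{u, v} S).2 ⟨hS, hco⟩,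
      (isModel_occurrenceAxioms_iff.{u, v} hS hS').2 fun _ _ => id⟩,
      (isModel_omissionAxioms_iff.{u, v} hS hS').2 fun _ _ => id⟩
  refine ⟨fun M => isModel_SCSSEP_iff.{u, v} M, fun A hA => ?_,
    fun M => ⟨fun h φ hφ => h φ (axioms_S φ hφ), fun h => ?_⟩⟩
  · obtain ⟨φ, hφ⟩ := exists_expresses_occurs.{u, v} hA
    exact ⟨⟨φ, hφ⟩, _, hφ.omitted⟩
  · simp only [isModel_union_iff] at h
    obtain ⟨⟨hSEP, hocc⟩, hom⟩ := h
    obtain ⟨hM, hcoM⟩ := (isModel_SCSSEP_iff.{u, v} M).1 hSEP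
    have same_fg_subsystems (A : Str.{u, max u v} J) (hA : IsFGSystem Jsub A) :
        Nonempty (Emb A M) ↔ Nonempty (Emb A S) :=
      ⟨(isModel_omissionAxioms_iff.{u, v} hM hS').1 hom A hA,
        (isModel_occurrenceAxioms_iff.{u, v} hM hS').1 hocc A hA⟩
    exact fun φ hφ =>
      (models_iff.{u, v} hM.scsAxioms hS' hcoM hco same_fg_subsystems φ).2 hφ

theorem mainTheorem5 {J : Type u} [Countable J]
    (Jsub : ℕ+ → SortedSystem.Tup J → SortedSystem.Tup J)
    (S : SortedSystem.Str.{u, max u v} J)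
    (hS : SortedSystem.IsSCS Jsub S) (hco : SortedSystem.CoSEP Jsub S) :
    -- the models of the theory of co-SEP systems are exactly the co-SEP systems
    (∀ M : SortedSystem.Str.{u, max u v} J,
      SortedSystem.IsModel M (SortedSystem.SCSSEP.{u, max u v} Jsub) ↔
        SortedSystem.IsSCS Jsub M ∧ SortedSystem.CoSEP Jsub M) ∧
    -- each of the further axioms can be written as a first-order sentence
    (∀ A : SortedSystem.Str.{u, max u v} J, SortedSystem.IsFGSystem Jsub A →
      (∃ φ : SortedSystem.Sentence J,
        SortedSystem.Expresses Jsub φ (SortedSystem.Occurs Jsub A)) ∧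
      (∃ φ : SortedSystem.Sentence J,
        SortedSystem.Expresses Jsub φ (SortedSystem.Omitted Jsub A))) ∧
    -- these axioms axiomatize the complete theory of `S`
    SortedSystem.IsAxiomatizedBy.{u, max u v} (SortedSystem.Th S)
      (SortedSystem.SCSSEP.{u, max u v} Jsub ∪ SortedSystem.OccurrenceAxioms Jsub S ∪
        SortedSystem.OmissionAxioms Jsub S) :=
  mainTheorem5_general.{u, v} Jsub S hS hco
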